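/- **Setting.** Let $E=\mathbb R\times L^2(\mathbb R)$ with $\|(\alpha_1,\alpha_2)\|_E=|\alpha_1|+\|\alpha_2\|_{L^2}$, and $\|(s_1,s_2)\|_{E\times E}=\|s_1\|_E+\|s_2\|_E$. Fix $T,M>0$, $L\ge 0$ and a probability space $(\Omega,\mathcal F,\mathbb P)$. For $n\in\mathbb N$ let $\Delta x^{(n)},\Delta t^{(n)}>0$ and $\Delta v^{(n)},\Delta p^{(n)}\in\mathbb R$ with $$\Delta t^{(n)}\to0,\qquad \frac{\Delta x^{(n)}\Delta p^{(n)}}{\Delta t^{(n)}}\to1,\qquad \frac{\Delta v^{(n)}}{\Delta t^{(n)}}\to 1,\qquad \frac{\Delta x^{(n)}}{(\Delta t^{(n)})^{\beta}}\to1\ \text{ for some }\beta\in(0,1).$$ Put $x^{(n)}_j=j\Delta x^{(n)}$ for $j\in\mathbb Z$, $(T^{(n)}_\pm g)(x)=g(x\pm\Delta x^{(n)})$, and let $I$ be the identity. Let $\phi^{(n)}_k\in\{A,B,C,D,E,F\}$ (event types), $\omega^{(n)}_k\in\mathbb R$ (sizes) and $\pi^{(n)}_k\in\mathbb R$ (relative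 price levels), $k,n\ge 0$, be random variables, and write $\mathbf 1^{(n),J}_k=\mathbf 1_{\{\phi^{(n)}_k=J\}}$, $\mathbf 1^{(n),J-K}_k=\mathbf 1^{(n),J}_k-\mathbf 1^{(n),K}_k$ and $c^{(n)}_k(\cdot)=\sum_{j\in\mathbb Z}\mathbf 1_{\{\pi^{(n)}_k\in[x^{(n)}_j,x^{(n)}_{j+1})\}}\mathbf 1_{[x^{(n)}_j,x^{(n)}_{j+1})}(\cdot)$. The state $S^{(n)}_k=(A^{(n)}_k,v^{(n)}_{a,k},B^{(n)}_k,v^{(n)}_{b,k})\in E\times E$ starts at a deterministic $S^{(n)}_0$ and satisfies, for $k\ge1$, $$A^{(n)}_k=A^{(n)}_{k-1}+\mathbf 1^{(n),D-E}_{k-1}\Delta x^{(n)},\qquad B^{(n)}_k=B^{(n)}_{k-1}+\mathbf 1^{(n),B-A}_{k-1}\Delta x^{(n)},$$ $$v^{(n)}_{a,k}=v^{(n)}_{a,k-1}+\mathbf 1^{(n),D}_{k-1}(T^{(n)}_+-I)v^{(n)}_{a,k-1}+\mathbf 1^{(n),E}_{k-1}(T^{(n)}_--I)v^{(n)}_{a,k-1}+\mathbf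 1^{(n),F}_{k-1}\tfrac{\Delta v^{(n)}}{\Delta x^{(n)}}\omega^{(n)}_{k-1}c^{(n)}_{k-1},$$ $$v^{(n)}_{b,k}=v^{(n)}_{b,k-1}+\mathbf 1^{(n),B}_{k-1}(T^{(n)}_+-I)v^{(n)}_{b,k-1}+\mathbf 1^{(n),A}_{k-1}(T^{(n)}_--I)v^{(n)}_{b,k-1}+\mathbf 1^{(n),C}_{k-1}\tfrac{\Delta v^{(n)}}{\Delta x^{(n)}}\omega^{(n)}_{k-1}c^{(n)}_{k-1}.$$ Put $S^{(n)}(t)=S^{(n)}_k$ for $t\in[k\Delta t^{(n)},(k+1)\Delta t^{(n)})$ and $\mathcal F^{(n)}_k=\sigma(S^{(n)}_j,\ j\le k)$. **Assumptions.** 1. There is $s_0=(A_0,v_{a,0},B_0,v_{b,0})\in E\times E$ with $A_0,B_0\ge0$ and $v_{a,0},v_{b,0}$ non-negative and continuously differentiable, such that $A^{(n)}_0\to A_0$, $B^{(n)}_0\to B_0$ and $\|v^{(n)}_{i,0}-v_{i,0}\|_{L^2}=\mathcal O(\Delta x^{(n)})$ for $i=a,b$. For every $n$, $v^{(n)}_{a,0}$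 and $v^{(n)}_{b,0}$ are non-negative step functions on the grid $\{x^{(n)}_j\}$, constant on each $[x^{(n)}_j,x^{(n)}_{j+1})$, bounded by $M$ and supported in $[-M,M]$. 2. $\omega^{(n)}_k,\pi^{(n)}_k\in[-M,M]$ almost surely. 3. There are functions $p^A,p^B,p^D,p^E:E\times E\to[0,1]$, Lipschitz with constant $L$, such that $\mathbb P(\phi^{(n)}_k=J\mid\mathcal F^{(n)}_k)=\Delta p^{(n)}p^J[S^{(n)}_k]$ a.s. for all $n$, all $k\le\lfloor T/\Delta t^{(n)}\rfloor$ and $J=A,B,D,E$. 4. For $J=C,F$ there are $f^{(n)}_J:E\times E\to L^2$, Lipschitz with constant $L$, with $\|f^{(n)}_J[s]\|_\infty\le M$ for all $s$ and $f^{(n)}_J[S^{(n)}_k]=\frac1{\Delta x^{(n)}}\mathbb E\big(\omega^{(n)}_k\,c^{(n)}_k\,\mathbf 1^{(n),J}_k\mid\mathcal F^{(n)}_k\big)$ a.s. for all $n$ and all $k\le\lfloor T/\Delta t^{(n)}\rfloor$. Moreover, there are $f_J:E\times E\to L^2$ with $\sup_{s}\|f^{(n)}_J[s]-f_J[s]\|_{L^2}=\mathcal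 O(\Delta x^{(n)})$ such that, for every $s=(A,v_a,B,v_b)$ with $v_a,v_b$ Lipschitz continuous, $f_J[s]$ is a continuously differentiable function with $|f_J[s]|\le M$ and $|f_J[s]'|\le M$. **Theorem.** There is a deterministic $S:[0,T]\to E\times E$ such that for all $\varepsilon>0$ $$\lim_{n\to\infty}\mathbb P\Big(\sup_{0\le t\le T}\|S^{(n)}(t)-S(t)\|_{E\times E}>\varepsilon\Big)=0 .$$ Moreover, with $p^{D-E}=p^D-p^E$ and $p^{B-A}=p^B-p^A$, $S=(A,v_a,B,v_b)$ is the unique classical solution of $$\begin{aligned}S(0)&=s_0,\\ A'(t)&=p^{D-E}[S(t)],\qquad B'(t)=p^{B-A}[S(t)],&& t\in[0,T],\\ \partial_tv_a(t,x)&=p^{D-E}[S(t)]\,\partial_xv_a(t,x)+f_F[S(t)](x),&&(t,x)\in[0,T]\times\mathbb R,\\ \partial_tv_b(t,x)&=p^{B-A}[S(t)]\,\partial_xv_b(t,x)+f_C[S(t)](x),&&(t,x)\in[0,T]\times\mathbb R.\end{aligned}$$ Here a classical solution is a continuous $S:[0,T]\to E\times E$ such that $A,B$ are differentiable, $v_a,v_b$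 are (in $L^2$, for each $t$) continuously differentiable functions on $[0,T]\times\mathbb R$, $f_F[S(t)]$ and $f_C[S(t)]$ have continuous versions for each $t$, and the equations hold at every point with these versions. -/

import Mathlib

open MeasureTheory ProbabilityTheory Filter Topology Set
open scoped ENNReal NNReal

namespace LOB

/-- The space `L²(ℝ)` of (classes of) square integrable functions. -/
abbrev L2 : Type := Lp ℝ 2 (volume : Measure ℝ)

/-- `E = ℝ × L²(ℝ)` with the norm `‖(α₁, α₂)‖ = |α₁| + ‖α₂‖`. -/
abbrev E : Type := WithLp 1 (ℝ × L2)

/-- The state space `E × E` with the norm `‖(s₁, s₂)‖ = ‖s₁‖ + ‖s₂‖`. A state is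
`((A, v_a), (B, v_b))`: best ask price, sell side volume density, best bid price, buy side
volume density, the densities being relative to the respective best price. -/
abbrev State : Type := WithLp 1 (E × E)

/-- The state `(A, v_a, B, v_b)`. -/
def State.mk (A : ℝ) (va : L2) (B : ℝ) (vb : L2) : State :=
  WithLp.toLp 1 (WithLp.toLp 1 (A, va), WithLp.toLp 1 (B, vb))

/-- Best ask price. -/
def State.ask (s : State) : ℝ := s.fst.fst

/-- Sell side volume density. -/
def State.va (s : State) : L2 := s.fst.snd

/-- Best bid price. -/
def State.bid (s : State) : ℝ := s.snd.fst

/-- Buy side volume density. -/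
def State.vb (s : State) : L2 := s.snd.snd

/-- The norm of the state space is the sum of the four component norms. -/
theorem State.norm_eq (s : State) :
    ‖s‖ = (|s.ask| + ‖s.va‖) + (|s.bid| + ‖s.vb‖) := by
  rw [WithLp.prod_norm_eq_of_L1, WithLp.prod_norm_eq_of_L1, WithLp.prod_norm_eq_of_L1]
  rfl

/-- The six types of events. -/
inductive Event
  /-- market sell order -/
  | A
  /-- buy limit order inside the spread -/
  | B
  /-- placement or cancelation of a buy limit order -/
  | C
  /-- market buy order -/
  | D
  /-- sell limit order inside the spread -/
  | E
  /-- placement or cancelation of a sell limit order -/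
  | F
  deriving DecidableEq

/-- Every set of event types is measurable. -/
instance : MeasurableSpace Event := ⊤

/-- The indicator `1_I(e)`. -/
def ind (I e : Event) : ℝ := if e = I then 1 else 0

/-- The translation `f ↦ f(· + h)` on `L²(ℝ)`. -/
noncomputable def shift (h : ℝ) (f : L2) : L2 :=
  Lp.compMeasurePreserving (fun x : ℝ => x + h) (measurePreserving_add_right volume h) f

/-- The function `∑ⱼ 1{y ∈ [xⱼ, xⱼ₊₁)} 1_{[xⱼ, xⱼ₊₁)}(·)` for the grid `xⱼ = j dx`, that is, the
indicator function of the grid cell that contains `y` (the one with `j = ⌊y / dx⌋`). -/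
noncomputable def cell (dx y : ℝ) : L2 :=
  indicatorConstLp 2 (measurableSet_Ico (a := (⌊y / dx⌋ : ℝ) * dx) (b := (⌊y / dx⌋ + 1 : ℝ) * dx))
    measure_Ico_lt_top.ne 1

/-- One step of the order book: the state after an event of type `e` with size `om` and
relative price level `y` has occurred in state `s`. -/
noncomputable def next (dx dv : ℝ) (e : Event) (om y : ℝ) (s : State) : State :=
  State.mk
    (s.ask + (ind .D e - ind .E e) * dx)
    (s.va + ind .D e • (shift dx s.va - s.va) + ind .E e • (shift (-dx) s.va - s.va)
      + (ind .F e * (dv / dx) * om) • cell dx y)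
    (s.bid + (ind .B e - ind .A e) * dx)
    (s.vb + ind .B e • (shift dx s.vb - s.vb) + ind .A e • (shift (-dx) s.vb - s.vb)
      + (ind .C e * (dv / dx) * om) • cell dx y)

/-- The data of a sequence of two-sided limit order book models on a common probability space:
the scaling parameters, the deterministic initial states, and the random event types, sizes and
relative price levels. -/
structure Models (Ω : Type*) [MeasurableSpace Ω] where
  /-- tick size `Δx⁽ⁿ⁾` -/
  dx : ℕ → ℝ
  /-- time between two events `Δt⁽ⁿ⁾` -/
  dt : ℕ → ℝ
  /-- scaling parameter `Δv⁽ⁿ⁾` of the individual volumes -/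
  dv : ℕ → ℝ
  /-- scaling parameter `Δp⁽ⁿ⁾` of the probabilities of price changes -/
  dp : ℕ → ℝ
  /-- initial state `s₀⁽ⁿ⁾` -/
  init : ℕ → State
  /-- event type `φₖ⁽ⁿ⁾` (arguments `n`, `k`) -/
  event : ℕ → ℕ → Ω → Event
  /-- order size `ωₖ⁽ⁿ⁾` -/
  size : ℕ → ℕ → Ω → ℝ
  /-- relative price level `πₖ⁽ⁿ⁾` -/
  level : ℕ → ℕ → Ω → ℝ
  dx_pos : ∀ n, 0 < dx n
  dt_pos : ∀ n, 0 < dt n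
  measurable_event : ∀ n k, Measurable (event n k)
  measurable_size : ∀ n k, Measurable (size n k)
  measurable_level : ∀ n k, Measurable (level n k)

namespace Models

variable {Ω : Type*} [MeasurableSpace Ω]

/-- The state `Sₖ⁽ⁿ⁾` after `k` events in the `n`-th model. -/
noncomputable def S (m : Models Ω) (n : ℕ) : ℕ → Ω → State
  | 0, _ => m.init n
  | k + 1, w =>
      next (m.dx n) (m.dv n) (m.event n k w) (m.size n k w) (m.level n k w) (S m n k w)

/-- The state `S⁽ⁿ⁾(t)` at time `t`: it is `Sₖ⁽ⁿ⁾` for `t ∈ [k Δt⁽ⁿ⁾, (k+1) Δt⁽ⁿ⁾)`. -/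
noncomputable def path (m : Models Ω) (n : ℕ) (t : ℝ) (w : Ω) : State :=
  m.S n ⌊t / m.dt n⌋₊ w

/-- The σ-field `σ(Sⱼ⁽ⁿ⁾, j ≤ k)`. -/
noncomputable abbrev past (m : Models Ω) (n k : ℕ) : MeasurableSpace Ω :=
  ⨆ j : Fin (k + 1), MeasurableSpace.comap (m.S n j) (borel State)

/-- The scaling assumption:
`Δt → 0`, `Δx Δp / Δt → 1`, `Δv / Δt → 1` and `Δx / (Δt)^β → 1` for some `β ∈ (0, 1)`. -/
def Scaling (m : Models Ω) : Prop :=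
  Tendsto m.dt atTop (𝓝 0) ∧
  Tendsto (fun n => m.dx n * m.dp n / m.dt n) atTop (𝓝 1) ∧
  Tendsto (fun n => m.dv n / m.dt n) atTop (𝓝 1) ∧
  ∃ β : ℝ, 0 < β ∧ β < 1 ∧ Tendsto (fun n => m.dx n / m.dt n ^ β) atTop (𝓝 1)

end Models

/-- `v` is (the class of) a non-negative step function on the grid `{j dx : j ∈ ℤ}`, bounded by `M`
and supported in `[-M, M]`. -/
def IsInitialVolume (dx M : ℝ) (v : L2) : Prop :=
  ∃ g : ℝ → ℝ, v =ᵐ[volume] g ∧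
    (∀ j : ℤ, ∀ x ∈ Ico ((j : ℝ) * dx) (((j : ℝ) + 1) * dx), g x = g ((j : ℝ) * dx)) ∧
    (∀ x, 0 ≤ g x ∧ g x ≤ M) ∧
    ∀ x, x ∉ Icc (-M) M → g x = 0

/-- `v` is (the class of) a non-negative continuously differentiable function. -/
def IsNonnegC1 (v : L2) : Prop :=
  ∃ g : ℝ → ℝ, v =ᵐ[volume] g ∧ ContDiff ℝ 1 g ∧ ∀ x, 0 ≤ g x

/-- `v` is (the class of) a Lipschitz continuous function. -/
def IsLipschitzVolume (v : L2) : Prop :=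
  ∃ g : ℝ → ℝ, v =ᵐ[volume] g ∧ ∃ K : ℝ≥0, LipschitzWith K g

namespace Models

variable {Ω : Type*} [MeasurableSpace Ω]

/-- The assumption on the initial states, with limit `s0`. -/
def InitialAssumption (m : Models Ω) (M : ℝ) (s0 : State) : Prop :=
  0 ≤ s0.ask ∧ 0 ≤ s0.bid ∧ IsNonnegC1 s0.va ∧ IsNonnegC1 s0.vb ∧
  Tendsto (fun n => (m.init n).ask) atTop (𝓝 s0.ask) ∧
  Tendsto (fun n => (m.init n).bid) atTop (𝓝 s0.bid) ∧
  (∀ n, IsInitialVolume (m.dx n) M (m.init n).va ∧ IsInitialVolume (m.dx n) M (m.init n).vb) ∧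
  (fun n => ‖(m.init n).va - s0.va‖) =O[atTop] m.dx ∧
  (fun n => ‖(m.init n).vb - s0.vb‖) =O[atTop] m.dx

/-- Sizes and relative price levels take their values in `[-M, M]` almost surely. -/
def BoundedMarks (m : Models Ω) (P : Measure Ω) (M : ℝ) : Prop :=
  ∀ n k, ∀ᵐ w ∂P, m.size n k w ∈ Icc (-M) M ∧ m.level n k w ∈ Icc (-M) M

/-- The assumption on the probability of the event type `I`: the function `p` is `[0, 1]`-valued and
Lipschitz with constant `L`, and
`P(φₖ⁽ⁿ⁾ = I | Sⱼ⁽ⁿ⁾, j ≤ k) = Δp⁽ⁿ⁾ p[Sₖ⁽ⁿ⁾]` almost surely for `k ≤ ⌊T / Δt⁽ⁿ⁾⌋`. -/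
def EventAssumption (m : Models Ω) (P : Measure Ω) (T : ℝ) (L : ℝ≥0) (I : Event)
    (p : State → ℝ) : Prop :=
  LipschitzWith L p ∧ (∀ s, p s ∈ Icc (0 : ℝ) 1) ∧
  ∀ n k, k ≤ ⌊T / m.dt n⌋₊ →
    P[fun w => ind I (m.event n k w) | m.past n k] =ᵐ[P] fun w => m.dp n * p (m.S n k w)

/-- The assumption on the placements and cancelations of type `I`, with the functions `fn n` of
the `n`-th model and the limit function `f`. The conditional expectation is that of an
`L²(ℝ)`-valued random variable. The regularity of `f[s]` is asked for states `s` with Lipschitz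
continuous volume densities. -/
def PlacementAssumption (m : Models Ω) (P : Measure Ω) (T M : ℝ) (L : ℝ≥0) (I : Event)
    (fn : ℕ → State → L2) (f : State → L2) : Prop :=
  (∀ n, LipschitzWith L (fn n)) ∧
  (∀ n k, k ≤ ⌊T / m.dt n⌋₊ →
    (fun w => fn n (m.S n k w)) =ᵐ[P] fun w =>
      (1 / m.dx n) • (P[fun w' => (m.size n k w' * ind I (m.event n k w')) •
        cell (m.dx n) (m.level n k w') | m.past n k]) w) ∧
  (∀ n s, ∀ᵐ x, |fn n s x| ≤ M) ∧
  (∃ K : ℝ, ∀ᶠ n in atTop, ∀ s, ‖fn n s - f s‖ ≤ K * m.dx n) ∧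
  ∀ s : State, IsLipschitzVolume s.va → IsLipschitzVolume s.vb →
    ∃ g : ℝ → ℝ, f s =ᵐ[volume] g ∧ ContDiff ℝ 1 g ∧ ∀ x, |g x| ≤ M ∧ |deriv g x| ≤ M

end Models

/-- `v` is a classical solution on `[0, T] × ℝ` of the transport equation
`∂ₜ v(t, x) = c(t) ∂ₓ v(t, x) + F(t)(x)`: it is continuously differentiable in `(t, x)` (one-sided
at the boundary of the time interval) and satisfies the equation at every point, where `F(t)` stands
for the continuous version of that element of `L²(ℝ)`, whose existence is part of the notion. -/
def SolvesTransport (T : ℝ) (c : ℝ → ℝ) (F : ℝ → L2) (v : ℝ → ℝ → ℝ) : Prop :=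
  ContDiffOn ℝ 1 (fun z : ℝ × ℝ => v z.1 z.2) (Icc 0 T ×ˢ univ) ∧
  ∀ t ∈ Icc 0 T, ∃ g : ℝ → ℝ, Continuous g ∧ F t =ᵐ[volume] g ∧
    ∀ x, HasDerivWithinAt (fun r => v r x) (c t * deriv (v t) x + g x) (Icc 0 T) t

/-- `S = (A, v_a, B, v_b) : [0, T] → E × E` is a classical solution of the system
`S(0) = s₀`, `dA = p^{D-E}[S] dt`, `dB = p^{B-A}[S] dt`,
`∂ₜ v_a = p^{D-E}[S] ∂ₓ v_a + f_F[S]`, `∂ₜ v_b = p^{B-A}[S] ∂ₓ v_b + f_C[S]`.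
Here `va t`, `vb t` are the continuously differentiable versions of the volume densities. -/
def IsClassicalSolution (T : ℝ) (pA pB pD pE : State → ℝ) (fC fF : State → L2) (s0 : State)
    (S : ℝ → State) : Prop :=
  ContinuousOn S (Icc 0 T) ∧ S 0 = s0 ∧
  (∀ t ∈ Icc 0 T,
    HasDerivWithinAt (fun r => (S r).ask) (pD (S t) - pE (S t)) (Icc 0 T) t) ∧
  (∀ t ∈ Icc 0 T,
    HasDerivWithinAt (fun r => (S r).bid) (pB (S t) - pA (S t)) (Icc 0 T) t) ∧
  (∃ va : ℝ → ℝ → ℝ, (∀ t ∈ Icc 0 T, (S t).va =ᵐ[volume] va t) ∧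
    SolvesTransport T (fun t => pD (S t) - pE (S t)) (fun t => fF (S t)) va) ∧
  (∃ vb : ℝ → ℝ → ℝ, (∀ t ∈ Icc 0 T, (S t).vb =ᵐ[volume] vb t) ∧
    SolvesTransport T (fun t => pB (S t) - pA (S t)) (fun t => fC (S t)) vb)

end LOB

namespace LOB

/-! ### Components of a state -/

/-! The price moves and the translations of the volume density are tied together: an event that
moves the price `x` by `±dx` translates the density `v` by the same amount. Hence in the frame that
moves with the price, where the density is `shift (x0 - x) v`, price changes are invisible and only
placements act. In that frame both price and density are a sum of conditional means plus a
martingale. By Doob's inequality for Hilbert space valued martingales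
(`measure_exists_norm_sum_ge_le`) the price martingale has variance of order `dx`, up to terms of
order `dt`, and the density martingale has variance of order `dt / dx`, again up to `dt`. All of
these vanish in the limit; for `dt / dx` this is the assumption `β < 1`.

Consequently, off an event of small probability, the step path is a mild solution (`MildSol`) of the
limit equation up to a small error (`mild_of_discrete`). A mild solution is one in which `x` is the
integral of its velocity and `v` is the translate of the initial density plus the accumulated
sources. Mild solutions are stable (`MildSol.dist_le`): by Grönwall, an approximate one is close to
an exact one, provided that the data along the exact one depend on translations in a Lipschitz way
(`TransLip`). The approximate solution needs no regularity, so densities that are only step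
functions are admitted.

The exact solution comes from Picard iteration among curves whose densities have a common Lipschitz
constant (`exists_mildSol`). A bounded derivative of `f[s]` does not make its translations Lipschitz
in `L²`; bounded support is needed as well. Therefore the system is first solved with `cutoff (M +
1)` applied to the sources. The discrete models cannot tell the difference, since order levels lie
in `[-M, M]` and so their placement densities are supported in `[-(M + 1), M + 1]` at visited
states. Convergence to the solution of the truncated system then shows, after the fact, that the
cutoff does nothing along the limit (`cutoff_limit_eq`).

Finally, mild and classical solutions are matched by the method of characteristics. Smooth data turn
the mild solution into a classical one (`solvesTransport_density`), and every classical solution is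
mild (`mild_of_solvesTransport`), so uniqueness is again the stability estimate, with error zero. -/

theorem State.abs_ask_sub_le (s s' : State) : |s.ask - s'.ask| ≤ ‖s - s'‖ := by
  rw [State.norm_eq (s - s')]
  have h : (s - s').ask = s.ask - s'.ask := rfl
  rw [h]
  have := norm_nonneg (s - s').va
  have := norm_nonneg (s - s').vb
  have := abs_nonneg (s - s').bid
  linarith

theorem State.abs_bid_sub_le (s s' : State) : |s.bid - s'.bid| ≤ ‖s - s'‖ := by
  rw [State.norm_eq (s - s')]
  have h : (s - s').bid = s.bid - s'.bid := rfl
  rw [h]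
  have := norm_nonneg (s - s').va
  have := norm_nonneg (s - s').vb
  have := abs_nonneg (s - s').ask
  linarith

theorem State.norm_va_sub_le (s s' : State) : ‖s.va - s'.va‖ ≤ ‖s - s'‖ := by
  rw [State.norm_eq (s - s')]
  have h : (s - s').va = s.va - s'.va := rfl
  rw [h]
  have := norm_nonneg (s - s').vb
  have := abs_nonneg (s - s').ask
  have := abs_nonneg (s - s').bid
  linarith

theorem State.norm_vb_sub_le (s s' : State) : ‖s.vb - s'.vb‖ ≤ ‖s - s'‖ := by
  rw [State.norm_eq (s - s')]
  have h : (s - s').vb = s.vb - s'.vb := rfl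
  rw [h]
  have := norm_nonneg (s - s').va
  have := abs_nonneg (s - s').ask
  have := abs_nonneg (s - s').bid
  linarith

theorem State.norm_sub_eq (s s' : State) :
    ‖s - s'‖ = (|s.ask - s'.ask| + ‖s.va - s'.va‖) + (|s.bid - s'.bid| + ‖s.vb - s'.vb‖) :=
  State.norm_eq (s - s')

theorem State.continuous_ask : Continuous State.ask :=
  (LipschitzWith.of_dist_le_mul (K := 1) fun s s' => by
    simpa [Real.dist_eq, dist_eq_norm] using State.abs_ask_sub_le s s').continuous

theorem State.continuous_bid : Continuous State.bid :=
  (LipschitzWith.of_dist_le_mul (K := 1) fun s s' => by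
    simpa [Real.dist_eq, dist_eq_norm] using State.abs_bid_sub_le s s').continuous

theorem State.continuous_va : Continuous State.va :=
  (LipschitzWith.of_dist_le_mul (K := 1) fun s s' => by
    simpa [dist_eq_norm] using State.norm_va_sub_le s s').continuous

theorem State.continuous_vb : Continuous State.vb :=
  (LipschitzWith.of_dist_le_mul (K := 1) fun s s' => by
    simpa [dist_eq_norm] using State.norm_vb_sub_le s s').continuous

theorem State.continuous_mk :
    Continuous fun z : (ℝ × L2) × (ℝ × L2) => State.mk z.1.1 z.1.2 z.2.1 z.2.2 := by
  unfold State.mk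
  refine (WithLp.prod_continuous_toLp 1 E E).comp
    (Continuous.prodMk ((WithLp.prod_continuous_toLp 1 ℝ L2).comp ?_)
      ((WithLp.prod_continuous_toLp 1 ℝ L2).comp ?_))
  · fun_prop
  · fun_prop

@[simp] theorem State.ask_mk (A : ℝ) (va : L2) (B : ℝ) (vb : L2) :
    (State.mk A va B vb).ask = A := rfl
@[simp] theorem State.va_mk (A : ℝ) (va : L2) (B : ℝ) (vb : L2) :
    (State.mk A va B vb).va = va := rfl
@[simp] theorem State.bid_mk (A : ℝ) (va : L2) (B : ℝ) (vb : L2) :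
    (State.mk A va B vb).bid = B := rfl
@[simp] theorem State.vb_mk (A : ℝ) (va : L2) (B : ℝ) (vb : L2) :
    (State.mk A va B vb).vb = vb := rfl

/-! ### Translations of `L²(ℝ)` -/

theorem coeFn_shift (h : ℝ) (f : L2) : shift h f =ᵐ[volume] fun x => f (x + h) :=
  Lp.coeFn_compMeasurePreserving f (measurePreserving_add_right volume h)

theorem shift_ae_eq {f : L2} {g : ℝ → ℝ} (hfg : f =ᵐ[volume] g) (h : ℝ) :
    shift h f =ᵐ[volume] fun x => g (x + h) :=
  (coeFn_shift h f).trans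
    ((measurePreserving_add_right volume h).quasiMeasurePreserving.ae_eq_comp hfg)

theorem shift_shift (h k : ℝ) (f : L2) : shift h (shift k f) = shift (h + k) f := by
  refine Lp.ext ((shift_ae_eq (coeFn_shift k f) h).trans ?_)
  filter_upwards [coeFn_shift (h + k) f] with x hx
  rw [hx, add_assoc]

@[simp] theorem shift_zero (f : L2) : shift 0 f = f := by
  refine Lp.ext ((coeFn_shift 0 f).trans ?_)
  simp

/-- The translation as a linear isometry. -/
noncomputable def shiftL (h : ℝ) : L2 →ₗᵢ[ℝ] L2 :=
  Lp.compMeasurePreservingₗᵢ ℝ (fun x : ℝ => x + h) (measurePreserving_add_right volume h)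

theorem shiftL_apply (h : ℝ) (f : L2) : shiftL h f = shift h f := rfl

@[simp] theorem norm_shift (h : ℝ) (f : L2) : ‖shift h f‖ = ‖f‖ := (shiftL h).norm_map f

theorem shift_add (h : ℝ) (f g : L2) : shift h (f + g) = shift h f + shift h g :=
  map_add (shiftL h) f g

theorem shift_sub (h : ℝ) (f g : L2) : shift h (f - g) = shift h f - shift h g :=
  map_sub (shiftL h) f g

theorem shift_smul (h c : ℝ) (f : L2) : shift h (c • f) = c • shift h f :=
  map_smul (shiftL h) c f

/-- Translations are strongly but not norm continuous on `L²`. Joint continuity in the displacement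
and the function is what makes curves seen in a moving frame measurable and integrable. -/
theorem continuous_shift {X : Type*} [TopologicalSpace X] {a : X → ℝ} {f : X → L2}
    (ha : Continuous a) (hf : Continuous f) : Continuous fun z => shift (a z) (f z) := by
  have hc : Continuous fun p : X × ℝ => p.2 + a p.1 := by fun_prop
  let g : X → C(ℝ, ℝ) := fun z => ⟨fun x => x + a z, by fun_prop⟩
  have hg : Continuous g := ContinuousMap.continuous_of_continuous_uncurry g hc
  exact Continuous.compMeasurePreservingLp (g := g) hf hg
    (fun z => measurePreserving_add_right volume (a z)) (by norm_num)

theorem continuousOn_shift {X : Type*} [TopologicalSpace X] {s : Set X} {a : X → ℝ} {f : X → L2}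
    (ha : ContinuousOn a s) (hf : ContinuousOn f s) :
    ContinuousOn (fun z => shift (a z) (f z)) s := by
  rw [continuousOn_iff_continuous_domRestrict] at *
  exact continuous_shift ha hf

/-- `f` depends in a Lipschitz way on its translation. -/
def TransLip (C : ℝ) (f : L2) : Prop := ∀ h : ℝ, ‖shift h f - f‖ ≤ C * |h|

theorem TransLip.norm_shift_sub_shift_le {C : ℝ} {f : L2} (hf : TransLip C f) (h k : ℝ) :
    ‖shift h f - shift k f‖ ≤ C * |h - k| := by
  have e : shift h f - shift k f = shift k (shift (h - k) f - f) := by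
    rw [shift_sub, shift_shift]
    congr 2
    ring
  rw [e, norm_shift]
  exact hf _

/-- The functions in `L²(ℝ)` with a `K`-Lipschitz version. -/
def LipVol (K : ℝ≥0) : Set L2 := {f | ∃ g : ℝ → ℝ, f =ᵐ[volume] g ∧ LipschitzWith K g}

theorem LipVol.shift {K : ℝ≥0} {f : L2} (hf : f ∈ LipVol K) (h : ℝ) : shift h f ∈ LipVol K := by
  obtain ⟨g, hfg, hg⟩ := hf
  refine ⟨_, shift_ae_eq hfg h, ?_⟩
  refine LipschitzWith.of_dist_le_mul fun x y => ?_
  simpa using hg.dist_le_mul (x + h) (y + h)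

theorem LipVol.add {K K' : ℝ≥0} {f f' : L2} (hf : f ∈ LipVol K) (hf' : f' ∈ LipVol K') :
    f + f' ∈ LipVol (K + K') := by
  obtain ⟨g, hfg, hg⟩ := hf
  obtain ⟨g', hfg', hg'⟩ := hf'
  exact ⟨_, (Lp.coeFn_add f f').trans (hfg.add hfg'), hg.add hg'⟩

theorem LipVol.smul {K : ℝ≥0} {f : L2} (hf : f ∈ LipVol K) (c : ℝ) :
    c • f ∈ LipVol (‖c‖₊ * K) := by
  obtain ⟨g, hfg, hg⟩ := hf
  refine ⟨_, (Lp.coeFn_smul c f).trans (hfg.const_smul c), ?_⟩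
  exact (lipschitzWith_smul c).comp hg

theorem LipVol.mono {K K' : ℝ≥0} (h : K ≤ K') : LipVol K ⊆ LipVol K' :=
  fun _ ⟨g, hfg, hg⟩ => ⟨g, hfg, hg.weaken h⟩

theorem LipVol.zero_mem (K : ℝ≥0) : (0 : L2) ∈ LipVol K :=
  ⟨fun _ => 0, Lp.coeFn_zero _ _ _, LipschitzWith.const' 0⟩

theorem convex_lipVol (K : ℝ≥0) : Convex ℝ (LipVol K) := by
  intro f hf f' hf' a b ha hb hab
  have := LipVol.add (LipVol.smul hf a) (LipVol.smul hf' b)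
  refine LipVol.mono (le_of_eq ?_) this
  rw [← add_mul]
  have : ‖a‖₊ + ‖b‖₊ = 1 := by
    rw [← NNReal.coe_inj]
    simp [abs_of_nonneg ha, abs_of_nonneg hb, hab]
  rw [this, one_mul]

/-- A subsequence converges almost everywhere, the limit is `K`-Lipschitz on the set of convergence,
and a Lipschitz function on a subset of the line extends with the same constant. Together with
convexity this keeps Lipschitz constants under control in Bochner integrals and in limits of Picard
iterates. -/
theorem isClosed_lipVol (K : ℝ≥0) : IsClosed (LipVol K) := by
  refine IsSeqClosed.isClosed fun f φ hf hlim => ?_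
  choose g hfg hg using hf
  have hm : TendstoInMeasure volume (fun n => (f n : ℝ → ℝ)) atTop φ :=
    tendstoInMeasure_of_tendsto_Lp hlim
  obtain ⟨ns, -, hns⟩ := hm.exists_seq_tendsto_ae
  have hall : ∀ᵐ x, Tendsto (fun n => g (ns n) x) atTop (𝓝 (φ x)) := by
    filter_upwards [hns, ae_all_iff.2 hfg] with x hx hx'
    simpa only [hx'] using hx
  have hL : LipschitzOnWith K φ {x | Tendsto (fun n => g (ns n) x) atTop (𝓝 (φ x))} := by
    refine LipschitzOnWith.of_dist_le_mul fun x hx y hy => ?_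
    exact le_of_tendsto (hx.dist hy) (Eventually.of_forall fun n => (hg _).dist_le_mul x y)
  obtain ⟨G, hG, hGe⟩ := hL.extend_real
  refine ⟨G, ?_, hG⟩
  filter_upwards [hall] with x hx using hGe hx

theorem LipVol.isLipschitzVolume {K : ℝ≥0} {f : L2} (hf : f ∈ LipVol K) : IsLipschitzVolume f :=
  hf.imp fun _ h => ⟨h.1, K, h.2⟩

/-- An essentially bounded function that vanishes outside of a set of finite measure. -/
theorem norm_le_of_ae_abs_le {f : L2} {C : ℝ} (hC : 0 ≤ C) {s : Set ℝ} (hs : MeasurableSet s)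
    (hsf : volume s ≠ ∞) (hf : ∀ᵐ x, |f x| ≤ C) (hf0 : ∀ᵐ x, x ∉ s → f x = 0) :
    ‖f‖ ≤ C * Real.sqrt (volume.real s) := by
  have h1 : ‖f‖ ≤ ‖indicatorConstLp 2 hs hsf C‖ := by
    refine Lp.norm_le_norm_of_ae_le ?_
    filter_upwards [hf, hf0, indicatorConstLp_coeFn (p := 2) (hs := hs) (hμs := hsf) (c := C)]
      with x h1 h2 h3
    rw [h3]
    by_cases hx : x ∈ s
    · simpa [hx, abs_of_nonneg hC] using h1
    · simp [hx, h2 hx]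
  refine h1.trans (le_of_eq ?_)
  rw [norm_indicatorConstLp (by norm_num) (by norm_num), Real.norm_of_nonneg hC,
    Real.sqrt_eq_rpow]
  norm_num

/-- A Lipschitz function with bounded support. -/
theorem transLip_of_lipschitz {K : ℝ≥0} {R : ℝ} (hR : 0 ≤ R) {f : L2} {g : ℝ → ℝ}
    (hfg : f =ᵐ[volume] g) (hg : LipschitzWith K g) (hsupp : ∀ x, x ∉ Icc (-R) R → g x = 0) :
    TransLip (K * Real.sqrt (4 * R)) f := by
  intro h
  have hd : ⇑(shift h f - f) =ᵐ[volume] fun x => g (x + h) - g x := by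
    filter_upwards [Lp.coeFn_sub (shift h f) f, shift_ae_eq hfg h, hfg] with x h1 h2 h3
    rw [h1, Pi.sub_apply, h2, h3]
  -- The difference can be nonzero only where `x` or `x + h` lies in `[-R, R]`, a set of measure at
  -- most `4R` for every `h`.
  have hvol : volume (Icc (-R) R ∪ Icc (-R - h) (R - h)) ≤ ENNReal.ofReal (4 * R) := by
    refine (measure_union_le _ _).trans ?_
    rw [Real.volume_Icc, Real.volume_Icc, ← ENNReal.ofReal_add (by linarith) (by linarith)]
    exact ENNReal.ofReal_le_ofReal (by linarith)
  have hfin := ne_top_of_le_ne_top ENNReal.ofReal_ne_top hvol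
  have := norm_le_of_ae_abs_le (f := shift h f - f) (C := K * |h|) (by positivity)
    (measurableSet_Icc.union measurableSet_Icc) hfin
    (by
      filter_upwards [hd] with x hx
      rw [hx]
      simpa [Real.dist_eq] using hg.dist_le_mul (x + h) x)
    (by
      filter_upwards [hd] with x hx hxs
      simp only [mem_union, not_or] at hxs
      have hx2 : x + h ∉ Icc (-R) R := fun h' => hxs.2 ⟨by linarith [h'.1], by linarith [h'.2]⟩
      rw [hx, hsupp _ hxs.1, hsupp _ hx2, sub_zero])
  have hs : Real.sqrt (volume.real (Icc (-R) R ∪ Icc (-R - h) (R - h))) ≤ Real.sqrt (4 * R) := by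
    refine Real.sqrt_le_sqrt ?_
    exact ENNReal.toReal_le_of_le_ofReal (by linarith) hvol
  calc _ ≤ _ := this
    _ ≤ K * |h| * Real.sqrt (4 * R) := by gcongr
    _ = _ := by ring

/-- The value of a Lipschitz function is controlled by its norm in `L²(ℝ)`. -/
theorem abs_le_of_lipschitz {K : ℝ≥0} {f : L2} {g : ℝ → ℝ} (hfg : f =ᵐ[volume] g)
    (hg : LipschitzWith K g) (x : ℝ) {δ : ℝ} (hδ : 0 < δ) :
    |g x| ≤ K * δ + ‖f‖ / Real.sqrt δ := by
  by_contra! hlt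
  -- On `[x, x + δ]` the function stays at least `η` in absolute value, so its `L²` norm is at least
  -- `η √δ`.
  set η := |g x| - K * δ with hη
  have hη0 : ‖f‖ / Real.sqrt δ < η := by linarith
  have hsq := Real.sqrt_pos.2 hδ
  have hηp : 0 ≤ η := (by positivity : (0 : ℝ) ≤ ‖f‖ / Real.sqrt δ).trans hη0.le
  have h1 : ‖indicatorConstLp 2 (measurableSet_Icc (a := x) (b := x + δ))
      (measure_Icc_lt_top (μ := volume)).ne η‖ ≤ ‖f‖ := by
    refine Lp.norm_le_norm_of_ae_le ?_
    filter_upwards [hfg, indicatorConstLp_coeFn (p := 2)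
      (hs := (measurableSet_Icc (a := x) (b := x + δ)))
      (hμs := (measure_Icc_lt_top (μ := volume)).ne) (c := η)] with y h1 h3
    rw [h3, h1]
    by_cases hy : y ∈ Icc x (x + δ)
    · simp only [hy, indicator_of_mem, Real.norm_eq_abs, abs_of_nonneg hηp]
      have h4 := hg.dist_le_mul x y
      rw [Real.dist_eq, Real.dist_eq] at h4
      have h5 : |x - y| ≤ δ := by
        rw [abs_sub_comm, abs_of_nonneg (by linarith [hy.1])]
        linarith [hy.2]
      have h6 : (K : ℝ) * |x - y| ≤ K * δ := by gcongr
      have h7 := abs_sub_abs_le_abs_sub (g x) (g y)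
      linarith
    · simp [hy]
  rw [norm_indicatorConstLp (by norm_num) (by norm_num), Real.norm_of_nonneg hηp] at h1
  have h2 : volume.real (Icc x (x + δ)) = δ := by simp [measureReal_def, hδ.le]
  rw [h2] at h1
  have h3 : δ ^ (1 / (2 : ℝ≥0∞).toReal) = Real.sqrt δ := by rw [Real.sqrt_eq_rpow]; norm_num
  rw [h3] at h1
  rw [div_lt_iff₀ hsq] at hη0
  linarith

/-! ### A cutoff function -/

/-- The piecewise linear function which is `1` on `[-R, R]` and `0` outside of
`[-(R + 1), R + 1]`. -/
noncomputable def bump (R x : ℝ) : ℝ := max 0 (min 1 (R + 1 - |x|))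

theorem bump_nonneg (R x : ℝ) : 0 ≤ bump R x := le_max_left _ _

theorem bump_le_one (R x : ℝ) : bump R x ≤ 1 := max_le zero_le_one (min_le_left _ _)

theorem bump_eq_one {R x : ℝ} (h : |x| ≤ R) : bump R x = 1 := by
  unfold bump
  rw [min_eq_left (by linarith), max_eq_right zero_le_one]

theorem bump_eq_zero {R x : ℝ} (h : R + 1 ≤ |x|) : bump R x = 0 := by
  unfold bump
  exact max_eq_left ((min_le_right _ _).trans (by linarith))

theorem lipschitzWith_bump (R : ℝ) : LipschitzWith 1 (bump R) := by
  have h1 : LipschitzWith 1 fun x : ℝ => R + 1 - |x| := by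
    refine LipschitzWith.of_dist_le_mul fun x y => ?_
    simp only [Real.dist_eq, NNReal.coe_one, one_mul]
    rw [show R + 1 - |x| - (R + 1 - |y|) = |y| - |x| by ring, abs_sub_comm x y]
    exact abs_abs_sub_abs_le _ _
  exact (h1.const_min 1).const_max 0

theorem memLp_bump_mul (R : ℝ) (f : L2) : MemLp (fun x => bump R x * f x) 2 volume := by
  refine (Lp.memLp f).of_le
    ((lipschitzWith_bump R).continuous.aestronglyMeasurable.mul (Lp.aestronglyMeasurable f)) ?_
  refine Eventually.of_forall fun x => ?_
  rw [norm_mul, Real.norm_of_nonneg (bump_nonneg R x)]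
  exact mul_le_of_le_one_left (norm_nonneg _) (bump_le_one R x)

/-- Multiplication by the cutoff function. -/
noncomputable def cutoff (R : ℝ) : L2 →L[ℝ] L2 :=
  LinearMap.mkContinuous
    { toFun := fun f => (memLp_bump_mul R f).toLp
      map_add' := fun f g => by
        refine Lp.ext ?_
        filter_upwards [(memLp_bump_mul R (f + g)).coeFn_toLp, (memLp_bump_mul R f).coeFn_toLp,
          (memLp_bump_mul R g).coeFn_toLp, Lp.coeFn_add f g,
          Lp.coeFn_add (memLp_bump_mul R f).toLp (memLp_bump_mul R g).toLp] with x h1 h2 h3 h4 h5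
        rw [h1, h5, Pi.add_apply, h2, h3, h4, Pi.add_apply, mul_add]
      map_smul' := fun c f => by
        refine Lp.ext ?_
        filter_upwards [(memLp_bump_mul R (c • f)).coeFn_toLp, (memLp_bump_mul R f).coeFn_toLp,
          Lp.coeFn_smul c f, Lp.coeFn_smul c (memLp_bump_mul R f).toLp] with x h1 h2 h3 h4
        rw [h1, RingHom.id_apply, h4, Pi.smul_apply, h2, h3, Pi.smul_apply, smul_eq_mul,
          smul_eq_mul]
        ring }
    1 fun f => by
      rw [one_mul]
      refine Lp.norm_le_norm_of_ae_le ?_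
      filter_upwards [(memLp_bump_mul R f).coeFn_toLp] with x hx
      simp only [LinearMap.coe_mk, AddHom.coe_mk]
      rw [hx, norm_mul, Real.norm_of_nonneg (bump_nonneg R x)]
      exact mul_le_of_le_one_left (norm_nonneg _) (bump_le_one R x)

theorem coeFn_cutoff (R : ℝ) (f : L2) : cutoff R f =ᵐ[volume] fun x => bump R x * f x :=
  (memLp_bump_mul R f).coeFn_toLp

theorem norm_cutoff_le (R : ℝ) (f : L2) : ‖cutoff R f‖ ≤ ‖f‖ := by
  simpa using (cutoff R).le_of_opNorm_le (LinearMap.mkContinuous_norm_le _ zero_le_one _) f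

theorem cutoff_eq_self {R : ℝ} {f : L2} (h : ∀ᵐ x, R < |x| → f x = 0) : cutoff R f = f := by
  refine Lp.ext ?_
  filter_upwards [coeFn_cutoff R f, h] with x h1 h2
  rw [h1]
  by_cases hx : |x| ≤ R
  · rw [bump_eq_one hx, one_mul]
  · rw [h2 (not_le.1 hx), mul_zero]

theorem norm_cutoff_le_of_ae_abs_le {R M : ℝ} (hR : 0 ≤ R) (hM : 0 ≤ M) {f : L2}
    (hf : ∀ᵐ x, |f x| ≤ M) :
    ‖cutoff R f‖ ≤ M * Real.sqrt (2 * (R + 1)) := by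
  have := norm_le_of_ae_abs_le (f := cutoff R f) hM (measurableSet_Icc (a := -(R + 1)) (b := R + 1))
    measure_Icc_lt_top.ne
    (by
      filter_upwards [hf, coeFn_cutoff R f] with x h1 h2
      rw [h2, abs_mul, abs_of_nonneg (bump_nonneg R x)]
      exact (mul_le_of_le_one_left (abs_nonneg _) (bump_le_one R x)).trans h1)
    (by
      filter_upwards [coeFn_cutoff R f] with x h2 hx
      rw [h2, bump_eq_zero, zero_mul]
      by_contra! h
      exact hx (abs_le.1 h.le))
  refine this.trans (le_of_eq ?_)
  congr 2
  rw [measureReal_def, Real.volume_Icc, ENNReal.toReal_ofReal (by linarith)]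
  ring

/-- The cutoff of a bounded Lipschitz function. -/
theorem exists_version_cutoff {R : ℝ} {M : ℝ≥0} {f : L2} {g : ℝ → ℝ}
    (hfg : f =ᵐ[volume] g) (hg : LipschitzWith M g) (hgb : ∀ x, |g x| ≤ M) :
    ∃ g' : ℝ → ℝ, cutoff R f =ᵐ[volume] g' ∧ LipschitzWith (M + M) g' ∧
      ∀ x, x ∉ Icc (-(R + 1)) (R + 1) → g' x = 0 := by
  refine ⟨fun x => bump R x * g x, ?_, ?_, ?_⟩
  · filter_upwards [coeFn_cutoff R f, hfg] with x h1 h2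
    rw [h1, h2]
  · refine LipschitzWith.of_dist_le_mul fun x y => ?_
    have h1 := hg.dist_le_mul x y
    have h2 := (lipschitzWith_bump R).dist_le_mul x y
    rw [Real.dist_eq] at h1 h2 ⊢
    rw [show bump R x * g x - bump R y * g y
      = bump R x * (g x - g y) + (bump R x - bump R y) * g y by ring]
    refine (abs_add_le _ _).trans ?_
    rw [abs_mul, abs_mul, abs_of_nonneg (bump_nonneg R x), NNReal.coe_add, add_mul]
    have h3 : bump R x * |g x - g y| ≤ 1 * (M * dist x y) := by
      gcongr
      exact bump_le_one R x
    have h4 : |bump R x - bump R y| * |g y| ≤ (((1 : ℝ≥0) : ℝ) * dist x y) * M := by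
      gcongr
      exact hgb y
    simp only [NNReal.coe_one] at h4
    linarith
  · intro x hx
    simp only
    rw [bump_eq_zero, zero_mul]
    by_contra! h
    exact hx (abs_le.1 h.le)

/-! ### Grid cells -/

theorem norm_cell {dx : ℝ} (hdx : 0 < dx) (y : ℝ) : ‖cell dx y‖ = Real.sqrt dx := by
  unfold cell
  rw [norm_indicatorConstLp (by norm_num) (by norm_num), measureReal_def, Real.volume_Ico]
  rw [show (⌊y / dx⌋ + 1 : ℝ) * dx - ⌊y / dx⌋ * dx = dx by ring, ENNReal.toReal_ofReal hdx.le,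
    Real.sqrt_eq_rpow]
  norm_num

/-- A cell that meets `[-M, M]` and has width at most `1` lies within `[-(M + 1), M + 1]`; this is
the origin of the radius `M + 1` used throughout. -/
theorem cutoff_cell {dx y M : ℝ} (hdx : 0 < dx) (hdx1 : dx ≤ 1) (hy : y ∈ Icc (-M) M) :
    cutoff (M + 1) (cell dx y) = cell dx y := by
  refine cutoff_eq_self ?_
  unfold cell
  filter_upwards [indicatorConstLp_coeFn (p := 2)
    (hs := (measurableSet_Ico (a := (⌊y / dx⌋ : ℝ) * dx) (b := (⌊y / dx⌋ + 1 : ℝ) * dx)))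
    (hμs := (measure_Ico_lt_top (μ := volume)).ne) (c := (1 : ℝ))] with x hx hxM
  rw [hx, indicator_of_notMem]
  rintro ⟨h1, h2⟩
  have h3 : (⌊y / dx⌋ : ℝ) * dx ≤ y := by
    rw [← le_div_iff₀ hdx]; exact Int.floor_le _
  have h4 : y < (⌊y / dx⌋ + 1 : ℝ) * dx := by
    rw [← div_lt_iff₀ hdx]; exact Int.lt_floor_add_one _
  have : |x| ≤ M + 1 := abs_le.2 ⟨by nlinarith [hy.1], by nlinarith [hy.2]⟩
  linarith

/-! ### Integrals -/

/-- The Bochner integral of a curve in `L²(ℝ)` is the pointwise integral. -/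
theorem coeFn_intervalIntegral {F : ℝ → L2} (hF : Continuous F) {h : ℝ → ℝ → ℝ}
    (hh : Continuous fun z : ℝ × ℝ => h z.1 z.2) (hFh : ∀ s, F s =ᵐ[volume] h s)
    {t : ℝ} (ht : 0 ≤ t) :
    (∫ s in (0 : ℝ)..t, F s : L2) =ᵐ[volume] fun y => ∫ s in (0 : ℝ)..t, h s y := by
  have hcont : Continuous fun y => ∫ s in (0 : ℝ)..t, h s y :=
    intervalIntegral.continuous_parametric_intervalIntegral_of_continuous' (f := fun y s => h s y)
      (hh.comp continuous_swap) 0 t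
  -- On the bounded window `[-N, N]` both sides are integrable, so they can be compared by
  -- integrating over measurable subsets. The inner product with an indicator commutes with the
  -- Bochner integral, and Fubini does the rest.
  have key : ∀ N : ℕ, ∀ᵐ y, y ∈ Icc (-N : ℝ) N →
      (∫ s in (0 : ℝ)..t, F s : L2) y = ∫ s in (0 : ℝ)..t, h s y := by
    intro N
    rw [← ae_restrict_iff' measurableSet_Icc]
    refine Integrable.ae_eq_of_forall_setIntegral_eq _ _ ?_ ?_ ?_
    · exact ((Lp.memLp _).restrict _).integrable (by norm_num)
    · exact hcont.continuousOn.integrableOn_compact isCompact_Icc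
    · intro A hA _
      rw [Measure.restrict_restrict hA]
      set B := A ∩ Icc (-N : ℝ) N
      have hB : MeasurableSet B := hA.inter measurableSet_Icc
      have hBfin : volume B ≠ ∞ :=
        ((measure_mono inter_subset_right).trans_lt measure_Icc_lt_top).ne
      rw [← L2.inner_indicatorConstLp_one hB hBfin]
      have h1 := (innerSL ℝ (indicatorConstLp 2 hB hBfin (1 : ℝ))).intervalIntegral_comp_comm
        (hF.intervalIntegrable (μ := volume) 0 t)
      simp only [innerSL_apply_apply] at h1
      rw [← h1]
      have h2 : ∀ s, inner ℝ (indicatorConstLp 2 hB hBfin (1 : ℝ)) (F s) = ∫ y in B, h s y := by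
        intro s
        rw [L2.inner_indicatorConstLp_one hB hBfin]
        exact integral_congr_ae (ae_restrict_of_ae (hFh s))
      simp only [h2, intervalIntegral.integral_of_le ht]
      refine integral_integral_swap ?_
      rw [Measure.prod_restrict]
      refine IntegrableOn.mono_set (t := Icc (0 : ℝ) t ×ˢ Icc (-N : ℝ) N) ?_
        (prod_mono Ioc_subset_Icc_self inter_subset_right)
      exact hh.continuousOn.integrableOn_compact (isCompact_Icc.prod isCompact_Icc)
  filter_upwards [ae_all_iff.2 key] with y hy
  obtain ⟨N, hN⟩ := exists_nat_ge |y|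
  exact hy N (abs_le.1 hN)

/-! ### Integrals of step functions of time -/

section Step

variable {H : Type*} [NormedAddCommGroup H] {dt : ℝ}

theorem stronglyMeasurable_step (G : ℕ → H) : StronglyMeasurable fun s : ℝ => G ⌊s / dt⌋₊ := by
  have h1 : StronglyMeasurable G := .of_discrete
  exact h1.comp_measurable (Nat.measurable_floor.comp (measurable_id.div_const dt))

theorem exists_bound_step (hdt : 0 < dt) (G : ℕ → H) (t : ℝ) :
    ∃ B, ∀ s ≤ t, ‖G ⌊s / dt⌋₊‖ ≤ B := by
  refine ⟨∑ j ∈ Finset.range (⌊t / dt⌋₊ + 1), ‖G j‖, fun s hs => ?_⟩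
  refine Finset.single_le_sum (f := fun j => ‖G j‖) (fun j _ => norm_nonneg _) ?_
  rw [Finset.mem_range, Nat.lt_succ_iff]
  exact Nat.floor_le_floor (by gcongr)

theorem intervalIntegrable_step (hdt : 0 < dt) (G : ℕ → H) (a b : ℝ) :
    IntervalIntegrable (fun s : ℝ => G ⌊s / dt⌋₊) volume a b := by
  obtain ⟨B, hB⟩ := exists_bound_step hdt G (max a b)
  rw [intervalIntegrable_iff]
  refine Measure.integrableOn_of_bounded (M := B) (by simp)
    (stronglyMeasurable_step G).aestronglyMeasurable ?_
  filter_upwards [ae_restrict_mem measurableSet_uIoc] with s hs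
  exact hB s hs.2

theorem integral_step_of_floor_eq [NormedSpace ℝ H] [CompleteSpace H] (G : ℕ → H) {j : ℕ} {a b : ℝ} (hab : a ≤ b)
    (h : ∀ s ∈ Ioo a b, ⌊s / dt⌋₊ = j) :
    ∫ s in a..b, G ⌊s / dt⌋₊ = (b - a) • G j := by
  rw [intervalIntegral.integral_of_le hab, integral_Ioc_eq_integral_Ioo,
    setIntegral_congr_fun measurableSet_Ioo (g := fun _ => G j) fun s hs => by simp only [h s hs]]
  rw [setIntegral_const, measureReal_def, Real.volume_Ioo, ENNReal.toReal_ofReal (by linarith)]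

theorem integral_step [NormedSpace ℝ H] [CompleteSpace H] (hdt : 0 < dt) (G : ℕ → H) {t : ℝ} (ht : 0 ≤ t) :
    ∫ s in (0 : ℝ)..t, G ⌊s / dt⌋₊ =
      ∑ j ∈ Finset.range ⌊t / dt⌋₊, dt • G j + (t - ⌊t / dt⌋₊ * dt) • G ⌊t / dt⌋₊ := by
  have hsum : ∀ k : ℕ, ∫ s in (0 : ℝ)..(k * dt), G ⌊s / dt⌋₊ = ∑ j ∈ Finset.range k, dt • G j := by
    intro k
    induction k with
    | zero => simp
    | succ k ih =>
      rw [Finset.sum_range_succ, ← ih, ← intervalIntegral.integral_add_adjacent_intervals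
        (intervalIntegrable_step hdt G 0 (k * dt)) (intervalIntegrable_step hdt G (k * dt) _)]
      congr 1
      rw [integral_step_of_floor_eq (j := k) G (by push_cast; nlinarith)]
      · congr 1
        push_cast
        ring
      · intro s hs
        have h0 : 0 ≤ s := le_trans (by positivity) hs.1.le
        rw [Nat.floor_eq_iff (by positivity), le_div_iff₀ hdt, div_lt_iff₀ hdt]
        exact ⟨hs.1.le, by simpa using hs.2⟩
  have h1 : (⌊t / dt⌋₊ : ℝ) * dt ≤ t := by
    rw [← le_div_iff₀ hdt]
    exact Nat.floor_le (by positivity)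
  rw [← intervalIntegral.integral_add_adjacent_intervals
    (intervalIntegrable_step hdt G 0 (⌊t / dt⌋₊ * dt)) (intervalIntegrable_step hdt G _ _), hsum,
    integral_step_of_floor_eq (j := ⌊t / dt⌋₊) G h1]
  intro s hs
  have h0 : 0 ≤ s := le_trans (by positivity) hs.1.le
  rw [Nat.floor_eq_iff (by positivity), le_div_iff₀ hdt]
  refine ⟨hs.1.le, lt_of_le_of_lt ?_ (Nat.lt_floor_add_one (t / dt))⟩
  have := hs.2.le
  gcongr

end Step

/-- Grönwall's inequality in integral form. -/
theorem gronwall_integral {T C δ : ℝ} (hC : 0 < C) {e : ℝ → ℝ} (hT : 0 ≤ T)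
    (he : IntervalIntegrable e volume 0 T)
    (h : ∀ t ∈ Icc 0 T, e t ≤ δ + C * ∫ s in (0 : ℝ)..t, e s) :
    ∀ t ∈ Icc 0 T, e t ≤ δ * Real.exp (C * t) := by
  -- `e` is only integrable. Its majorant `J` is continuous and satisfies the same inequality
  -- because `e ≤ J`; the differential form of Grönwall then applies to the primitive of `J`, which
  -- starts at zero.
  set J : ℝ → ℝ := fun t => δ + C * ∫ s in (0 : ℝ)..t, e s
  have hJc : ContinuousOn J (Icc 0 T) := by
    have := intervalIntegral.continuousOn_primitive_interval' he (left_mem_uIcc)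
    rw [uIcc_of_le hT] at this
    exact continuousOn_const.add (continuousOn_const.mul this)
  have hJi : IntervalIntegrable J volume 0 T := by
    refine ContinuousOn.intervalIntegrable ?_
    rwa [uIcc_of_le hT]
  have hsub : ∀ t ∈ Icc 0 T, uIcc 0 t ⊆ uIcc 0 T := fun t ht => by
    rw [uIcc_of_le ht.1, uIcc_of_le hT]
    exact Icc_subset_Icc_right ht.2
  have hJ : ∀ t ∈ Icc 0 T, J t ≤ δ + C * ∫ s in (0 : ℝ)..t, J s := by
    intro t ht
    have := intervalIntegral.integral_mono_on ht.1 (he.mono_set (hsub t ht))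
      (hJi.mono_set (hsub t ht)) fun s hs => h s ⟨hs.1, hs.2.trans ht.2⟩
    simp only [J]
    gcongr
  have hK : ∀ t ∈ Icc 0 T, ∫ s in (0 : ℝ)..t, J s ≤ gronwallBound 0 C δ (t - 0) := by
    refine le_gronwallBound_of_liminf_deriv_right_le (f' := J) ?_ ?_ (by simp) ?_
    · have := intervalIntegral.continuousOn_primitive_interval' hJi (left_mem_uIcc)
      rwa [uIcc_of_le hT] at this
    · intro t ht r hr
      have hd : HasDerivWithinAt (fun t => ∫ s in (0 : ℝ)..t, J s) (J t) (Ici t) t := by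
        refine intervalIntegral.integral_hasDerivWithinAt_right
          (hJi.mono_set (hsub t ⟨ht.1, ht.2.le⟩)) (s := Ici t) (t := Ioi t) ?_ ?_
        · refine ⟨Ioo t T, Ioo_mem_nhdsGT ht.2, ?_⟩
          refine ContinuousOn.aestronglyMeasurable (hJc.mono ?_) measurableSet_Ioo
          exact fun x hx => ⟨ht.1.trans hx.1.le, hx.2.le⟩
        · have h1 := (hJc t ⟨ht.1, ht.2.le⟩)
          refine (h1.mono_of_mem_nhdsWithin ?_)
          refine mem_of_superset (Ioo_mem_nhdsGT ht.2) fun x hx => ⟨ht.1.trans hx.1.le, hx.2.le⟩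
      exact hd.liminf_right_slope_le hr
    · intro t ht
      have := hJ t ⟨ht.1, ht.2.le⟩
      linarith
  intro t ht
  have h1 := h t ht
  have h2 := hJ t ht
  have h3 := hK t ht
  rw [gronwallBound_of_K_ne_0 hC.ne', sub_zero] at h3
  simp only [zero_mul, zero_add] at h3
  have h4 : C * ∫ s in (0 : ℝ)..t, J s ≤ δ * (Real.exp (C * t) - 1) := by
    calc _ ≤ C * (δ / C * (Real.exp (C * t) - 1)) := by gcongr
      _ = _ := by field_simp
  have : e t ≤ J t := h1
  linarith

/-! ### Mild solutions -/

/-- `x` and `v` satisfy, up to an error `δ`, the equation of a price `x` with velocity `c` and of a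
volume density `v` with source `F`, the latter in the frame that moves with the price. -/
def Mild (T δ x0 : ℝ) (v0 : L2) (c : ℝ → ℝ) (F : ℝ → L2) (x : ℝ → ℝ) (v : ℝ → L2) : Prop :=
  ∀ t ∈ Icc 0 T, |x t - (x0 + ∫ s in (0 : ℝ)..t, c s)| ≤ δ ∧
    ‖v t - shift (x t - x0) (v0 + ∫ s in (0 : ℝ)..t, shift (x0 - x s) (F s))‖ ≤ δ

theorem shift_intervalIntegral {F : ℝ → L2} {a b : ℝ} (hF : IntervalIntegrable F volume a b)
    (h : ℝ) : shift h (∫ s in a..b, F s) = ∫ s in a..b, shift h (F s) :=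
  ((shiftL h).toContinuousLinearMap.intervalIntegral_comp_comm hF).symm

theorem intervalIntegrable_shift {F : ℝ → L2} {a b : ℝ} (hF : IntervalIntegrable F volume a b)
    (h : ℝ) : IntervalIntegrable (fun s => shift h (F s)) volume a b :=
  ⟨(shiftL h).toContinuousLinearMap.integrable_comp hF.1,
    (shiftL h).toContinuousLinearMap.integrable_comp hF.2⟩

/-- Each difference of translates splits into two translates of one unprimed function, controlled by
`κ` times the difference of displacements, and one translate of a difference, whose norm the
isometry preserves. This asymmetric splitting is why only the exact solution needs `TransLip` data.
In applications `e` is the distance of the states that drive the coefficients. -/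
theorem Mild.dist_le {T δ x0 x0' : ℝ} {v0 v0' : L2} {c c' : ℝ → ℝ} {F F' : ℝ → L2}
    {x x' : ℝ → ℝ} {v v' : ℝ → L2} (hS : Mild T 0 x0 v0 c F x v)
    (hY : Mild T δ x0' v0' c' F' x' v') {Λ Λ' κ : ℝ} (hΛ : 0 ≤ Λ) (hκ : 0 ≤ κ)
    (hc : IntervalIntegrable c volume 0 T) (hc' : IntervalIntegrable c' volume 0 T)
    (hF : IntervalIntegrable (fun s => shift (x0 - x s) (F s)) volume 0 T)
    (hF' : IntervalIntegrable (fun s => shift (x0' - x' s) (F' s)) volume 0 T)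
    {e : ℝ → ℝ} (he : IntervalIntegrable e volume 0 T) (he0 : ∀ s, 0 ≤ e s)
    (hcc : ∀ s ∈ Icc 0 T, |c s - c' s| ≤ Λ * e s)
    (hFF : ∀ s ∈ Icc 0 T, ‖F s - F' s‖ ≤ Λ' * e s)
    (hv0 : TransLip κ v0) (hFT : ∀ s ∈ Icc 0 T, TransLip κ (F s)) :
    ∀ t ∈ Icc 0 T, |x t - x' t| + ‖v t - v' t‖ ≤ |x0 - x0'| + ‖v0 - v0'‖ +
      (2 + κ + 2 * κ * T) * δ + ((1 + κ + 2 * κ * T) * Λ + Λ') * ∫ s in (0 : ℝ)..t, e s := by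
  intro t ht
  have hsub : ∀ t ∈ Icc 0 T, uIcc 0 t ⊆ uIcc 0 T := fun t ht => by
    rw [uIcc_of_le ht.1, uIcc_of_le (ht.1.trans ht.2)]
    exact Icc_subset_Icc_right ht.2
  set I := ∫ s in (0 : ℝ)..t, e s with hI
  -- `D` bounds the difference of the two price displacements uniformly on `[0, t]`.
  set D := δ + Λ * I with hD
  have hy : ∀ s ∈ Icc 0 t, |(x s - x0) - (x' s - x0')| ≤ D := by
    intro s hs
    have hsT : s ∈ Icc 0 T := ⟨hs.1, hs.2.trans ht.2⟩
    have h1 := (hS s hsT).1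
    have h2 := (hY s hsT).1
    have h3 : |(∫ r in (0 : ℝ)..s, c r) - ∫ r in (0 : ℝ)..s, c' r| ≤ Λ * I := by
      rw [← intervalIntegral.integral_sub (hc.mono_set (hsub s hsT)) (hc'.mono_set (hsub s hsT))]
      have h4 := intervalIntegral.norm_integral_le_of_norm_le (a := 0) (b := s) (μ := volume)
        (f := fun r => c r - c' r) (g := fun r => Λ * e r) hs.1
        (Eventually.of_forall fun r hr => hcc r ⟨hr.1.le, hr.2.trans hsT.2⟩)
        ((he.mono_set (hsub s hsT)).const_mul Λ)
      rw [Real.norm_eq_abs] at h4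
      refine h4.trans ?_
      rw [intervalIntegral.integral_const_mul]
      gcongr
      exact intervalIntegral.integral_mono_interval le_rfl hs.1 hs.2
        (Eventually.of_forall he0) (he.mono_set (hsub t ht))
    rw [abs_le] at *
    constructor <;> linarith [h1.1, h1.2, h2.1, h2.2, h3.1, h3.2]
  have hI0 : 0 ≤ I := intervalIntegral.integral_nonneg ht.1 fun s _ => he0 s
  have hD0 : 0 ≤ D := (abs_nonneg _).trans (hy t ⟨ht.1, le_rfl⟩)
  have hx : |x t - x' t| ≤ |x0 - x0'| + D := by
    have h1 := hy t ⟨ht.1, le_rfl⟩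
    calc _ = |((x t - x0) - (x' t - x0')) + (x0 - x0')| := by ring_nf
      _ ≤ _ := (abs_add_le _ _).trans (by linarith)
  set a := x t - x0 with ha
  set a' := x' t - x0' with ha'
  have hFt := hF.mono_set (hsub t ht)
  have hFt' := hF'.mono_set (hsub t ht)
  have hint : ‖shift a (∫ s in (0 : ℝ)..t, shift (x0 - x s) (F s)) -
      shift a' (∫ s in (0 : ℝ)..t, shift (x0' - x' s) (F' s))‖ ≤ 2 * κ * D * T + Λ' * I := by
    rw [shift_intervalIntegral hFt, shift_intervalIntegral hFt',
      ← intervalIntegral.integral_sub (intervalIntegrable_shift hFt a)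
        (intervalIntegrable_shift hFt' a')]
    have h4 := intervalIntegral.norm_integral_le_of_norm_le (a := 0) (b := t) (μ := volume)
        (f := fun s => shift a (shift (x0 - x s) (F s)) - shift a' (shift (x0' - x' s) (F' s)))
        (g := fun s => 2 * κ * D + Λ' * e s) ht.1
        (Eventually.of_forall fun s hs => ?_)
        (intervalIntegrable_const.add ((he.mono_set (hsub t ht)).const_mul Λ'))
    · refine h4.trans ?_
      rw [intervalIntegral.integral_add intervalIntegrable_const
        ((he.mono_set (hsub t ht)).const_mul Λ'), intervalIntegral.integral_const,
        intervalIntegral.integral_const_mul, smul_eq_mul, sub_zero]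
      have : t * (2 * κ * D) ≤ T * (2 * κ * D) := by
        gcongr
        exact ht.2
      linarith
    · have hsT : s ∈ Icc 0 T := ⟨hs.1.le, hs.2.trans ht.2⟩
      rw [shift_shift, shift_shift]
      have e1 : shift (a + (x0 - x s)) (F s) - shift (a' + (x0' - x' s)) (F' s) =
          (shift (a + (x0 - x s)) (F s) - shift (a' + (x0' - x' s)) (F s)) +
            shift (a' + (x0' - x' s)) (F s - F' s) := by
        rw [shift_sub]
        abel
      rw [e1]
      refine (norm_add_le _ _).trans ?_
      rw [norm_shift]
      refine add_le_add ?_ (hFF s hsT)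
      refine ((hFT s hsT).norm_shift_sub_shift_le _ _).trans ?_
      have h5 := hy s ⟨hs.1.le, hs.2⟩
      have h6 := hy t ⟨ht.1, le_rfl⟩
      -- The displacement from time `s` to time `t` carries the error at `s` and the error at `t`,
      -- hence the factor `2`.
      have h7 : |a + (x0 - x s) - (a' + (x0' - x' s))| ≤ 2 * D := by
        rw [abs_le] at *
        constructor <;> linarith [h5.1, h5.2, h6.1, h6.2]
      calc _ ≤ κ * (2 * D) := by gcongr
        _ = _ := by ring
  have hv : ‖v t - v' t‖ ≤ δ + (κ * D + ‖v0 - v0'‖) + (2 * κ * D * T + Λ' * I) := by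
    have h1 := (hS t ht).2
    have h2 := (hY t ht).2
    have h3 := norm_le_zero_iff.1 h1
    rw [sub_eq_zero] at h3
    rw [← ha', shift_add] at h2
    rw [h3, ← ha, shift_add]
    have h4 : ‖shift a v0 - shift a' v0'‖ ≤ κ * D + ‖v0 - v0'‖ := by
      have e1 : shift a v0 - shift a' v0' = (shift a v0 - shift a' v0) + shift a' (v0 - v0') := by
        rw [shift_sub]
        abel
      rw [e1]
      refine (norm_add_le _ _).trans ?_
      rw [norm_shift]
      gcongr
      refine (hv0.norm_shift_sub_shift_le _ _).trans ?_
      gcongr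
      exact hy t ⟨ht.1, le_rfl⟩
    generalize shift a (∫ s in (0 : ℝ)..t, shift (x0 - x s) (F s)) = U at *
    generalize shift a' (∫ s in (0 : ℝ)..t, shift (x0' - x' s) (F' s)) = U' at *
    have e2 : shift a v0 + U - v' t =
        -(v' t - (shift a' v0' + U')) + (shift a v0 - shift a' v0') + (U - U') := by abel
    rw [e2]
    refine (norm_add_le _ _).trans (add_le_add ((norm_add_le _ _).trans (add_le_add ?_ h4)) hint)
    rwa [norm_neg]
  calc _ ≤ (|x0 - x0'| + D) + (δ + (κ * D + ‖v0 - v0'‖) + (2 * κ * D * T + Λ' * I)) :=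
        add_le_add hx hv
    _ = _ := by rw [hD]; ring

/-- Curves of states that are measurable and bounded on `[0, T]`. -/
def Admissible (T : ℝ) (Y : ℝ → State) : Prop :=
  AEStronglyMeasurable Y (volume.restrict (Icc 0 T)) ∧ ∃ B, ∀ t ∈ Icc 0 T, ‖Y t‖ ≤ B

theorem Admissible.of_continuousOn {T : ℝ} {Y : ℝ → State} (h : ContinuousOn Y (Icc 0 T)) :
    Admissible T Y :=
  ⟨h.aestronglyMeasurable measurableSet_Icc, isCompact_Icc.exists_bound_of_continuousOn h⟩

theorem Admissible.of_step {T dt : ℝ} (hdt : 0 < dt) (G : ℕ → State) :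
    Admissible T fun t => G ⌊t / dt⌋₊ :=
  ⟨(stronglyMeasurable_step G).aestronglyMeasurable,
    (exists_bound_step hdt G T).imp fun _ hB t ht => hB t ht.2⟩

theorem Admissible.intervalIntegrable {H : Type*} [NormedAddCommGroup H] {T : ℝ}
    (hT : 0 ≤ T) {Y : ℝ → State} (hY : Admissible T Y) {Φ : State → H} (hΦ : Continuous Φ)
    (hb : ∀ r, ∃ C, ∀ s, ‖s‖ ≤ r → ‖Φ s‖ ≤ C) :
    IntervalIntegrable (fun t => Φ (Y t)) volume 0 T := by
  rw [intervalIntegrable_iff_integrableOn_Icc_of_le hT]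
  obtain ⟨B, hB⟩ := hY.2
  obtain ⟨C, hC⟩ := hb B
  refine Integrable.of_bound (hΦ.comp_aestronglyMeasurable hY.1) C ?_
  filter_upwards [ae_restrict_mem measurableSet_Icc] with t ht using hC _ (hB t ht)

theorem exists_bound_of_lipschitz {H : Type*} [NormedAddCommGroup H] {L : ℝ≥0} {Φ : State → H}
    (hΦ : LipschitzWith L Φ) (r : ℝ) : ∃ C, ∀ s, ‖s‖ ≤ r → ‖Φ s‖ ≤ C := by
  refine ⟨‖Φ 0‖ + L * r, fun s hs => ?_⟩
  have h1 := hΦ.dist_le_mul s 0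
  rw [dist_eq_norm, dist_zero_right] at h1
  have h2 := norm_le_norm_add_norm_sub' (Φ s) (Φ 0)
  have h3 : (L : ℝ) * ‖s‖ ≤ L * r := by gcongr
  linarith

/-- `S` is a mild solution up to an error `δ`. -/
def MildSol (T δ : ℝ) (p q : State → ℝ) (f g : State → L2) (s0 : State) (S : ℝ → State) : Prop :=
  Mild T δ s0.ask s0.va (fun t => p (S t)) (fun t => f (S t)) (fun t => (S t).ask)
      (fun t => (S t).va) ∧
    Mild T δ s0.bid s0.vb (fun t => q (S t)) (fun t => g (S t)) (fun t => (S t).bid)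
      (fun t => (S t).vb)

theorem Admissible.intervalIntegrable_shift {T : ℝ} (hT : 0 ≤ T) {Y : ℝ → State}
    (hY : Admissible T Y) {L : ℝ≥0} {f : State → L2} (hf : LipschitzWith L f) {a : State → ℝ}
    (ha : Continuous a) (x0 : ℝ) :
    IntervalIntegrable (fun s => shift (x0 - a (Y s)) (f (Y s))) volume 0 T := by
  refine hY.intervalIntegrable hT (Φ := fun s => shift (x0 - a s) (f s))
    (continuous_shift (by fun_prop) hf.continuous) fun r => ?_
  simp only [norm_shift]
  exact exists_bound_of_lipschitz hf r

/-- The constant in the stability estimate. -/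
noncomputable def stabilityConst (T κ L : ℝ) : ℝ :=
  (1 + 2 * (2 + κ + 2 * κ * T)) *
    Real.exp ((2 * ((1 + κ + 2 * κ * T) * (2 * L) + L) + 1) * T)

/-- Stability of mild solutions which are Lipschitz with respect to translations. -/
theorem MildSol.dist_le {T δ κ : ℝ} (hT : 0 ≤ T) (hδ : 0 ≤ δ) (hκ : 0 ≤ κ) {L : ℝ≥0}
    {p q : State → ℝ} {f g : State → L2} (hp : LipschitzWith (2 * L) p)
    (hq : LipschitzWith (2 * L) q) (hf : LipschitzWith L f) (hg : LipschitzWith L g)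
    {s0 s0' : State} {S Y : ℝ → State} (hS : MildSol T 0 p q f g s0 S)
    (hY : MildSol T δ p q f g s0' Y) (hSa : Admissible T S) (hYa : Admissible T Y)
    (hva : TransLip κ s0.va) (hvb : TransLip κ s0.vb)
    (hfS : ∀ t ∈ Icc 0 T, TransLip κ (f (S t))) (hgS : ∀ t ∈ Icc 0 T, TransLip κ (g (S t))) :
    ∀ t ∈ Icc 0 T, ‖S t - Y t‖ ≤ stabilityConst T κ L * (‖s0 - s0'‖ + δ) := by
  have he : IntervalIntegrable (fun t => ‖S t - Y t‖) volume 0 T := by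
    rw [intervalIntegrable_iff_integrableOn_Icc_of_le hT]
    obtain ⟨B, hB⟩ := hSa.2
    obtain ⟨B', hB'⟩ := hYa.2
    refine Integrable.of_bound (hSa.1.sub hYa.1).norm (B + B') ?_
    filter_upwards [ae_restrict_mem measurableSet_Icc] with t ht
    rw [norm_norm]
    exact (norm_sub_le _ _).trans (add_le_add (hB t ht) (hB' t ht))
  have hlip : ∀ {Φ : State → ℝ}, LipschitzWith (2 * L) Φ → ∀ s s', |Φ s - Φ s'| ≤
      2 * L * ‖s - s'‖ := fun h s s' => by
    simpa [Real.dist_eq, dist_eq_norm] using h.dist_le_mul s s'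
  have hlip' : ∀ {Φ : State → L2}, LipschitzWith L Φ → ∀ s s', ‖Φ s - Φ s'‖ ≤
      L * ‖s - s'‖ := fun h s s' => by
    simpa [dist_eq_norm] using h.dist_le_mul s s'
  have ha := hS.1.dist_le hY.1 (Λ := 2 * L) (Λ' := L) (by positivity) hκ
    (hSa.intervalIntegrable hT hp.continuous (exists_bound_of_lipschitz hp))
    (hYa.intervalIntegrable hT hp.continuous (exists_bound_of_lipschitz hp))
    (hSa.intervalIntegrable_shift hT hf State.continuous_ask _)
    (hYa.intervalIntegrable_shift hT hf State.continuous_ask _) he (fun _ => norm_nonneg _)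
    (fun s _ => hlip hp _ _) (fun s _ => hlip' hf _ _) hva hfS
  have hb := hS.2.dist_le hY.2 (Λ := 2 * L) (Λ' := L) (by positivity) hκ
    (hSa.intervalIntegrable hT hq.continuous (exists_bound_of_lipschitz hq))
    (hYa.intervalIntegrable hT hq.continuous (exists_bound_of_lipschitz hq))
    (hSa.intervalIntegrable_shift hT hg State.continuous_bid _)
    (hYa.intervalIntegrable_shift hT hg State.continuous_bid _) he (fun _ => norm_nonneg _)
    (fun s _ => hlip hq _ _) (fun s _ => hlip' hg _ _) hvb hgS
  set Q := 1 + κ + 2 * κ * T with hQ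
  have hQ0 : 0 ≤ Q := by positivity
  -- The bounds for the ask and the bid side are added, hence the factor `2`. The extra `1` keeps
  -- the Grönwall constant positive when `L = 0`.
  have hmain := gronwall_integral (C := 2 * (Q * (2 * L) + L) + 1)
    (δ := ‖s0 - s0'‖ + 2 * (1 + Q) * δ) (by positivity) hT he (fun t ht => by
      have h1 := ha t ht
      have h2 := hb t ht
      have hI0 : 0 ≤ ∫ s in (0 : ℝ)..t, ‖S s - Y s‖ :=
        intervalIntegral.integral_nonneg ht.1 fun s _ => norm_nonneg _
      rw [State.norm_sub_eq, State.norm_sub_eq s0]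
      have e1 : 2 + κ + 2 * κ * T = 1 + Q := by rw [hQ]; ring
      rw [e1] at h1 h2
      linarith)
  intro t ht
  refine (hmain t ht).trans ?_
  unfold stabilityConst
  have e1 : 2 + κ + 2 * κ * T = 1 + Q := by rw [hQ]; ring
  rw [e1, ← hQ]
  have h1 : Real.exp ((2 * (Q * (2 * L) + L) + 1) * t) ≤
      Real.exp ((2 * (Q * (2 * L) + L) + 1) * T) := by
    refine Real.exp_le_exp.2 ?_
    gcongr
    exact ht.2
  have h2 : ‖s0 - s0'‖ + 2 * (1 + Q) * δ ≤ (1 + 2 * (1 + Q)) * (‖s0 - s0'‖ + δ) := by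
    have := norm_nonneg (s0 - s0')
    nlinarith [mul_nonneg hQ0 this]
  calc _ ≤ ((1 + 2 * (1 + Q)) * (‖s0 - s0'‖ + δ)) *
        Real.exp ((2 * (Q * (2 * L) + L) + 1) * T) := by gcongr
    _ = _ := by ring

/-! ### Existence of mild solutions -/

/-- The projection of the real line onto `[0, T]`. -/
noncomputable def clamp (T t : ℝ) : ℝ := max 0 (min T t)

theorem continuous_clamp (T : ℝ) : Continuous (clamp T) := by
  unfold clamp
  fun_prop

theorem clamp_mem {T : ℝ} (hT : 0 ≤ T) (t : ℝ) : clamp T t ∈ Icc 0 T :=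
  ⟨le_max_left _ _, max_le hT (min_le_left _ _)⟩

theorem clamp_of_mem {T t : ℝ} (ht : t ∈ Icc 0 T) : clamp T t = t := by
  unfold clamp
  rw [min_eq_right ht.2, max_eq_right ht.1]

theorem Mild.congr {T δ x0 : ℝ} {v0 : L2} {c c' : ℝ → ℝ} {F F' : ℝ → L2} {x x' : ℝ → ℝ}
    {v v' : ℝ → L2} (h : Mild T δ x0 v0 c F x v) (hc : EqOn c c' (Icc 0 T))
    (hF : EqOn F F' (Icc 0 T)) (hx : EqOn x x' (Icc 0 T)) (hv : EqOn v v' (Icc 0 T)) :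
    Mild T δ x0 v0 c' F' x' v' := by
  intro t ht
  have hsub : ∀ s ∈ uIcc 0 t, s ∈ Icc 0 T := fun s hs => by
    rw [uIcc_of_le ht.1] at hs
    exact ⟨hs.1, hs.2.trans ht.2⟩
  rw [← hx ht, ← hv ht, ← intervalIntegral.integral_congr fun s hs => hc (hsub s hs),
    ← intervalIntegral.integral_congr (f := fun s => shift (x0 - x s) (F s)) fun s hs => by
      simp only [hx (hsub s hs), hF (hsub s hs)]]
  exact h t ht

/-- The price with velocity `c`. -/
noncomputable def priceOf (x0 : ℝ) (c : ℝ → ℝ) (t : ℝ) : ℝ := x0 + ∫ s in (0 : ℝ)..t, c s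

/-- The volume density which is transported with velocity `c` and has source `F`. -/
noncomputable def volumeOf (x0 : ℝ) (v0 : L2) (c : ℝ → ℝ) (F : ℝ → L2) (t : ℝ) : L2 :=
  shift (priceOf x0 c t - x0) (v0 + ∫ s in (0 : ℝ)..t, shift (x0 - priceOf x0 c s) (F s))

theorem mild_priceOf_volumeOf (T x0 : ℝ) (v0 : L2) (c : ℝ → ℝ) (F : ℝ → L2) :
    Mild T 0 x0 v0 c F (priceOf x0 c) (volumeOf x0 v0 c F) := by
  intro t _
  simp [priceOf, volumeOf]

theorem continuous_priceOf (x0 : ℝ) {c : ℝ → ℝ} (hc : Continuous c) :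
    Continuous (priceOf x0 c) :=
  continuous_const.add (intervalIntegral.continuous_primitive
    (fun a b => hc.intervalIntegrable a b) 0)

theorem continuous_volumeOf (x0 : ℝ) (v0 : L2) {c : ℝ → ℝ} (hc : Continuous c) {F : ℝ → L2}
    (hF : Continuous F) : Continuous (volumeOf x0 v0 c F) := by
  have h1 := continuous_priceOf x0 hc
  have h2 : Continuous fun s => shift (x0 - priceOf x0 c s) (F s) :=
    continuous_shift (by fun_prop) hF
  refine continuous_shift (by fun_prop) (continuous_const.add
    (intervalIntegral.continuous_primitive (fun a b => h2.intervalIntegrable a b) 0))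

/-- The integral is `t` times an average, and averages stay in a closed convex set. -/
theorem LipVol.intervalIntegral_mem {K : ℝ≥0} {F : ℝ → L2} (hF : Continuous F) {T t : ℝ}
    (ht : t ∈ Icc 0 T) (h : ∀ s ∈ Icc 0 T, F s ∈ LipVol K) :
    (∫ s in (0 : ℝ)..t, F s) ∈ LipVol (Real.toNNReal T * K) := by
  rcases ht.1.eq_or_lt with h0 | h0
  · rw [← h0, intervalIntegral.integral_same]
    exact LipVol.zero_mem _
  · have h1 := (convex_lipVol K).set_average_mem (μ := volume) (t := Ioc 0 t) (f := F)
      (isClosed_lipVol K) (by simpa using h0) (by simp)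
      (by
        filter_upwards [ae_restrict_mem measurableSet_Ioc] with s hs
        exact h s ⟨hs.1.le, hs.2.trans ht.2⟩)
      ((hF.intervalIntegrable 0 t).1)
    rw [setAverage_eq, measureReal_def, Real.volume_Ioc, sub_zero,
      ENNReal.toReal_ofReal ht.1] at h1
    have h2 := LipVol.smul h1 t
    rw [smul_smul, mul_inv_cancel₀ h0.ne', one_smul] at h2
    rw [intervalIntegral.integral_of_le ht.1]
    refine LipVol.mono ?_ h2
    gcongr
    rw [← NNReal.coe_le_coe, coe_nnnorm, Real.norm_of_nonneg ht.1,
      Real.coe_toNNReal _ (ht.1.trans ht.2)]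
    exact ht.2

theorem volumeOf_mem_lipVol {K K' : ℝ≥0} {x0 : ℝ} {v0 : L2} (hv0 : v0 ∈ LipVol K) {c : ℝ → ℝ}
    (hc : Continuous c) {F : ℝ → L2} (hF : Continuous F) {T t : ℝ} (ht : t ∈ Icc 0 T)
    (h : ∀ s ∈ Icc 0 T, F s ∈ LipVol K') :
    volumeOf x0 v0 c F t ∈ LipVol (K + Real.toNNReal T * K') := by
  have h1 := continuous_priceOf x0 hc
  have h2 : Continuous fun s => shift (x0 - priceOf x0 c s) (F s) :=
    continuous_shift (by fun_prop) hF
  refine LipVol.shift (LipVol.add hv0 (LipVol.intervalIntegral_mem h2 ht fun s hs => ?_)) _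
  exact LipVol.shift (h s hs) _

/-- The Picard iteration. -/
noncomputable def picard (p q : State → ℝ) (f g : State → L2) (s0 : State) (Y : ℝ → State)
    (t : ℝ) : State :=
  State.mk (priceOf s0.ask (fun s => p (Y s)) t)
    (volumeOf s0.ask s0.va (fun s => p (Y s)) (fun s => f (Y s)) t)
    (priceOf s0.bid (fun s => q (Y s)) t)
    (volumeOf s0.bid s0.vb (fun s => q (Y s)) (fun s => g (Y s)) t)

theorem continuous_picard {p q : State → ℝ} {f g : State → L2} (hp : Continuous p)
    (hq : Continuous q) (hf : Continuous f) (hg : Continuous g) (s0 : State) {Y : ℝ → State}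
    (hY : Continuous Y) : Continuous (picard p q f g s0 Y) := by
  refine State.continuous_mk.comp (f := fun t => ((_, _), (_, _)))
    (Continuous.prodMk (Continuous.prodMk ?_ ?_) (Continuous.prodMk ?_ ?_))
  · exact continuous_priceOf _ (hp.comp hY)
  · exact continuous_volumeOf _ _ (hp.comp hY) (hf.comp hY)
  · exact continuous_priceOf _ (hq.comp hY)
  · exact continuous_volumeOf _ _ (hq.comp hY) (hg.comp hY)

/-- A Picard iterate is an exact mild solution with the coefficients frozen along the previous
curve, so `Mild.dist_le` applies with `δ = 0` and equal initial data. -/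
theorem norm_picard_sub_picard_le {T κ : ℝ} (hκ : 0 ≤ κ) {L : ℝ≥0}
    {p q : State → ℝ} {f g : State → L2} (hp : LipschitzWith (2 * L) p)
    (hq : LipschitzWith (2 * L) q) (hf : LipschitzWith L f) (hg : LipschitzWith L g)
    {s0 : State} {Y Y' : ℝ → State} (hY : Continuous Y) (hY' : Continuous Y')
    (hva : TransLip κ s0.va) (hvb : TransLip κ s0.vb)
    (hfY : ∀ t ∈ Icc 0 T, TransLip κ (f (Y t))) (hgY : ∀ t ∈ Icc 0 T, TransLip κ (g (Y t))) :
    ∀ t ∈ Icc 0 T, ‖picard p q f g s0 Y t - picard p q f g s0 Y' t‖ ≤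
      (2 * ((1 + κ + 2 * κ * T) * (2 * L) + L)) * ∫ s in (0 : ℝ)..t, ‖Y s - Y' s‖ := by
  have hlip : ∀ {Φ : State → ℝ}, LipschitzWith (2 * L) Φ → ∀ s s', |Φ s - Φ s'| ≤
      2 * L * ‖s - s'‖ := fun h s s' => by
    simpa [Real.dist_eq, dist_eq_norm] using h.dist_le_mul s s'
  have hlip' : ∀ {Φ : State → L2}, LipschitzWith L Φ → ∀ s s', ‖Φ s - Φ s'‖ ≤
      L * ‖s - s'‖ := fun h s s' => by
    simpa [dist_eq_norm] using h.dist_le_mul s s'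
  have hcs : ∀ {x0 : ℝ} {p : State → ℝ} {f : State → L2} {Y : ℝ → State}, Continuous p →
      Continuous f → Continuous Y → IntervalIntegrable
        (fun s => shift (x0 - priceOf x0 (fun s => p (Y s)) s) (f (Y s))) volume 0 T := by
    intro x0 p f Y hp hf hY
    have h1 := continuous_priceOf x0 (hp.comp hY)
    exact (continuous_shift (continuous_const.sub h1) (hf.comp hY)).intervalIntegrable _ _
  have he := (hY.sub hY').norm.intervalIntegrable (μ := volume) 0 T
  have ha := (mild_priceOf_volumeOf T s0.ask s0.va (fun s => p (Y s)) fun s => f (Y s)).dist_le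
    (mild_priceOf_volumeOf T s0.ask s0.va (fun s => p (Y' s)) fun s => f (Y' s))
    (Λ := 2 * L) (Λ' := L) (by positivity) hκ
    ((hp.continuous.comp hY).intervalIntegrable _ _)
    ((hp.continuous.comp hY').intervalIntegrable _ _)
    (hcs hp.continuous hf.continuous hY) (hcs hp.continuous hf.continuous hY') he
    (fun _ => norm_nonneg _) (fun s _ => hlip hp _ _) (fun s _ => hlip' hf _ _) hva hfY
  have hb := (mild_priceOf_volumeOf T s0.bid s0.vb (fun s => q (Y s)) fun s => g (Y s)).dist_le
    (mild_priceOf_volumeOf T s0.bid s0.vb (fun s => q (Y' s)) fun s => g (Y' s))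
    (Λ := 2 * L) (Λ' := L) (by positivity) hκ
    ((hq.continuous.comp hY).intervalIntegrable _ _)
    ((hq.continuous.comp hY').intervalIntegrable _ _)
    (hcs hq.continuous hg.continuous hY) (hcs hq.continuous hg.continuous hY') he
    (fun _ => norm_nonneg _) (fun s _ => hlip hq _ _) (fun s _ => hlip' hg _ _) hvb hgY
  intro t ht
  have h1 := ha t ht
  have h2 := hb t ht
  simp only [sub_self, abs_zero, norm_zero, mul_zero, add_zero, zero_add, Pi.sub_apply] at h1 h2
  rw [State.norm_sub_eq]
  simp only [picard, State.ask_mk, State.va_mk, State.bid_mk, State.vb_mk]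
  linarith

/-- The regularity of the sources is known only at states with Lipschitz densities, but there with
bounds that do not depend on the Lipschitz constant of the state. Hence the iteration preserves a
fixed class of curves, on which it has the usual factorial convergence. -/
theorem exists_mildSol {T κ : ℝ} (hT : 0 ≤ T) (hκ : 0 ≤ κ) {L K0 K1 : ℝ≥0}
    {p q : State → ℝ} {f g : State → L2} (hp : LipschitzWith (2 * L) p)
    (hq : LipschitzWith (2 * L) q) (hf : LipschitzWith L f) (hg : LipschitzWith L g)
    {s0 : State} (hva : TransLip κ s0.va) (hvb : TransLip κ s0.vb)
    (hva' : s0.va ∈ LipVol K0) (hvb' : s0.vb ∈ LipVol K0)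
    (hfK : ∀ s : State, IsLipschitzVolume s.va → IsLipschitzVolume s.vb →
      TransLip κ (f s) ∧ f s ∈ LipVol K1)
    (hgK : ∀ s : State, IsLipschitzVolume s.va → IsLipschitzVolume s.vb →
      TransLip κ (g s) ∧ g s ∈ LipVol K1) :
    ∃ S : ℝ → State, Continuous S ∧ S 0 = s0 ∧
      (∀ t, IsLipschitzVolume (S t).va ∧ IsLipschitzVolume (S t).vb) ∧
      MildSol T 0 p q f g s0 S := by
  -- The initial density contributes `K0`, and sources accumulated over a time at most `T`
  -- contribute at most `T * K1`; translations change neither.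
  set K := K0 + Real.toNNReal T * K1 with hK
  set Good : (ℝ → State) → Prop := fun Y => Continuous Y ∧
    ∀ t ∈ Icc 0 T, (Y t).va ∈ LipVol K ∧ (Y t).vb ∈ LipVol K with hGood
  set Φ := picard p q f g s0
  have hΦ : ∀ Y, Good Y → Good (Φ Y) := by
    rintro Y ⟨hY, hYL⟩
    refine ⟨continuous_picard hp.continuous hq.continuous hf.continuous hg.continuous s0 hY,
      fun t ht => ⟨?_, ?_⟩⟩
    · exact volumeOf_mem_lipVol hva' (hp.continuous.comp hY) (hf.continuous.comp hY) ht
        fun s hs => (hfK _ (LipVol.isLipschitzVolume (hYL s hs).1) (LipVol.isLipschitzVolume (hYL s hs).2)).2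
    · exact volumeOf_mem_lipVol hvb' (hq.continuous.comp hY) (hg.continuous.comp hY) ht
        fun s hs => (hgK _ (LipVol.isLipschitzVolume (hYL s hs).1) (LipVol.isLipschitzVolume (hYL s hs).2)).2
  set C : ℝ := 2 * ((1 + κ + 2 * κ * T) * (2 * L) + L) with hC
  have hC0 : 0 ≤ C := by positivity
  have hstep : ∀ Y Y', Good Y → Good Y' → ∀ t ∈ Icc 0 T,
      ‖Φ Y t - Φ Y' t‖ ≤ C * ∫ s in (0 : ℝ)..t, ‖Y s - Y' s‖ := by
    rintro Y Y' ⟨hY, hYL⟩ ⟨hY', -⟩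
    exact norm_picard_sub_picard_le hκ hp hq hf hg hY hY' hva hvb
      (fun s hs => (hfK _ (LipVol.isLipschitzVolume (hYL s hs).1) (LipVol.isLipschitzVolume (hYL s hs).2)).1)
      (fun s hs => (hgK _ (LipVol.isLipschitzVolume (hYL s hs).1) (LipVol.isLipschitzVolume (hYL s hs).2)).1)
  clear_value C
  set Y : ℕ → ℝ → State := fun n => Φ^[n] fun _ => s0 with hYdef
  have hYs : ∀ n, Y (n + 1) = Φ (Y n) := fun n => Function.iterate_succ_apply' Φ n _
  have hYG : ∀ n, Good (Y n) := by
    intro n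
    induction n with
    | zero =>
      exact ⟨continuous_const, fun t _ => ⟨LipVol.mono le_self_add hva',
        LipVol.mono le_self_add hvb'⟩⟩
    | succ n ih =>
      rw [hYs]
      exact hΦ _ ih
  obtain ⟨D, hD⟩ := isCompact_Icc.exists_bound_of_continuousOn
    (((hYG 1).1.sub (hYG 0).1).continuousOn (s := Icc 0 T))
  have hD0 : 0 ≤ D := (norm_nonneg _).trans (hD 0 ⟨le_rfl, hT⟩)
  have hfac : ∀ n : ℕ, ∀ t ∈ Icc 0 T, ‖Y (n + 1) t - Y n t‖ ≤ D * (C * t) ^ n / n.factorial := by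
    intro n
    induction n with
    | zero => simpa using hD
    | succ n ih =>
      intro t ht
      have h1 := hstep _ _ (hYG (n + 1)) (hYG n) t ht
      rw [← hYs, ← hYs] at h1
      refine h1.trans ?_
      have h2 : ∫ s in (0 : ℝ)..t, ‖Y (n + 1) s - Y n s‖ ≤
          ∫ s in (0 : ℝ)..t, D * C ^ n / n.factorial * s ^ n := by
        refine intervalIntegral.integral_mono_on ht.1
          (((hYG (n + 1)).1.sub (hYG n).1).norm.intervalIntegrable _ _)
          (Continuous.intervalIntegrable (by fun_prop) _ _) fun s hs => ?_
        refine (ih s ⟨hs.1, hs.2.trans ht.2⟩).trans (le_of_eq ?_)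
        rw [mul_pow]
        ring
      rw [intervalIntegral.integral_const_mul, integral_pow] at h2
      calc _ ≤ C * (D * C ^ n / n.factorial * ((t ^ (n + 1) - 0 ^ (n + 1)) / (n + 1))) := by gcongr
        _ = _ := by
          rw [Nat.factorial_succ, zero_pow (by omega)]
          push_cast
          rw [sub_zero, mul_pow]
          field_simp
          ring
  set d : ℕ → ℝ := fun n => D * ((C * T) ^ n / n.factorial) with hd
  have hdsum : Summable d := (Real.summable_pow_div_factorial (C * T)).mul_left D
  have hdist : ∀ t ∈ Icc 0 T, ∀ n, dist (Y n t) (Y (n + 1) t) ≤ d n := by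
    intro t ht n
    rw [dist_comm, dist_eq_norm]
    refine (hfac n t ht).trans ?_
    have := ht.1
    have h2 : (C * t) ^ n ≤ (C * T) ^ n := by
      gcongr
      exact ht.2
    simp only [hd]
    rw [mul_div_assoc]
    gcongr
  -- Freezing time outside `[0, T]` makes the convergence uniform on the whole line, so that the
  -- limit is continuous with Lipschitz densities at every real time.
  have hlim : ∀ t, ∃ y, Tendsto (fun n => Y n (clamp T t)) atTop (𝓝 y) := fun t =>
    cauchySeq_tendsto_of_complete
      (cauchySeq_of_dist_le_of_summable d (hdist _ (clamp_mem hT t)) hdsum)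
  choose S hS using hlim
  have hSt : ∀ t ∈ Icc 0 T, Tendsto (fun n => Y n t) atTop (𝓝 (S t)) := fun t ht => by
    simpa only [clamp_of_mem ht] using hS t
  have htail : ∀ n t, dist (Y n (clamp T t)) (S t) ≤ ∑' m, d (n + m) := fun n t =>
    dist_le_tsum_of_dist_le_of_tendsto d (hdist _ (clamp_mem hT t)) hdsum (hS t) n
  have htail0 : Tendsto (fun n => ∑' m, d (n + m)) atTop (𝓝 0) := by
    simpa only [add_comm] using tendsto_sum_nat_add d
  have hunif : TendstoUniformly (fun n t => Y n (clamp T t)) S atTop := by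
    rw [Metric.tendstoUniformly_iff]
    intro ε hε
    filter_upwards [htail0.eventually_lt_const hε] with n hn t
    rw [dist_comm]
    exact (htail n t).trans_lt hn
  have hSc : Continuous S := hunif.continuous
    (Frequently.of_forall fun n => (hYG n).1.comp (continuous_clamp T))
  have hSL : ∀ t, (S t).va ∈ LipVol K ∧ (S t).vb ∈ LipVol K := fun t =>
    ⟨(isClosed_lipVol K).mem_of_tendsto ((State.continuous_va.tendsto _).comp (hS t))
      (Eventually.of_forall fun n => ((hYG n).2 _ (clamp_mem hT t)).1),
    (isClosed_lipVol K).mem_of_tendsto ((State.continuous_vb.tendsto _).comp (hS t))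
      (Eventually.of_forall fun n => ((hYG n).2 _ (clamp_mem hT t)).2)⟩
  have hfix : ∀ t ∈ Icc 0 T, Φ S t = S t := by
    intro t ht
    refine tendsto_nhds_unique (f := fun n => Y (n + 1) t) (l := atTop) ?_
      ((tendsto_add_atTop_iff_nat 1).2 (hSt t ht))
    rw [tendsto_iff_dist_tendsto_zero]
    have h0 : Tendsto (fun n => C * (t * ∑' m, d (n + m))) atTop (𝓝 0) := by
      simpa using (htail0.const_mul t).const_mul C
    refine squeeze_zero (fun _ => dist_nonneg) (fun n => ?_) h0
    rw [dist_eq_norm, hYs]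
    refine (hstep _ _ (hYG n) ⟨hSc, fun t _ => hSL t⟩ t ht).trans
      (mul_le_mul_of_nonneg_left ?_ hC0)
    have h1 : ∫ s in (0 : ℝ)..t, ‖Y n s - S s‖ ≤ ∫ s in (0 : ℝ)..t, ∑' m, d (n + m) := by
      refine intervalIntegral.integral_mono_on ht.1
        (((hYG n).1.sub hSc).norm.intervalIntegrable _ _) intervalIntegrable_const fun s hs => ?_
      have := htail n s
      rwa [clamp_of_mem ⟨hs.1, hs.2.trans ht.2⟩, dist_eq_norm] at this
    simpa using h1
  refine ⟨S, hSc, ?_, fun t => ⟨(LipVol.isLipschitzVolume (hSL t).1), (LipVol.isLipschitzVolume (hSL t).2)⟩, ?_, ?_⟩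
  · rw [← hfix 0 ⟨le_rfl, hT⟩]
    simp only [Φ, picard, priceOf, volumeOf, intervalIntegral.integral_same, add_zero, sub_self,
      shift_zero]
    rfl
  · exact (mild_priceOf_volumeOf T s0.ask s0.va (fun s => p (S s)) fun s => f (S s)).congr
      (fun _ _ => rfl) (fun _ _ => rfl) (fun t ht => congrArg State.ask (hfix t ht))
      fun t ht => congrArg State.va (hfix t ht)
  · exact (mild_priceOf_volumeOf T s0.bid s0.vb (fun s => q (S s)) fun s => g (S s)).congr
      (fun _ _ => rfl) (fun _ _ => rfl) (fun t ht => congrArg State.bid (hfix t ht))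
      fun t ht => congrArg State.vb (hfix t ht)

/-! ### A maximal inequality for martingales with values in a Hilbert space -/

section Martingale

variable {Ω : Type*} {m0 : MeasurableSpace Ω} {P : Measure Ω} [IsProbabilityMeasure P]
  {H : Type*} [NormedAddCommGroup H] [InnerProductSpace ℝ H]

/-- The past-measurable factor is pulled out of the conditional expectation, through the inner
product as a bilinear map. -/
theorem integral_inner_eq_zero [CompleteSpace H] {m : MeasurableSpace Ω} (hm : m ≤ m0)
    {Y Z : Ω → H} (hY : StronglyMeasurable[m] Y) {C : ℝ} (hYC : ∀ᵐ w ∂P, ‖Y w‖ ≤ C)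
    (hZ : Integrable Z P) (hZ0 : P[Z | m] =ᵐ[P] 0) : ∫ w, inner ℝ (Y w) (Z w) ∂P = 0 := by
  have h := condExp_stronglyMeasurable_bilin_of_bound (innerSL ℝ) hm hY hZ C hYC
  have h2 : ∫ w, inner ℝ (Y w) (Z w) ∂P = ∫ w, (P[fun w => innerSL ℝ (Y w) (Z w) | m]) w ∂P :=
    (integral_condExp hm).symm
  rw [h2, integral_congr_ae h]
  refine integral_eq_zero_of_ae ?_
  filter_upwards [hZ0] with w hw
  rw [hw]
  simp

/-- Orthogonality to the past makes the squared norm of the partial sums a real submartingale whose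
mean is the sum of the variances, and Doob's maximal inequality applies to it. The martingale
property is stated through inner products because the increments of the density carry a random
translation, which the isometry moves to the other factor. -/
theorem measure_exists_norm_sum_ge_le (𝒢 : Filtration ℕ m0) {D : ℕ → Ω → H}
    (hD : ∀ k, StronglyMeasurable[𝒢 (k + 1)] (D k)) {C : ℕ → ℝ}
    (hDC : ∀ k, ∀ᵐ w ∂P, ‖D k w‖ ≤ C k)
    (horth : ∀ k, ∀ Y : Ω → H, StronglyMeasurable[𝒢 k] Y → (∃ C, ∀ᵐ w ∂P, ‖Y w‖ ≤ C) →
      ∫ w, inner ℝ (Y w) (D k w) ∂P = 0) (N : ℕ) {ε : ℝ} (hε : 0 < ε) :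
    P {w | ∃ k ≤ N, ε ≤ ‖∑ j ∈ Finset.range k, D j w‖} ≤
      ENNReal.ofReal ((∑ j ∈ Finset.range N, ∫ w, ‖D j w‖ ^ 2 ∂P) / ε ^ 2) := by
  set S : ℕ → Ω → H := fun k w => ∑ j ∈ Finset.range k, D j w with hSdef
  have hSs : ∀ k w, S (k + 1) w = S k w + D k w := fun k w => Finset.sum_range_succ _ _
  have hSm : ∀ k, StronglyMeasurable[𝒢 k] (S k) := fun k =>
    Finset.stronglyMeasurable_fun_sum _ fun j hj =>
      (hD j).mono (𝒢.mono (Finset.mem_range.1 hj))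
  have hSC : ∀ k, ∃ B, ∀ᵐ w ∂P, ‖S k w‖ ≤ B := fun k => by
    refine ⟨∑ j ∈ Finset.range k, C j, ?_⟩
    filter_upwards [ae_all_iff.2 hDC] with w hw
    exact (norm_sum_le _ _).trans (Finset.sum_le_sum fun j _ => hw j)
  have hsq : ∀ {m : MeasurableSpace Ω}, m ≤ m0 → ∀ {Z : Ω → H}, StronglyMeasurable[m] Z →
      (∃ B, ∀ᵐ w ∂P, ‖Z w‖ ≤ B) → Integrable (fun w => ‖Z w‖ ^ 2) P := by
    rintro m hm Z hZ ⟨B, hB⟩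
    refine Integrable.of_bound ((hZ.mono hm).norm.pow 2).aestronglyMeasurable (B ^ 2) ?_
    filter_upwards [hB] with w hw
    rw [norm_pow, norm_norm]
    gcongr
  have hDint := fun k => hsq (𝒢.le _) (hD k) ⟨C k, hDC k⟩
  have hSint := fun k => hsq (𝒢.le _) (hSm k) (hSC k)
  have hinner : ∀ k, ∀ Y : Ω → H, StronglyMeasurable[𝒢 k] Y → (∃ B, ∀ᵐ w ∂P, ‖Y w‖ ≤ B) →
      Integrable (fun w => inner ℝ (Y w) (D k w)) P := by
    rintro k Y hY ⟨B, hB⟩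
    refine Integrable.of_bound
      ((hY.mono (𝒢.le k)).aestronglyMeasurable.inner ((hD k).mono (𝒢.le _)).aestronglyMeasurable)
      (B * C k) ?_
    filter_upwards [hB, hDC k] with w h1 h2
    refine (norm_inner_le_norm _ _).trans ?_
    have := (norm_nonneg _).trans h1
    gcongr
  have hexp : ∀ k w, ‖S (k + 1) w‖ ^ 2 =
      ‖S k w‖ ^ 2 + 2 * inner ℝ (S k w) (D k w) + ‖D k w‖ ^ 2 := fun k w => by
    rw [hSs, norm_add_sq_real]
  -- The partial sum restricted to an event of the past is again a bounded past-measurable function,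
  -- so it is an admissible test function.
  have hset : ∀ k (A : Set Ω), MeasurableSet[𝒢 k] A →
      ∫ w in A, inner ℝ (S k w) (D k w) ∂P = 0 := by
    intro k A hA
    rw [← integral_indicator (𝒢.le k A hA)]
    rw [← horth k (A.indicator (S k)) ((hSm k).indicator hA) ?_]
    · refine integral_congr_ae (Eventually.of_forall fun w => ?_)
      by_cases hw : w ∈ A <;> simp [hw]
    · obtain ⟨B, hB⟩ := hSC k
      refine ⟨B, ?_⟩
      filter_upwards [hB] with w hw
      exact (norm_indicator_le_norm_self _ _).trans hw
  have hsub : Submartingale (fun k w => ‖S k w‖ ^ 2) 𝒢 P := by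
    refine submartingale_of_setIntegral_le_succ (fun k => (hSm k).norm.pow 2) hSint ?_
    intro k A hA
    simp only [hexp]
    have i1 := (hSint k).integrableOn (s := A)
    have i2 := ((hinner k (S k) (hSm k) (hSC k)).const_mul 2).integrableOn (s := A)
    have i3 := (hDint k).integrableOn (s := A)
    have i12 : IntegrableOn (fun w => ‖S k w‖ ^ 2 + 2 * inner ℝ (S k w) (D k w)) A P := i1.add i2
    rw [integral_add i12 i3, integral_add i1 i2, integral_const_mul, hset k A hA]
    have : 0 ≤ ∫ w in A, ‖D k w‖ ^ 2 ∂P := integral_nonneg fun w => by positivity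
    linarith
  have hvar : ∀ k, ∫ w, ‖S k w‖ ^ 2 ∂P = ∑ j ∈ Finset.range k, ∫ w, ‖D j w‖ ^ 2 ∂P := by
    intro k
    induction k with
    | zero => simp [hSdef]
    | succ k ih =>
      simp only [hexp]
      have i2 := (hinner k (S k) (hSm k) (hSC k)).const_mul 2
      have i12 : Integrable (fun w => ‖S k w‖ ^ 2 + 2 * inner ℝ (S k w) (D k w)) P :=
        (hSint k).add i2
      rw [integral_add i12 (hDint k), integral_add (hSint k) i2,
        integral_const_mul, horth k _ (hSm k) (hSC k), ih, Finset.sum_range_succ]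
      ring
  have hε2 : (0 : ℝ) < ε ^ 2 := by positivity
  have hmax := maximal_ineq hsub (fun k w => by positivity) (ε := (ε ^ 2).toNNReal) N
  rw [Real.coe_toNNReal _ hε2.le] at hmax
  set A := {w | ε ^ 2 ≤ (Finset.range (N + 1)).sup' Finset.nonempty_range_add_one
    fun k => ‖S k w‖ ^ 2} with hA
  have hsubset : {w | ∃ k ≤ N, ε ≤ ‖∑ j ∈ Finset.range k, D j w‖} ⊆ A := by
    rintro w ⟨k, hk, hw⟩
    have h1 : ε ^ 2 ≤ ‖S k w‖ ^ 2 := by gcongr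
    exact h1.trans (Finset.le_sup' (fun k => ‖S k w‖ ^ 2) (Finset.mem_range.2 (by omega)))
  refine (measure_mono hsubset).trans ?_
  rw [ENNReal.ofReal_div_of_pos hε2, ENNReal.le_div_iff_mul_le
    (Or.inl (by simpa using hε.ne')) (Or.inl ENNReal.ofReal_ne_top), mul_comm]
  refine hmax.trans (ENNReal.ofReal_le_ofReal ?_)
  rw [← hvar N]
  exact setIntegral_le_integral (hSint N) (Eventually.of_forall fun w => by positivity)

end Martingale

/-! ### Measurability of the state process -/

/-- Second countability turns Borel measurability with respect to the past, which holds by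
construction, into strong measurability. -/
theorem secondCountableTopology_state : SecondCountableTopology State := by
  have : Fact ((2 : ℝ≥0∞) ≠ ∞) := ⟨by norm_num⟩
  have h1 : SecondCountableTopology L2 := inferInstance
  have h2 : SecondCountableTopology E := (WithLp.homeomorphProd 1 ℝ L2).secondCountableTopology
  exact (WithLp.homeomorphProd 1 E E).secondCountableTopology

theorem stronglyMeasurable_cell {Ω : Type*} [MeasurableSpace Ω] (dx : ℝ) {y : Ω → ℝ}
    (hy : Measurable y) : StronglyMeasurable fun w => cell dx (y w) := by
  have h1 : StronglyMeasurable fun j : ℤ => (indicatorConstLp 2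
    (measurableSet_Ico (a := (j : ℝ) * dx) (b := (j + 1 : ℝ) * dx))
    (measure_Ico_lt_top (μ := volume)).ne (1 : ℝ) : L2) := .of_discrete
  exact h1.comp_measurable (Int.measurable_floor.comp (hy.div_const dx))

namespace Models

variable {Ω : Type*} [mΩ : MeasurableSpace Ω] (m : Models Ω)

theorem measurable_ind (n k : ℕ) (I : Event) : Measurable fun w => ind I (m.event n k w) :=
  (measurable_from_top (f := ind I)).comp (m.measurable_event n k)

theorem stronglyMeasurable_mark (n k : ℕ) (I : Event) (c : ℝ) : StronglyMeasurable fun w =>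
    (ind I (m.event n k w) * c * m.size n k w) • cell (m.dx n) (m.level n k w) :=
  (((m.measurable_ind n k I).mul_const c).mul (m.measurable_size n k)).stronglyMeasurable.smul
    (stronglyMeasurable_cell _ (m.measurable_level n k))

theorem stronglyMeasurable_S (n k : ℕ) : StronglyMeasurable (m.S n k) := by
  induction k with
  | zero => exact stronglyMeasurable_const
  | succ k ih =>
    have hi := fun I => (m.measurable_ind n k I).stronglyMeasurable
    have ha := State.continuous_ask.comp_stronglyMeasurable ih
    have hb := State.continuous_bid.comp_stronglyMeasurable ih
    have hva := State.continuous_va.comp_stronglyMeasurable ih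
    have hvb := State.continuous_vb.comp_stronglyMeasurable ih
    have hsh : ∀ (h : ℝ) {v : Ω → L2}, StronglyMeasurable v →
        StronglyMeasurable fun w => shift h (v w) := fun h v hv =>
      (continuous_shift (a := fun _ : L2 => h) continuous_const
        continuous_id).comp_stronglyMeasurable hv
    refine State.continuous_mk.comp_stronglyMeasurable (StronglyMeasurable.prodMk
      (StronglyMeasurable.prodMk ?_ ?_) (StronglyMeasurable.prodMk ?_ ?_))
    · exact ha.add (((hi .D).sub (hi .E)).mul stronglyMeasurable_const)
    · exact ((hva.add ((hi .D).smul ((hsh _ hva).sub hva))).add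
        ((hi .E).smul ((hsh _ hva).sub hva))).add (m.stronglyMeasurable_mark n k .F _)
    · exact hb.add (((hi .B).sub (hi .A)).mul stronglyMeasurable_const)
    · exact ((hvb.add ((hi .B).smul ((hsh _ hvb).sub hvb))).add
        ((hi .A).smul ((hsh _ hvb).sub hvb))).add (m.stronglyMeasurable_mark n k .C _)

/-- The filtration generated by the states of the `n`-th model. -/
noncomputable def pastFiltration (n : ℕ) : Filtration ℕ mΩ where
  seq := m.past n
  mono' := fun i j hij => iSup_le fun l =>
    le_iSup (fun l : Fin (j + 1) => MeasurableSpace.comap (m.S n l) (borel State))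
      ⟨l, by omega⟩
  le' := fun k => iSup_le fun l => by
    let : MeasurableSpace State := borel State
    have : BorelSpace State := ⟨rfl⟩
    exact (m.stronglyMeasurable_S n l).measurable.comap_le

theorem past_le (n k : ℕ) : m.past n k ≤ mΩ := (m.pastFiltration n).le k

theorem stronglyMeasurable_past (n k : ℕ) : StronglyMeasurable[m.past n k] (m.S n k) := by
  let : MeasurableSpace State := borel State
  have : BorelSpace State := ⟨rfl⟩
  have := secondCountableTopology_state
  have h1 : MeasurableSpace.comap (m.S n k) (borel State) ≤ m.past n k :=
    le_iSup (fun l : Fin (k + 1) => MeasurableSpace.comap (m.S n l) (borel State))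
      ⟨k, by omega⟩
  exact Measurable.stronglyMeasurable (Measurable.of_comap_le h1)

end Models

theorem ind_nonneg (I e : Event) : 0 ≤ ind I e := by
  unfold ind
  split_ifs <;> norm_num

theorem ind_le_one (I e : Event) : ind I e ≤ 1 := by
  unfold ind
  split_ifs <;> norm_num

/-! ### One side of the order book -/

/-- One side of the order book in the `n`-th model: the best price `x` increases at events of type
`U` and decreases at events of type `V`; orders are placed or canceled at events of type `W`. The
conditional probabilities of `U` and `V` are `Δp pU`, `Δp pV`, and `φ` is the conditional
expectation of the normalized placements. -/
structure Models.IsSide {Ω : Type*} [MeasurableSpace Ω] (m : Models Ω) (P : Measure Ω)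
    (n N : ℕ) (M Cφ : ℝ) (U V W : Event) (x0 : ℝ) (v0 : L2) (x : ℕ → Ω → ℝ) (v : ℕ → Ω → L2)
    (pU pV : ℕ → Ω → ℝ) (φ : ℕ → Ω → L2) : Prop where
  hUV : U ≠ V
  hUW : U ≠ W
  hVW : V ≠ W
  x_zero : ∀ w, x 0 w = x0
  v_zero : ∀ w, v 0 w = v0
  x_succ : ∀ k w, x (k + 1) w =
    x k w + (ind U (m.event n k w) - ind V (m.event n k w)) * m.dx n
  v_succ : ∀ k w, v (k + 1) w =
    v k w + ind U (m.event n k w) • (shift (m.dx n) (v k w) - v k w)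
      + ind V (m.event n k w) • (shift (-m.dx n) (v k w) - v k w)
      + (ind W (m.event n k w) * (m.dv n / m.dx n) * m.size n k w) •
        cell (m.dx n) (m.level n k w)
  meas_x : ∀ k, StronglyMeasurable[m.past n k] (x k)
  meas_v : ∀ k, StronglyMeasurable[m.past n k] (v k)
  meas_U : ∀ k, StronglyMeasurable[m.past n k] (pU k)
  meas_V : ∀ k, StronglyMeasurable[m.past n k] (pV k)
  meas_φ : ∀ k, StronglyMeasurable[m.past n k] (φ k)
  mem_U : ∀ k w, pU k w ∈ Icc (0 : ℝ) 1
  mem_V : ∀ k w, pV k w ∈ Icc (0 : ℝ) 1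
  bound_φ : ∀ k ≤ N, ∀ᵐ w ∂P, ‖φ k w‖ ≤ Cφ
  cond_U : ∀ k ≤ N, P[fun w => ind U (m.event n k w) | m.past n k] =ᵐ[P]
    fun w => m.dp n * pU k w
  cond_V : ∀ k ≤ N, P[fun w => ind V (m.event n k w) | m.past n k] =ᵐ[P]
    fun w => m.dp n * pV k w
  cond_W : ∀ k ≤ N, φ k =ᵐ[P] fun w => (1 / m.dx n) • (P[fun w' =>
    (m.size n k w' * ind W (m.event n k w')) • cell (m.dx n) (m.level n k w') | m.past n k]) w
  marks : ∀ k, ∀ᵐ w ∂P, m.size n k w ∈ Icc (-M) M ∧ m.level n k w ∈ Icc (-M) M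

namespace Models.IsSide

variable {Ω : Type*} [mΩ : MeasurableSpace Ω] {m : Models Ω} {P : Measure Ω}
  [IsProbabilityMeasure P] {n N : ℕ} {M Cφ : ℝ} {U V W : Event} {x0 : ℝ} {v0 : L2}
  {x : ℕ → Ω → ℝ} {v : ℕ → Ω → L2} {pU pV : ℕ → Ω → ℝ} {φ : ℕ → Ω → L2}

theorem integrable_ind (I : Event) (k : ℕ) :
    Integrable (fun w => ind I (m.event n k w)) P :=
  Integrable.of_bound (m.measurable_ind n k I).aestronglyMeasurable 1
    (Eventually.of_forall fun w => by
      rw [Real.norm_of_nonneg (ind_nonneg _ _)]; exact ind_le_one _ _)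

/-- Price changes are rare, with probability of order `dp`; this makes the variance of a price
increment of order `dx² |dp|` and not merely `dx²`. -/
theorem integral_ind_le (I : Event) {k : ℕ} {p : Ω → ℝ} (hp : ∀ w, p w ∈ Icc (0 : ℝ) 1)
    (h : P[fun w => ind I (m.event n k w) | m.past n k] =ᵐ[P] fun w => m.dp n * p w) :
    ∫ w, ind I (m.event n k w) ∂P ≤ |m.dp n| := by
  rw [← integral_condExp (m.past_le n k), integral_congr_ae h]
  have := norm_integral_le_of_norm_le_const (μ := P) (f := fun w => m.dp n * p w) (C := |m.dp n|)
    (Eventually.of_forall fun w => by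
      rw [norm_mul, Real.norm_eq_abs, Real.norm_of_nonneg (hp w).1]
      exact mul_le_of_le_one_right (abs_nonneg _) (hp w).2)
  simp only [probReal_univ, mul_one] at this
  exact (le_abs_self _).trans this

/-- The fluctuations of the price. -/
theorem measure_price_noise_le (h : m.IsSide P n N M Cφ U V W x0 v0 x v pU pV φ) {ε : ℝ}
    (hε : 0 < ε) :
    P {w | ∃ k ≤ N, ε ≤ |x k w - x0 -
        ∑ j ∈ Finset.range k, m.dx n * m.dp n * (pU j w - pV j w)|} ≤
      ENNReal.ofReal (N * (m.dx n ^ 2 * (4 * |m.dp n| + 2 * m.dp n ^ 2)) / ε ^ 2) := by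
  set Z : ℕ → Ω → ℝ := fun k w => x (k + 1) w - x k w - m.dx n * m.dp n * (pU k w - pV k w)
  have hZ : ∀ k w, Z k w = m.dx n * ((ind U (m.event n k w) - ind V (m.event n k w))
      - m.dp n * (pU k w - pV k w)) := fun k w => by
    simp only [Z, h.x_succ]
    ring
  -- The conditional probabilities are known only up to index `N`, so later increments are replaced
  -- by zero; partial sums up to `N` do not change.
  set D : ℕ → Ω → ℝ := fun k => if k < N then Z k else 0 with hD
  have hpdiff : ∀ k w, |pU k w - pV k w| ≤ 1 := fun k w => by
    rw [abs_le]
    constructor <;> linarith [(h.mem_U k w).1, (h.mem_U k w).2, (h.mem_V k w).1, (h.mem_V k w).2]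
  have hidiff : ∀ k w, |ind U (m.event n k w) - ind V (m.event n k w)| ≤ 1 := fun k w => by
    have := ind_nonneg U (m.event n k w)
    have := ind_nonneg V (m.event n k w)
    have := ind_le_one U (m.event n k w)
    have := ind_le_one V (m.event n k w)
    rw [abs_le]
    constructor <;> linarith
  have hZb : ∀ k w, ‖Z k w‖ ≤ |m.dx n| * (1 + |m.dp n|) := fun k w => by
    rw [hZ, Real.norm_eq_abs, abs_mul]
    gcongr
    refine (abs_sub _ _).trans (add_le_add (hidiff k w) ?_)
    rw [abs_mul]
    exact mul_le_of_le_one_right (abs_nonneg _) (hpdiff k w)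
  have hZm : ∀ k, StronglyMeasurable[m.past n (k + 1)] (Z k) := fun k => by
    have hle : m.past n k ≤ m.past n (k + 1) := (m.pastFiltration n).mono k.le_succ
    exact ((h.meas_x (k + 1)).sub ((h.meas_x k).mono hle)).sub
      (stronglyMeasurable_const.mul (((h.meas_U k).mono hle).sub ((h.meas_V k).mono hle)))
  have hZi : ∀ k, Integrable (Z k) P := fun k =>
    Integrable.of_bound ((hZm k).mono (m.past_le n (k + 1))).aestronglyMeasurable _
      (Eventually.of_forall (hZb k))
  have hcond : ∀ k ≤ N, P[Z k | m.past n k] =ᵐ[P] 0 := by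
    intro k hk
    set r : Ω → ℝ := fun w => m.dp n * (pU k w - pV k w)
    have hr : StronglyMeasurable[m.past n k] r :=
      stronglyMeasurable_const.mul ((h.meas_U k).sub (h.meas_V k))
    have hri : Integrable r P := by
      refine Integrable.of_bound (hr.mono (m.past_le n k)).aestronglyMeasurable |m.dp n|
        (Eventually.of_forall fun w => ?_)
      rw [norm_mul, Real.norm_eq_abs, Real.norm_eq_abs]
      exact mul_le_of_le_one_right (abs_nonneg _) (hpdiff k w)
    have e : Z k = m.dx n • (((fun w => ind U (m.event n k w)) -
        fun w => ind V (m.event n k w)) - r) := by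
      ext w
      rw [hZ]
      rfl
    rw [e]
    have h1 := condExp_smul (μ := P) (m.dx n) (((fun w => ind U (m.event n k w)) -
        fun w => ind V (m.event n k w)) - r) (m.past n k)
    have h2 := condExp_sub (μ := P) ((integrable_ind (m := m) (n := n) U k).sub
      (integrable_ind (m := m) (n := n) V k)) hri (m.past n k)
    have h3 := condExp_sub (μ := P) (integrable_ind (m := m) (n := n) U k)
      (integrable_ind (m := m) (n := n) V k) (m.past n k)
    have h4 := condExp_of_stronglyMeasurable (μ := P) (m.past_le n k) hr hri
    filter_upwards [h1, h2, h3, h.cond_U k hk, h.cond_V k hk] with w h1 h2 h3 h5 h6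
    rw [h1, Pi.smul_apply, h2, Pi.sub_apply, h3, Pi.sub_apply, h5, h6, h4]
    simp only [r, Pi.zero_apply, smul_eq_mul]
    ring
  have hvar : ∀ k < N, ∫ w, ‖D k w‖ ^ 2 ∂P ≤ m.dx n ^ 2 * (4 * |m.dp n| + 2 * m.dp n ^ 2) := by
    intro k hk
    -- From `(a - b - r)² ≤ 2(a - b)² + 2r²`, and `(a - b)² ≤ a + b` for indicators, which keeps the
    -- smallness of the event probabilities.
    have hle : ∀ w, ‖D k w‖ ^ 2 ≤ m.dx n ^ 2 * (2 * ind U (m.event n k w) +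
        2 * ind V (m.event n k w) + 2 * m.dp n ^ 2) := by
      intro w
      simp only [hD, if_pos hk, hZ, Real.norm_eq_abs, sq_abs]
      rw [mul_pow]
      gcongr
      have hu0 := ind_nonneg U (m.event n k w)
      have hv0 := ind_nonneg V (m.event n k w)
      have hu1 := ind_le_one U (m.event n k w)
      have hv1 := ind_le_one V (m.event n k w)
      have h1 : (pU k w - pV k w) ^ 2 ≤ 1 := by
        rw [sq_le_one_iff_abs_le_one]
        exact hpdiff k w
      have h2 : (m.dp n * (pU k w - pV k w)) ^ 2 ≤ m.dp n ^ 2 := by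
        rw [mul_pow]
        exact mul_le_of_le_one_right (sq_nonneg _) h1
      generalize ind U (m.event n k w) = a at *
      generalize ind V (m.event n k w) = b at *
      generalize m.dp n * (pU k w - pV k w) = r at *
      have h3 : (a - b) ^ 2 ≤ a + b := by nlinarith
      nlinarith [sq_nonneg (a - b + r)]
    have hi : Integrable (fun w => m.dx n ^ 2 * (2 * ind U (m.event n k w) +
        2 * ind V (m.event n k w) + 2 * m.dp n ^ 2)) P :=
      ((((integrable_ind (n := n) U k).const_mul 2).add
        ((integrable_ind (n := n) V k).const_mul 2)).add (integrable_const _)).const_mul _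
    refine (integral_mono_of_nonneg (Eventually.of_forall fun w => by positivity) hi
      (Eventually.of_forall hle)).trans ?_
    rw [integral_const_mul]
    gcongr
    have i1 : Integrable (fun w => 2 * ind U (m.event n k w) + 2 * ind V (m.event n k w)) P :=
      ((integrable_ind (n := n) U k).const_mul 2).add
        ((integrable_ind (n := n) V k).const_mul 2)
    rw [integral_add i1 (integrable_const _), integral_add
      ((integrable_ind (n := n) U k).const_mul 2) ((integrable_ind (n := n) V k).const_mul 2),
      integral_const_mul, integral_const_mul, integral_const, probReal_univ, one_smul]
    have h1 := integral_ind_le U (h.mem_U k) (h.cond_U k hk.le)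
    have h2 := integral_ind_le V (h.mem_V k) (h.cond_V k hk.le)
    linarith
  have hmain := measure_exists_norm_sum_ge_le (P := P) (m.pastFiltration n) (D := D)
    (C := fun _ => |m.dx n| * (1 + |m.dp n|)) (fun k => ?_) (fun k => ?_) (fun k Y hY hYC => ?_)
    N hε
  · refine le_trans (measure_mono ?_) (hmain.trans (ENNReal.ofReal_le_ofReal ?_))
    · rintro w ⟨k, hk, hw⟩
      refine ⟨k, hk, hw.trans (le_of_eq ?_)⟩
      rw [← Real.norm_eq_abs]
      congr 1
      have : ∑ j ∈ Finset.range k, D j w = ∑ j ∈ Finset.range k, Z j w :=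
        Finset.sum_congr rfl fun j hj => by
          simp only [hD, if_pos (lt_of_lt_of_le (Finset.mem_range.1 hj) hk)]
      rw [this]
      simp only [Z]
      rw [Finset.sum_sub_distrib, Finset.sum_range_sub (fun j => x j w), h.x_zero]
    · gcongr
      refine (Finset.sum_le_sum fun j hj => hvar j (Finset.mem_range.1 hj)).trans ?_
      rw [Finset.sum_const, Finset.card_range, nsmul_eq_mul]
  · simp only [hD]
    split_ifs
    · exact hZm k
    · exact stronglyMeasurable_zero
  · refine Eventually.of_forall fun w => ?_
    simp only [hD]
    split_ifs
    · exact hZb k w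
    · simp only [Pi.zero_apply, norm_zero]
      positivity
  · simp only [hD]
    split_ifs with hk
    · obtain ⟨C, hC⟩ := hYC
      exact integral_inner_eq_zero (m.past_le n k) hY hC (hZi k) (hcond k hk.le)
    · simp

/-- The fluctuations of the volume density in the frame that moves with the price. -/
theorem measure_volume_noise_le (h : m.IsSide P n N M Cφ U V W x0 v0 x v pU pV φ) {ε : ℝ}
    (hM : 0 ≤ M) (hCφ : 0 ≤ Cφ) (hε : 0 < ε) :
    P {w | ∃ k ≤ N, ε ≤ ‖shift (x0 - x k w) (v k w) - v0 -
        ∑ j ∈ Finset.range k, m.dv n • shift (x0 - x j w) (φ j w)‖} ≤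
      ENNReal.ofReal
        (N * (|m.dv n| * (M / Real.sqrt (m.dx n) + Cφ)) ^ 2 / ε ^ 2) := by
  have hdx := m.dx_pos n
  set Q : ℕ → Ω → L2 := fun k w =>
    (ind W (m.event n k w) * (m.dv n / m.dx n) * m.size n k w) • cell (m.dx n) (m.level n k w)
  set Z : ℕ → Ω → L2 := fun k w => Q k w - m.dv n • φ k w with hZ
  set A : ℕ → Ω → L2 := fun k w => shift (x0 - x (k + 1) w) (v (k + 1) w) -
    shift (x0 - x k w) (v k w) - m.dv n • shift (x0 - x k w) (φ k w) with hA
  have hAZ : ∀ k w, A k w = shift (x0 - x k w) (Z k w) := by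
    intro k w
    -- At most one of the three events `U`, `V`, `W` occurs. For `U` and `V` the translation of the
    -- density cancels against the change of the price, so only a placement is seen in the moving
    -- frame.
    have key : shift (x0 - x (k + 1) w) (v (k + 1) w) =
        shift (x0 - x k w) (v k w) + shift (x0 - x k w) (Q k w) := by
      rw [h.v_succ, h.x_succ]
      by_cases hU : m.event n k w = U
      · have e1 : ind U (m.event n k w) = 1 := if_pos hU
        have e2 : ind V (m.event n k w) = 0 := if_neg (by rw [hU]; exact h.hUV)
        have e3 : ind W (m.event n k w) = 0 := if_neg (by rw [hU]; exact h.hUW)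
        simp only [Q, e1, e2, e3, zero_mul, zero_smul, one_smul, add_zero, sub_zero, one_mul,
          add_sub_cancel]
        rw [shift_shift, show shift (x0 - x k w) (0 : L2) = 0 from map_zero (shiftL _), add_zero]
        congr 1
        ring
      · by_cases hV : m.event n k w = V
        · have e1 : ind U (m.event n k w) = 0 := if_neg hU
          have e2 : ind V (m.event n k w) = 1 := if_pos hV
          have e3 : ind W (m.event n k w) = 0 := if_neg (by rw [hV]; exact h.hVW)
          simp only [Q, e1, e2, e3, zero_mul, zero_smul, one_smul, add_zero,
            add_sub_cancel]
          rw [shift_shift, show shift (x0 - x k w) (0 : L2) = 0 from map_zero (shiftL _),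
            add_zero]
          congr 1
          ring
        · have e1 : ind U (m.event n k w) = 0 := if_neg hU
          have e2 : ind V (m.event n k w) = 0 := if_neg hV
          simp only [Q, e1, e2, zero_mul, zero_smul, add_zero, sub_zero, shift_add]
    simp only [hA, hZ, key, shift_sub, shift_smul]
    abel
  set D : ℕ → Ω → L2 := fun k => if k < N then A k else 0 with hD
  set B := |m.dv n| * (M / Real.sqrt (m.dx n) + Cφ) with hB
  have hB0 : 0 ≤ B := by positivity
  have hcellb : ∀ k, ∀ᵐ w ∂P, ‖(m.size n k w * ind W (m.event n k w)) •
      cell (m.dx n) (m.level n k w)‖ ≤ M * Real.sqrt (m.dx n) := fun k => by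
    filter_upwards [h.marks k] with w hw
    rw [norm_smul, norm_cell hdx, norm_mul, Real.norm_of_nonneg (ind_nonneg _ _),
      Real.norm_eq_abs]
    gcongr
    calc _ ≤ M * 1 := mul_le_mul (abs_le.2 hw.1) (ind_le_one _ _) (ind_nonneg _ _) hM
      _ = M := mul_one M
  have hQe : ∀ k w, Q k w = (m.dv n / m.dx n) • ((m.size n k w * ind W (m.event n k w)) •
      cell (m.dx n) (m.level n k w)) := fun k w => by
    simp only [Q, smul_smul]
    congr 1
    ring
  have hZb : ∀ k ≤ N, ∀ᵐ w ∂P, ‖Z k w‖ ≤ B := fun k hk => by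
    filter_upwards [hcellb k, h.bound_φ k hk] with w h1 h2
    refine (norm_sub_le _ _).trans ?_
    rw [hQe, norm_smul (m.dv n / m.dx n), norm_smul (m.dv n), hB, mul_add, norm_div,
      Real.norm_of_nonneg hdx.le, Real.norm_eq_abs (m.dv n)]
    refine add_le_add ?_ (by gcongr)
    calc |m.dv n| / m.dx n * _ ≤ |m.dv n| / m.dx n * (M * Real.sqrt (m.dx n)) :=
          mul_le_mul_of_nonneg_left h1 (by positivity)
      _ = |m.dv n| * (M * (Real.sqrt (m.dx n) / m.dx n)) := by ring
      _ = |m.dv n| * (M / Real.sqrt (m.dx n)) := by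
        rw [Real.sqrt_div_self', mul_one_div]
  have hAb : ∀ k ≤ N, ∀ᵐ w ∂P, ‖A k w‖ ≤ B := fun k hk => by
    filter_upwards [hZb k hk] with w hw
    rwa [hAZ, norm_shift]
  have hsm : ∀ {m' : MeasurableSpace Ω} {a : Ω → ℝ} {f : Ω → L2}, StronglyMeasurable[m'] a →
      StronglyMeasurable[m'] f → StronglyMeasurable[m'] fun w => shift (a w) (f w) :=
    fun ha hf => (continuous_shift (X := ℝ × L2) continuous_fst
      continuous_snd).comp_stronglyMeasurable (ha.prodMk hf)
  have hAm : ∀ k, StronglyMeasurable[m.past n (k + 1)] (A k) := fun k => by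
    have hle : m.past n k ≤ m.past n (k + 1) := (m.pastFiltration n).mono k.le_succ
    have hx := (h.meas_x k).mono hle
    exact ((hsm (stronglyMeasurable_const.sub (h.meas_x (k + 1))) (h.meas_v (k + 1))).sub
      (hsm (stronglyMeasurable_const.sub hx) ((h.meas_v k).mono hle))).sub
      ((hsm (stronglyMeasurable_const.sub hx) ((h.meas_φ k).mono hle)).fun_const_smul _)
  have hZm : ∀ k, StronglyMeasurable (Z k) := fun k =>
    (m.stronglyMeasurable_mark n k W _).sub (((h.meas_φ k).mono (m.past_le n k)).fun_const_smul _)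
  have hcond : ∀ k ≤ N, P[Z k | m.past n k] =ᵐ[P] 0 := by
    intro k hk
    set q : Ω → L2 := fun w => (m.size n k w * ind W (m.event n k w)) •
      cell (m.dx n) (m.level n k w) with hq
    have hqm : StronglyMeasurable q :=
      ((m.measurable_size n k).mul (m.measurable_ind n k W)).stronglyMeasurable.smul
        (stronglyMeasurable_cell _ (m.measurable_level n k))
    have hqi : Integrable q P := Integrable.of_bound hqm.aestronglyMeasurable _ (hcellb k)
    have hφi : Integrable (φ k) P := Integrable.of_bound
      ((h.meas_φ k).mono (m.past_le n k)).aestronglyMeasurable _ (h.bound_φ k hk)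
    have e : Z k = (m.dv n / m.dx n) • q - m.dv n • φ k := by
      ext1 w
      simp only [hZ, hQe, hq]
      rfl
    rw [e]
    have h1 := condExp_sub (μ := P) (hqi.smul (m.dv n / m.dx n)) (hφi.smul (m.dv n)) (m.past n k)
    have h2 := condExp_smul (μ := P) (m.dv n / m.dx n) q (m.past n k)
    have h3 := condExp_of_stronglyMeasurable (μ := P) (m.past_le n k)
      ((h.meas_φ k).const_smul (m.dv n)) (hφi.smul (m.dv n))
    filter_upwards [h1, h2, h.cond_W k hk] with w h1 h2 h4
    rw [h1, Pi.sub_apply, h2, Pi.smul_apply, h3, Pi.smul_apply, h4, smul_smul, ← hq]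
    simp only [Pi.zero_apply]
    rw [mul_one_div, sub_self]
  have hmain := measure_exists_norm_sum_ge_le (P := P) (m.pastFiltration n) (D := D)
    (C := fun _ => B) (fun k => ?_) (fun k => ?_) (fun k Y hY hYC => ?_)
    N hε
  · refine le_trans (measure_mono ?_) (hmain.trans (ENNReal.ofReal_le_ofReal ?_))
    · rintro w ⟨k, hk, hw⟩
      refine ⟨k, hk, hw.trans (le_of_eq ?_)⟩
      congr 1
      have : ∑ j ∈ Finset.range k, D j w = ∑ j ∈ Finset.range k, A j w :=
        Finset.sum_congr rfl fun j hj => by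
          simp only [hD, if_pos (lt_of_lt_of_le (Finset.mem_range.1 hj) hk)]
      rw [this]
      simp only [hA]
      rw [Finset.sum_sub_distrib, Finset.sum_range_sub (fun j => shift (x0 - x j w) (v j w)),
        h.x_zero, h.v_zero, sub_self, shift_zero]
    · gcongr
      have hvar : ∀ j ∈ Finset.range N, ∫ w, ‖D j w‖ ^ 2 ∂P ≤ B ^ 2 := by
        intro j hj
        have hj' := Finset.mem_range.1 hj
        have := integral_mono_of_nonneg (μ := P) (f := fun w => ‖D j w‖ ^ 2)
          (g := fun _ => B ^ 2) (Eventually.of_forall fun w => by positivity)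
          (integrable_const _) (by
            filter_upwards [hAb j hj'.le] with w hw
            simp only [hD, if_pos hj']
            gcongr)
        simpa using this
      refine (Finset.sum_le_sum hvar).trans ?_
      rw [Finset.sum_const, Finset.card_range, nsmul_eq_mul]
  · simp only [hD]
    split_ifs
    · exact hAm k
    · exact stronglyMeasurable_zero
  · simp only [hD]
    split_ifs with hk
    · exact hAb k hk.le
    · exact Eventually.of_forall fun w => by simpa using hB0
  · simp only [hD]
    split_ifs with hk
    · obtain ⟨C, hC⟩ := hYC
      -- The increment is a past-measurable random translate of the centred placement `Z k`; the
      -- inverse translation is applied to the test function instead.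
      have hY' : StronglyMeasurable[m.past n k] fun w => shift (x k w - x0) (Y w) :=
        hsm ((h.meas_x k).sub stronglyMeasurable_const) hY
      have h0 := integral_inner_eq_zero (P := P) (m.past_le n k) hY' (C := C) (Z := Z k)
        (by simpa only [norm_shift] using hC)
        (Integrable.of_bound (hZm k).aestronglyMeasurable B (hZb k hk.le)) (hcond k hk.le)
      rw [← h0]
      refine integral_congr_ae (Eventually.of_forall fun w => ?_)
      simp only [hAZ]
      rw [← (shiftL (x0 - x k w)).inner_map_map (shift (x k w - x0) (Y w)) (Z k w), shiftL_apply,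
        shiftL_apply, shift_shift, show x0 - x k w + (x k w - x0) = 0 by ring, shift_zero]
    · simp

end Models.IsSide

/-! ### The discrete models are approximate mild solutions -/

/-- The three error terms come from replacing the weight `b` by `dt`, the summands `a` by `a'`, and
the time `t` by the last grid point before it. -/
theorem norm_sub_integral_step_le {H : Type*} [NormedAddCommGroup H] [NormedSpace ℝ H]
    [CompleteSpace H] {T dt b η C r : ℝ} (hdt : 0 < dt) (hC : 0 ≤ C) (hr : 0 ≤ r)
    {a a' : ℕ → H} (ha : ∀ j ≤ ⌊T / dt⌋₊, ‖a j‖ ≤ C)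
    (haa : ∀ j ≤ ⌊T / dt⌋₊, ‖a j - a' j‖ ≤ r) {t : ℝ} (ht : t ∈ Icc 0 T) {X : H}
    (hX : ‖X - ∑ j ∈ Finset.range ⌊t / dt⌋₊, b • a j‖ ≤ η) :
    ‖X - ∫ s in (0 : ℝ)..t, a' ⌊s / dt⌋₊‖ ≤ η + (T * |b / dt - 1| * C + T * r + dt * (C + r)) := by
  have hkN : ⌊t / dt⌋₊ ≤ ⌊T / dt⌋₊ := Nat.floor_le_floor (by have := ht.2; gcongr)
  have hk1 : (⌊t / dt⌋₊ : ℝ) * dt ≤ t := by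
    rw [← le_div_iff₀ hdt]
    exact Nat.floor_le (div_nonneg ht.1 hdt.le)
  have hk2 : t < (⌊t / dt⌋₊ + 1 : ℝ) * dt := by
    rw [← div_lt_iff₀ hdt]
    exact Nat.lt_floor_add_one _
  rw [integral_step hdt a' ht.1]
  set k := ⌊t / dt⌋₊
  have e : X - (∑ j ∈ Finset.range k, dt • a' j + (t - k * dt) • a' k) =
      (X - ∑ j ∈ Finset.range k, b • a j) +
        (∑ j ∈ Finset.range k, ((b - dt) • a j + dt • (a j - a' j)) - (t - k * dt) • a' k) := by
    have : ∑ j ∈ Finset.range k, ((b - dt) • a j + dt • (a j - a' j)) =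
        ∑ j ∈ Finset.range k, b • a j - ∑ j ∈ Finset.range k, dt • a' j := by
      rw [← Finset.sum_sub_distrib]
      refine Finset.sum_congr rfl fun j _ => ?_
      rw [sub_smul, smul_sub]
      abel
    rw [this]
    abel
  rw [e]
  refine (norm_add_le _ _).trans (add_le_add hX ((norm_sub_le _ _).trans (add_le_add ?_ ?_)))
  · have h1 : ∀ j ∈ Finset.range k, ‖(b - dt) • a j + dt • (a j - a' j)‖ ≤
        dt * (|b / dt - 1| * C + r) := by
      intro j hj
      have hjN : j ≤ ⌊T / dt⌋₊ := (Finset.mem_range.1 hj).le.trans hkN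
      refine (norm_add_le _ _).trans ?_
      rw [norm_smul, norm_smul, Real.norm_of_nonneg hdt.le, Real.norm_eq_abs]
      have h2 : |b - dt| = dt * |b / dt - 1| := by
        rw [← abs_of_pos hdt, ← abs_mul, abs_of_pos hdt]
        congr 1
        field_simp
      rw [h2, mul_add, ← mul_assoc]
      have := ha j hjN
      have := haa j hjN
      gcongr
    refine (norm_sum_le_of_le _ h1).trans ?_
    rw [Finset.sum_const, Finset.card_range, nsmul_eq_mul, ← mul_assoc]
    calc _ ≤ T * (|b / dt - 1| * C + r) := by
          gcongr
          exact hk1.trans ht.2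
      _ = _ := by ring
  · rw [norm_smul, Real.norm_of_nonneg (by linarith)]
    have h3 : ‖a' k‖ ≤ C + r := by
      have h4 := norm_sub_norm_le (a' k) (a k)
      rw [norm_sub_rev] at h4
      linarith [ha k hkN, haa k hkN]
    gcongr
    linarith

/-- The Riemann sum estimate is used for the price and, in the moving frame, for the density;
translating back is an isometry. Here `φ` stands for the placement density of the discrete model and
`ψ` for that of the limit. -/
theorem mild_of_discrete {T dt dx dp dv η C r : ℝ} (hdt : 0 < dt) (hC : 0 ≤ C) (hr : 0 ≤ r)
    (hT : 0 ≤ T) {x0 : ℝ} {v0 : L2} {x c : ℕ → ℝ} {v φ ψ : ℕ → L2}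
    (hx : ∀ k ≤ ⌊T / dt⌋₊, |x k - x0 - ∑ j ∈ Finset.range k, dx * dp * c j| ≤ η)
    (hv : ∀ k ≤ ⌊T / dt⌋₊, ‖shift (x0 - x k) (v k) - v0 -
      ∑ j ∈ Finset.range k, dv • shift (x0 - x j) (φ j)‖ ≤ η)
    (hc : ∀ j, |c j| ≤ 1) (hφ : ∀ j ≤ ⌊T / dt⌋₊, ‖φ j‖ ≤ C)
    (hφψ : ∀ j ≤ ⌊T / dt⌋₊, ‖φ j - ψ j‖ ≤ r) :
    Mild T (η + ((T * |dx * dp / dt - 1| + dt) +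
        (T * |dv / dt - 1| * C + T * r + dt * (C + r)))) x0 v0
      (fun t => c ⌊t / dt⌋₊) (fun t => ψ ⌊t / dt⌋₊) (fun t => x ⌊t / dt⌋₊)
      (fun t => v ⌊t / dt⌋₊) := by
  intro t ht
  have hkN : ⌊t / dt⌋₊ ≤ ⌊T / dt⌋₊ := Nat.floor_le_floor (by have := ht.2; gcongr)
  constructor
  · have h1 := norm_sub_integral_step_le (T := T) (b := dx * dp) (η := η) (C := 1) (r := 0) hdt
      zero_le_one le_rfl (a := c) (a' := c) (fun j _ => hc j) (by simp) ht (X := x ⌊t / dt⌋₊ - x0)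
      (hx _ hkN)
    rw [Real.norm_eq_abs] at h1
    have e : x ⌊t / dt⌋₊ - (x0 + ∫ s in (0 : ℝ)..t, c ⌊s / dt⌋₊) =
      x ⌊t / dt⌋₊ - x0 - ∫ s in (0 : ℝ)..t, c ⌊s / dt⌋₊ := by ring
    rw [e]
    refine h1.trans ?_
    have : 0 ≤ T * |dv / dt - 1| * C + T * r + dt * (C + r) := by positivity
    linarith
  · have h1 := norm_sub_integral_step_le (T := T) (b := dv) (η := η) (C := C) (r := r) hdt
      hC hr (a := fun j => shift (x0 - x j) (φ j)) (a' := fun j => shift (x0 - x j) (ψ j))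
      (fun j hj => by simpa using hφ j hj)
      (fun j hj => by rw [← shift_sub, norm_shift]; exact hφψ j hj) ht
      (X := shift (x0 - x ⌊t / dt⌋₊) (v ⌊t / dt⌋₊) - v0) (hv _ hkN)
    have e : v ⌊t / dt⌋₊ - shift (x ⌊t / dt⌋₊ - x0)
        (v0 + ∫ s in (0 : ℝ)..t, shift (x0 - x ⌊s / dt⌋₊) (ψ ⌊s / dt⌋₊)) =
        shift (x ⌊t / dt⌋₊ - x0) (shift (x0 - x ⌊t / dt⌋₊) (v ⌊t / dt⌋₊) - v0 -
          ∫ s in (0 : ℝ)..t, shift (x0 - x ⌊s / dt⌋₊) (ψ ⌊s / dt⌋₊)) := by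
      rw [sub_sub, shift_sub, shift_shift]
      simp
    rw [e, norm_shift]
    refine h1.trans ?_
    have : 0 ≤ T * |dx * dp / dt - 1| + dt := by positivity
    linarith

namespace Models

/-- The bound on the placements, in `L²(ℝ)`. -/
noncomputable def placementBound (M : ℝ) : ℝ := M * Real.sqrt (2 * (M + 1 + 1))

theorem placementBound_nonneg {M : ℝ} (hM : 0 ≤ M) : 0 ≤ placementBound M := by
  unfold placementBound
  positivity

theorem PlacementAssumption.norm_le {Ω : Type*} [MeasurableSpace Ω] {m : Models Ω}
    {P : Measure Ω} {T M : ℝ} {L : ℝ≥0} {I : Event} {fn : ℕ → State → L2}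
    {f : State → L2}
    (h : m.PlacementAssumption P T M L I fn f) (hM : 0 ≤ M) (n : ℕ) (s : State) :
    ‖cutoff (M + 1) (fn n s)‖ ≤ placementBound M :=
  norm_cutoff_le_of_ae_abs_le (by linarith) hM (h.2.2.1 n s)

variable {Ω : Type*} [mΩ : MeasurableSpace Ω] {m : Models Ω} {P : Measure Ω}
  [IsProbabilityMeasure P] {T M : ℝ} {L : ℝ≥0}

/-- The placements in states that are reached are concentrated on `[-(M + 1), M + 1]`. -/
theorem PlacementAssumption.cutoff_eq {I : Event} {fn : ℕ → State → L2} {f : State → L2}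
    (h : m.PlacementAssumption P T M L I fn f) (hmarks : m.BoundedMarks P M) (hM : 0 ≤ M) {n k : ℕ}
    (hdx : m.dx n ≤ 1) (hk : k ≤ ⌊T / m.dt n⌋₊) :
    ∀ᵐ w ∂P, cutoff (M + 1) (fn n (m.S n k w)) = fn n (m.S n k w) := by
  set q : Ω → L2 := fun w => (m.size n k w * ind I (m.event n k w)) •
      cell (m.dx n) (m.level n k w) with hq
  have hqm : StronglyMeasurable q :=
    ((m.measurable_size n k).mul (m.measurable_ind n k I)).stronglyMeasurable.smul
      (stronglyMeasurable_cell _ (m.measurable_level n k))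
  have hqi : Integrable q P := by
    refine Integrable.of_bound hqm.aestronglyMeasurable (M * Real.sqrt (m.dx n)) ?_
    filter_upwards [hmarks n k] with w hw
    rw [hq, norm_smul, norm_cell (m.dx_pos n), norm_mul, Real.norm_of_nonneg (ind_nonneg _ _),
      Real.norm_eq_abs]
    gcongr
    calc _ ≤ M * 1 := mul_le_mul (abs_le.2 hw.1) (ind_le_one _ _) (ind_nonneg _ _) hM
      _ = M := mul_one M
  -- A bounded linear map commutes with conditional expectations, and `cutoff (M + 1)` fixes every
  -- cell that can occur.
  have h1 := (cutoff (M + 1)).comp_condExp_comm (m := m.past n k) hqi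
  have h2 : P[cutoff (M + 1) ∘ q | m.past n k] =ᵐ[P] P[q | m.past n k] := by
    refine condExp_congr_ae ?_
    filter_upwards [hmarks n k] with w hw
    simp only [hq, Function.comp_apply, map_smul]
    rw [cutoff_cell (m.dx_pos n) hdx hw.2]
  filter_upwards [h.2.1 n k hk, h1, h2] with w h3 h4 h5
  rw [h3, map_smul]
  congr 1
  rw [← hq]
  rw [Function.comp_apply, h5] at h4
  exact h4

theorem isSide_ask {pD pE : State → ℝ} {fFn : ℕ → State → L2} {fF : State → L2}
    (hM : 0 ≤ M) (hmarks : m.BoundedMarks P M)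
    (hD : m.EventAssumption P T L .D pD) (hE : m.EventAssumption P T L .E pE)
    (hF : m.PlacementAssumption P T M L .F fFn fF) {n : ℕ} (hdx : m.dx n ≤ 1) :
    m.IsSide P n ⌊T / m.dt n⌋₊ M (placementBound M) .D .E .F (m.init n).ask (m.init n).va
      (fun k w => (m.S n k w).ask) (fun k w => (m.S n k w).va)
      (fun k w => pD (m.S n k w)) (fun k w => pE (m.S n k w)) (fun k w => fFn n (m.S n k w)) where
  hUV := by decide
  hUW := by decide
  hVW := by decide
  x_zero _ := rfl
  v_zero _ := rfl
  x_succ _ _ := rfl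
  v_succ _ _ := rfl
  meas_x k := State.continuous_ask.comp_stronglyMeasurable (m.stronglyMeasurable_past n k)
  meas_v k := State.continuous_va.comp_stronglyMeasurable (m.stronglyMeasurable_past n k)
  meas_U k := hD.1.continuous.comp_stronglyMeasurable (m.stronglyMeasurable_past n k)
  meas_V k := hE.1.continuous.comp_stronglyMeasurable (m.stronglyMeasurable_past n k)
  meas_φ k := (hF.1 n).continuous.comp_stronglyMeasurable (m.stronglyMeasurable_past n k)
  mem_U _ _ := hD.2.1 _
  mem_V _ _ := hE.2.1 _
  bound_φ k hk := by
    filter_upwards [hF.cutoff_eq hmarks hM hdx hk] with w hw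
    rw [← hw]
    exact hF.norm_le hM n _
  cond_U k hk := hD.2.2 n k hk
  cond_V k hk := hE.2.2 n k hk
  cond_W k hk := hF.2.1 n k hk
  marks k := hmarks n k

theorem isSide_bid {pA pB : State → ℝ} {fCn : ℕ → State → L2} {fC : State → L2}
    (hM : 0 ≤ M) (hmarks : m.BoundedMarks P M)
    (hA : m.EventAssumption P T L .A pA) (hB : m.EventAssumption P T L .B pB)
    (hC : m.PlacementAssumption P T M L .C fCn fC) {n : ℕ} (hdx : m.dx n ≤ 1) :
    m.IsSide P n ⌊T / m.dt n⌋₊ M (placementBound M) .B .A .C (m.init n).bid (m.init n).vb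
      (fun k w => (m.S n k w).bid) (fun k w => (m.S n k w).vb)
      (fun k w => pB (m.S n k w)) (fun k w => pA (m.S n k w)) (fun k w => fCn n (m.S n k w)) where
  hUV := by decide
  hUW := by decide
  hVW := by decide
  x_zero _ := rfl
  v_zero _ := rfl
  x_succ _ _ := rfl
  v_succ _ _ := rfl
  meas_x k := State.continuous_bid.comp_stronglyMeasurable (m.stronglyMeasurable_past n k)
  meas_v k := State.continuous_vb.comp_stronglyMeasurable (m.stronglyMeasurable_past n k)
  meas_U k := hB.1.continuous.comp_stronglyMeasurable (m.stronglyMeasurable_past n k)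
  meas_V k := hA.1.continuous.comp_stronglyMeasurable (m.stronglyMeasurable_past n k)
  meas_φ k := (hC.1 n).continuous.comp_stronglyMeasurable (m.stronglyMeasurable_past n k)
  mem_U _ _ := hB.2.1 _
  mem_V _ _ := hA.2.1 _
  bound_φ k hk := by
    filter_upwards [hC.cutoff_eq hmarks hM hdx hk] with w hw
    rw [← hw]
    exact hC.norm_le hM n _
  cond_U k hk := hB.2.2 n k hk
  cond_V k hk := hA.2.2 n k hk
  cond_W k hk := hC.2.1 n k hk
  marks k := hmarks n k

theorem Scaling.tendsto_dx (h : m.Scaling) : Tendsto m.dx atTop (𝓝 0) := by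
  obtain ⟨hdt, -, -, β, hβ0, hβ1, hβ⟩ := h
  have h1 : Tendsto (fun n => m.dt n ^ β) atTop (𝓝 0) := by
    have := hdt.rpow_const (p := β) (Or.inr hβ0.le)
    rwa [Real.zero_rpow hβ0.ne'] at this
  have h2 := hβ.mul h1
  rw [mul_zero] at h2
  refine h2.congr fun n => ?_
  have := (Real.rpow_pos_of_pos (m.dt_pos n) β).ne'
  field_simp

/-- The ratio behaves like `dt ^ (1 - β)`. This is where `β < 1` enters: the tick size must be large
compared with the time step for placement noise to average out. -/
theorem Scaling.tendsto_dt_div_dx (h : m.Scaling) :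
    Tendsto (fun n => m.dt n / m.dx n) atTop (𝓝 0) := by
  obtain ⟨hdt, -, -, β, hβ0, hβ1, hβ⟩ := h
  have h1 : Tendsto (fun n => m.dt n ^ (1 - β)) atTop (𝓝 0) := by
    have := hdt.rpow_const (p := 1 - β) (Or.inr (by linarith))
    rwa [Real.zero_rpow (by linarith)] at this
  have h2 := (hβ.inv₀ one_ne_zero).mul h1
  rw [mul_zero] at h2
  refine h2.congr fun n => ?_
  have h3 := (Real.rpow_pos_of_pos (m.dt_pos n) β).ne'
  have h4 := (m.dx_pos n).ne'
  rw [Real.rpow_sub (m.dt_pos n), Real.rpow_one]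
  field_simp

theorem floor_mul_le (hT : 0 ≤ T) (n : ℕ) {a : ℝ} (ha : 0 ≤ a) :
    ⌊T / m.dt n⌋₊ * a ≤ T * (a / m.dt n) := by
  have := m.dt_pos n
  calc _ ≤ T / m.dt n * a := by
        gcongr
        exact Nat.floor_le (by positivity)
    _ = _ := by ring

/-- There are about `T / dt` steps and `dx * dp` is comparable to `dt`, so the two terms are of
orders `dx` and `dt`. -/
theorem Scaling.tendsto_price_noise (h : m.Scaling) (hT : 0 ≤ T) (η : ℝ) :
    Tendsto (fun n => ENNReal.ofReal (⌊T / m.dt n⌋₊ *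
      (m.dx n ^ 2 * (4 * |m.dp n| + 2 * m.dp n ^ 2)) / η ^ 2)) atTop (𝓝 0) := by
  have h1 : Tendsto (fun n => T * (4 * (m.dx n * |m.dx n * m.dp n / m.dt n|) +
      2 * (m.dt n * (m.dx n * m.dp n / m.dt n) ^ 2)) / η ^ 2) atTop (𝓝 0) := by
    have := ((((h.tendsto_dx.mul h.2.1.abs).const_mul 4).add
      ((h.1.mul (h.2.1.pow 2)).const_mul 2)).const_mul T).div_const (η ^ 2)
    simpa using this
  have h2 := ENNReal.tendsto_ofReal h1
  rw [ENNReal.ofReal_zero] at h2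
  refine tendsto_of_tendsto_of_tendsto_of_le_of_le tendsto_const_nhds h2 (fun _ => zero_le)
    fun n => ENNReal.ofReal_le_ofReal ?_
  have hdt := m.dt_pos n
  have hdx := m.dx_pos n
  refine div_le_div_of_nonneg_right ((floor_mul_le hT n (by positivity)).trans (le_of_eq ?_))
    (sq_nonneg η)
  rw [abs_div, abs_mul, abs_of_pos hdt, abs_of_pos hdx]
  field_simp

/-- A single placement has norm of order `dv / √dx`; with `dv` comparable to `dt`, summing the
squares over `T / dt` steps leaves order `dt / dx`, plus order `dt` from the conditional means. -/
theorem Scaling.tendsto_volume_noise (h : m.Scaling) (hT : 0 ≤ T) (M C η : ℝ) :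
    Tendsto (fun n => ENNReal.ofReal (⌊T / m.dt n⌋₊ *
      (|m.dv n| * (M / Real.sqrt (m.dx n) + C)) ^ 2 / η ^ 2)) atTop (𝓝 0) := by
  have h1 : Tendsto (fun n => T * ((m.dv n / m.dt n) ^ 2 * (M * Real.sqrt (m.dt n / m.dx n) +
      C * Real.sqrt (m.dt n)) ^ 2) / η ^ 2) atTop (𝓝 0) := by
    have := (((h.2.2.1.pow 2).mul (((h.tendsto_dt_div_dx.sqrt.const_mul M).add
      (h.1.sqrt.const_mul C)).pow 2)).const_mul T).div_const (η ^ 2)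
    simpa using this
  have h2 := ENNReal.tendsto_ofReal h1
  rw [ENNReal.ofReal_zero] at h2
  refine tendsto_of_tendsto_of_tendsto_of_le_of_le tendsto_const_nhds h2 (fun _ => zero_le)
    fun n => ENNReal.ofReal_le_ofReal ?_
  have hdt := m.dt_pos n
  have hdx := m.dx_pos n
  refine div_le_div_of_nonneg_right ((floor_mul_le hT n (by positivity)).trans (le_of_eq ?_))
    (sq_nonneg η)
  rw [Real.sqrt_div hdt.le]
  have e : M * (Real.sqrt (m.dt n) / Real.sqrt (m.dx n)) + C * Real.sqrt (m.dt n) =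
      Real.sqrt (m.dt n) * (M / Real.sqrt (m.dx n) + C) := by ring
  rw [e, mul_pow, mul_pow, Real.sq_sqrt hdt.le, sq_abs]
  field_simp

/-- The law of large numbers, for a given mild solution of the limit equation. -/
theorem tendsto_measure_iSup_path {pA pB pD pE : State → ℝ} {fCn fFn : ℕ → State → L2}
    {fC fF : State → L2} {s0 : State} {S : ℝ → State} {κ : ℝ} (hT : 0 ≤ T) (hM : 0 ≤ M)
    (hκ : 0 ≤ κ) (hscaling : m.Scaling)
    (hinit : Tendsto (fun n => ‖s0 - m.init n‖) atTop (𝓝 0))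
    (hmarks : m.BoundedMarks P M)
    (hA : m.EventAssumption P T L .A pA) (hB : m.EventAssumption P T L .B pB)
    (hD : m.EventAssumption P T L .D pD) (hE : m.EventAssumption P T L .E pE)
    (hC : m.PlacementAssumption P T M L .C fCn fC)
    (hF : m.PlacementAssumption P T M L .F fFn fF)
    (hp : LipschitzWith (2 * L) fun s => pD s - pE s)
    (hq : LipschitzWith (2 * L) fun s => pB s - pA s)
    (hf : LipschitzWith L fun s => cutoff (M + 1) (fF s))
    (hg : LipschitzWith L fun s => cutoff (M + 1) (fC s))
    (hS : MildSol T 0 (fun s => pD s - pE s) (fun s => pB s - pA s)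
      (fun s => cutoff (M + 1) (fF s)) (fun s => cutoff (M + 1) (fC s)) s0 S)
    (hSa : Admissible T S) (hva : TransLip κ s0.va) (hvb : TransLip κ s0.vb)
    (hfS : ∀ t ∈ Icc 0 T, TransLip κ (cutoff (M + 1) (fF (S t))))
    (hgS : ∀ t ∈ Icc 0 T, TransLip κ (cutoff (M + 1) (fC (S t)))) {ε : ℝ} (hε : 0 < ε) :
    Tendsto (fun n => P {w | ENNReal.ofReal ε < ⨆ t ∈ Icc 0 T, ‖m.path n t w - S t‖ₑ})
      atTop (𝓝 0) := by
  set Λ := stabilityConst T κ L with hΛ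
  have hΛ0 : 0 ≤ Λ := by
    rw [hΛ]
    unfold stabilityConst
    positivity
  obtain ⟨KC, hKC⟩ := hC.2.2.2.1
  obtain ⟨KF, hKF⟩ := hF.2.2.2.1
  -- The constants in the two `O(dx)` bounds carry no sign, hence the maximum with `0`.
  set K := max 0 (max KC KF) with hK
  have hK0 : 0 ≤ K := le_max_left _ _
  set Cφ := placementBound M with hCφ
  have hCφ0 : 0 ≤ Cφ := placementBound_nonneg hM
  -- Noise at most `η` on each side, and initial plus discretization error below `η`, give a
  -- distance of at most `2 * η * Λ ≤ ε`. The `1` avoids a division by zero.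
  set η := ε / (2 * (Λ + 1)) with hη
  have hη0 : 0 < η := by positivity
  set ρ : ℕ → ℝ := fun n => (T * |m.dx n * m.dp n / m.dt n - 1| + m.dt n) +
    (T * |m.dv n / m.dt n - 1| * Cφ + T * (K * m.dx n) + m.dt n * (Cφ + K * m.dx n)) with hρ
  have hρ0 : Tendsto ρ atTop (𝓝 0) := by
    have hdx := hscaling.tendsto_dx
    have h1 := (((hscaling.2.1.sub_const 1).abs.const_mul T).add hscaling.1).add
      (((((hscaling.2.2.1.sub_const 1).abs.const_mul T).mul_const Cφ).add
        ((hdx.const_mul K).const_mul T)).add (hscaling.1.mul ((hdx.const_mul K).const_add Cφ)))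
    simpa using h1
  have hsmall : ∀ᶠ n in atTop, ‖s0 - m.init n‖ + ρ n < η := by
    have h1 := hinit.add hρ0
    rw [add_zero] at h1
    exact h1.eventually_lt_const hη0
  have hdx1 : ∀ᶠ n in atTop, m.dx n ≤ 1 :=
    (hscaling.tendsto_dx.eventually_lt_const one_pos).mono fun _ h => h.le
  have hPn := hscaling.tendsto_price_noise hT η
  have hVn := hscaling.tendsto_volume_noise hT M Cφ η
  have hsum := (hPn.add hVn).add (hPn.add hVn)
  simp only [add_zero] at hsum
  refine tendsto_of_tendsto_of_tendsto_of_le_of_le' tendsto_const_nhds hsum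
    (Eventually.of_forall fun _ => zero_le) ?_
  filter_upwards [hsmall, hdx1, hKC, hKF] with n hn hdx hKCn hKFn
  have ha := isSide_ask hM hmarks hD hE hF hdx
  have hb := isSide_bid hM hmarks hA hB hC hdx
  refine le_trans ?_ (add_le_add
    (add_le_add (ha.measure_price_noise_le hη0) (ha.measure_volume_noise_le hM hCφ0 hη0))
    (add_le_add (hb.measure_price_noise_le hη0) (hb.measure_volume_noise_le hM hCφ0 hη0)))
  refine le_trans ?_ (add_le_add (measure_union_le _ _) (measure_union_le _ _))
  refine le_trans ?_ (measure_union_le _ _)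
  refine measure_mono_ae ?_
  have hFc : ∀ᵐ w ∂P, ∀ k ≤ ⌊T / m.dt n⌋₊,
      cutoff (M + 1) (fFn n (m.S n k w)) = fFn n (m.S n k w) := by
    rw [ae_all_iff]
    intro k
    by_cases hk : k ≤ ⌊T / m.dt n⌋₊
    · filter_upwards [hF.cutoff_eq hmarks hM hdx hk] with w hw _ using hw
    · exact Eventually.of_forall fun w h => absurd h hk
  have hCc : ∀ᵐ w ∂P, ∀ k ≤ ⌊T / m.dt n⌋₊,
      cutoff (M + 1) (fCn n (m.S n k w)) = fCn n (m.S n k w) := by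
    rw [ae_all_iff]
    intro k
    by_cases hk : k ≤ ⌊T / m.dt n⌋₊
    · filter_upwards [hC.cutoff_eq hmarks hM hdx hk] with w hw _ using hw
    · exact Eventually.of_forall fun w h => absurd h hk
  -- Off the four noise events the path is a mild solution, up to `η + ρ n`, of the truncated limit
  -- system; stability then contradicts a distance larger than `ε`.
  filter_upwards [hFc, hCc] with w hwF hwC hw
  by_contra hcon
  replace hcon : w ∉ ((_ ∪ _) ∪ (_ ∪ _) : Set Ω) := hcon
  simp only [mem_union, mem_ofPred_eq, not_or, not_exists, not_and, not_le] at hcon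
  obtain ⟨⟨c1, c2⟩, c3, c4⟩ := hcon
  have hdiff : ∀ {p p' : State → ℝ}, (∀ s, p s ∈ Icc (0 : ℝ) 1) → (∀ s, p' s ∈ Icc (0 : ℝ) 1) →
      ∀ s, |p s - p' s| ≤ 1 := fun hp hp' s => by
    rw [abs_le]
    constructor <;> linarith [(hp s).1, (hp s).2, (hp' s).1, (hp' s).2]
  have hKdx : 0 ≤ K * m.dx n := mul_nonneg hK0 (m.dx_pos n).le
  have hY : MildSol T (η + ρ n) (fun s => pD s - pE s) (fun s => pB s - pA s)
      (fun s => cutoff (M + 1) (fF s)) (fun s => cutoff (M + 1) (fC s)) (m.init n)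
      (fun t => m.path n t w) := by
    constructor
    · refine mild_of_discrete (dx := m.dx n) (dp := m.dp n) (dv := m.dv n) (m.dt_pos n) hCφ0 hKdx
        hT (x := fun k => (m.S n k w).ask) (c := fun k => pD (m.S n k w) - pE (m.S n k w))
        (v := fun k => (m.S n k w).va) (φ := fun k => fFn n (m.S n k w))
        (ψ := fun k => cutoff (M + 1) (fF (m.S n k w))) (fun k hk => (c1 k hk).le)
        (fun k hk => (c2 k hk).le) (fun k => hdiff hD.2.1 hE.2.1 _) (fun k hk => ?_)
        fun k hk => ?_
      · rw [← hwF k hk]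
        exact hF.norm_le hM n _
      · rw [← hwF k hk, ← map_sub]
        refine (norm_cutoff_le _ _).trans ((hKFn _).trans ?_)
        have := m.dx_pos n
        gcongr
        exact (le_max_right _ _).trans (le_max_right _ _)
    · refine mild_of_discrete (dx := m.dx n) (dp := m.dp n) (dv := m.dv n) (m.dt_pos n) hCφ0 hKdx
        hT (x := fun k => (m.S n k w).bid) (c := fun k => pB (m.S n k w) - pA (m.S n k w))
        (v := fun k => (m.S n k w).vb) (φ := fun k => fCn n (m.S n k w))
        (ψ := fun k => cutoff (M + 1) (fC (m.S n k w))) (fun k hk => (c3 k hk).le)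
        (fun k hk => (c4 k hk).le) (fun k => hdiff hB.2.1 hA.2.1 _) (fun k hk => ?_)
        fun k hk => ?_
      · rw [← hwC k hk]
        exact hC.norm_le hM n _
      · rw [← hwC k hk, ← map_sub]
        refine (norm_cutoff_le _ _).trans ((hKCn _).trans ?_)
        have := m.dx_pos n
        gcongr
        exact (le_max_left _ _).trans (le_max_right _ _)
  have hρn : 0 ≤ ρ n := by
    have := m.dt_pos n
    simp only [hρ]
    positivity
  have hdist := hS.dist_le hT (add_nonneg hη0.le hρn) hκ hp hq hf hg hY hSa
    (Admissible.of_step (m.dt_pos n) fun k => m.S n k w) hva hvb hfS hgS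
  refine absurd hw (not_lt.2 (iSup₂_le fun t ht => ?_))
  rw [← ofReal_norm]
  refine ENNReal.ofReal_le_ofReal ?_
  rw [norm_sub_rev]
  refine (hdist t ht).trans ?_
  calc Λ * (‖s0 - m.init n‖ + (η + ρ n)) ≤ Λ * (2 * η) := by
        gcongr
        linarith
    _ ≤ (Λ + 1) * (2 * η) := by gcongr; linarith
    _ = ε := by rw [hη]; field_simp

end Models

/-! ### Continuously differentiable functions of two variables -/

theorem hasStrictFDerivAt_of_partials {f f1 f2 : ℝ → ℝ → ℝ}
    (h1 : ∀ t y, HasDerivAt (fun s => f s y) (f1 t y) t)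
    (h2 : ∀ t y, HasDerivAt (f t) (f2 t y) y)
    (c1 : Continuous fun z : ℝ × ℝ => f1 z.1 z.2) (c2 : Continuous fun z : ℝ × ℝ => f2 z.1 z.2)
    (z : ℝ × ℝ) :
    HasStrictFDerivAt (fun z : ℝ × ℝ => f z.1 z.2)
      ((ContinuousLinearMap.toSpanSingleton ℝ (f1 z.1 z.2)).coprod
        (ContinuousLinearMap.toSpanSingleton ℝ (f2 z.1 z.2))) z := by
  have ht : Continuous fun d : ℝ => ContinuousLinearMap.toSpanSingleton ℝ d :=
    (ContinuousLinearMap.toSpanSingletonLIE ℝ ℝ).continuous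
  exact hasStrictFDerivAt_uncurry_coprod (f := f)
    (f₁ := fun t y => ContinuousLinearMap.toSpanSingleton ℝ (f1 t y))
    (f₂ := fun t y => ContinuousLinearMap.toSpanSingleton ℝ (f2 t y))
    (Eventually.of_forall fun v => (h1 v.1 v.2).hasFDerivAt)
    (Eventually.of_forall fun v => (h2 v.1 v.2).hasFDerivAt)
    (ht.comp c1).continuousAt (ht.comp c2).continuousAt

theorem contDiff_one_of_partials {f f1 f2 : ℝ → ℝ → ℝ}
    (h1 : ∀ t y, HasDerivAt (fun s => f s y) (f1 t y) t)
    (h2 : ∀ t y, HasDerivAt (f t) (f2 t y) y)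
    (c1 : Continuous fun z : ℝ × ℝ => f1 z.1 z.2) (c2 : Continuous fun z : ℝ × ℝ => f2 z.1 z.2) :
    ContDiff ℝ 1 fun z : ℝ × ℝ => f z.1 z.2 := by
  have h := hasStrictFDerivAt_of_partials h1 h2 c1 c2
  rw [contDiff_one_iff_fderiv]
  refine ⟨fun z => (h z).hasFDerivAt.differentiableAt, ?_⟩
  have e : fderiv ℝ (fun z : ℝ × ℝ => f z.1 z.2) = fun z =>
      (ContinuousLinearMap.toSpanSingleton ℝ (f1 z.1 z.2)).coprod
        (ContinuousLinearMap.toSpanSingleton ℝ (f2 z.1 z.2)) :=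
    funext fun z => (h z).hasFDerivAt.fderiv
  rw [e]
  refine continuous_clm_apply.2 fun w => ?_
  simp only [ContinuousLinearMap.coprod_apply, ContinuousLinearMap.toSpanSingleton_apply]
  fun_prop

/-- A continuous curve in `L²(ℝ)` of uniformly Lipschitz functions is jointly continuous. -/
theorem continuous_uncurry_of_lipschitz {K : ℝ≥0} {F : ℝ → L2} (hF : Continuous F)
    {G : ℝ → ℝ → ℝ} (hFG : ∀ s, F s =ᵐ[volume] G s) (hG : ∀ s, LipschitzWith K (G s)) :
    Continuous fun z : ℝ × ℝ => G z.1 z.2 := by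
  have hcont : ∀ y, Continuous fun s => G s y := by
    intro y
    rw [continuous_iff_continuousAt]
    intro s0
    rw [ContinuousAt, Metric.tendsto_nhds]
    intro ε hε
    -- The bound `2Kδ + ‖F s - F s0‖ / √δ` from `abs_le_of_lipschitz` has its first term at most `ε
    -- / 2` by this choice, and its second term below `ε / 2` for `s` near `s0`.
    set δ := ε / (2 * (2 * K + 1)) with hδ
    have hδ0 : 0 < δ := by positivity
    have hsq : 0 < Real.sqrt δ := Real.sqrt_pos.2 hδ0
    have hev : ∀ᶠ s in 𝓝 s0, ‖F s - F s0‖ < Real.sqrt δ * (ε / 2) := by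
      have := Metric.tendsto_nhds.1 (hF.tendsto s0) (Real.sqrt δ * (ε / 2)) (by positivity)
      simpa only [dist_eq_norm] using this
    filter_upwards [hev] with s hs
    have h1 := abs_le_of_lipschitz (f := F s - F s0) (g := fun x => G s x - G s0 x)
      (by
        filter_upwards [Lp.coeFn_sub (F s) (F s0), hFG s, hFG s0] with x h1 h2 h3
        rw [h1, Pi.sub_apply, h2, h3]) ((hG s).sub (hG s0)) y hδ0
    rw [Real.dist_eq]
    have h2 : ‖F s - F s0‖ / Real.sqrt δ < ε / 2 := by
      rw [div_lt_iff₀ hsq]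
      linarith
    have h3 : ((K + K : ℝ≥0) : ℝ) * δ ≤ ε / 2 := by
      rw [hδ, NNReal.coe_add]
      have hK := K.coe_nonneg
      rw [mul_div_assoc', div_le_iff₀ (by positivity)]
      nlinarith
    linarith
  exact (continuous_prod_of_continuous_lipschitzWith (fun z : ℝ × ℝ => G z.2 z.1) K
    (fun y => hcont y) hG).comp continuous_swap

/-! ### Mild solutions with smooth data are classical solutions -/

section Classical

variable {M : ℝ} {x0 : ℝ} {c : ℝ → ℝ} {F : ℝ → L2} {G : ℝ → ℝ → ℝ}

theorem hasDerivAt_priceOf (x0 : ℝ) (hc : Continuous c) (t : ℝ) :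
    HasDerivAt (priceOf x0 c) (c t) t :=
  ((hc.integral_hasStrictDerivAt 0 t).hasDerivAt).const_add x0

theorem contDiff_priceOf (x0 : ℝ) (hc : Continuous c) : ContDiff ℝ 1 (priceOf x0 c) := by
  rw [contDiff_one_iff_deriv]
  refine ⟨fun t => (hasDerivAt_priceOf x0 hc t).differentiableAt, ?_⟩
  rwa [show deriv (priceOf x0 c) = c from funext fun t => (hasDerivAt_priceOf x0 hc t).deriv]

theorem lipschitzWith_of_abs_deriv_le {M : ℝ} {g : ℝ → ℝ} (hg : ContDiff ℝ 1 g)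
    (h : ∀ x, |deriv g x| ≤ M) : LipschitzWith M.toNNReal g := by
  refine lipschitzWith_of_nnnorm_deriv_le (hg.differentiable (by norm_num)) fun x => ?_
  rw [← NNReal.coe_le_coe, coe_nnnorm, Real.norm_eq_abs]
  exact (h x).trans (Real.le_coe_toNNReal M)

/-- The source terms, accumulated in the frame that moves with the price. -/
noncomputable def accumulated (x0 : ℝ) (c : ℝ → ℝ) (G : ℝ → ℝ → ℝ) (t y : ℝ) : ℝ :=
  ∫ s in (0 : ℝ)..t, G s (y + (x0 - priceOf x0 c s))

/-- The spatial derivative of the accumulated source terms. -/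
noncomputable def accumulatedDeriv (x0 : ℝ) (c : ℝ → ℝ) (G : ℝ → ℝ → ℝ) (t y : ℝ) : ℝ :=
  ∫ s in (0 : ℝ)..t, deriv (G s) (y + (x0 - priceOf x0 c s))

theorem continuous_source (hc : Continuous c) (hGc : Continuous fun z : ℝ × ℝ => G z.1 z.2) :
    Continuous fun z : ℝ × ℝ => G z.1 (z.2 + (x0 - priceOf x0 c z.1)) := by
  have := continuous_priceOf x0 hc
  exact hGc.comp (f := fun z : ℝ × ℝ => (z.1, z.2 + (x0 - priceOf x0 c z.1))) (by fun_prop)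

/-- The spatial derivative of the source is not assumed continuous in time. Measurability and a
uniform bound are enough to differentiate under the integral. -/
theorem measurable_deriv_source (hc : Continuous c)
    (hGc : Continuous fun z : ℝ × ℝ => G z.1 z.2) (y : ℝ) :
    Measurable fun s => deriv (G s) (y + (x0 - priceOf x0 c s)) := by
  have h1 := measurable_deriv_with_param (f := G) hGc
  have h2 := continuous_priceOf x0 hc
  exact h1.comp (measurable_id.prodMk
    (measurable_const.add (measurable_const.sub h2.measurable)))

theorem hasDerivAt_accumulated_left (hc : Continuous c)
    (hGc : Continuous fun z : ℝ × ℝ => G z.1 z.2) (t y : ℝ) :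
    HasDerivAt (fun t => accumulated x0 c G t y) (G t (y + (x0 - priceOf x0 c t))) t := by
  have h1 : Continuous fun s => G s (y + (x0 - priceOf x0 c s)) :=
    (continuous_source (x0 := x0) hc hGc).comp (f := fun s : ℝ => (s, y)) (by fun_prop)
  exact (h1.integral_hasStrictDerivAt 0 t).hasDerivAt

theorem hasDerivAt_accumulated_right (hc : Continuous c)
    (hGc : Continuous fun z : ℝ × ℝ => G z.1 z.2) (hG : ∀ s, ContDiff ℝ 1 (G s))
    (hGM : ∀ s y, |deriv (G s) y| ≤ M) (t y : ℝ) :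
    HasDerivAt (accumulated x0 c G t) (accumulatedDeriv x0 c G t y) y := by
  have h1 : ∀ y, Continuous fun s => G s (y + (x0 - priceOf x0 c s)) := fun y =>
    (continuous_source (x0 := x0) hc hGc).comp (f := fun s : ℝ => (s, y)) (by fun_prop)
  refine (intervalIntegral.hasDerivAt_integral_of_dominated_loc_of_deriv_le
    (F := fun y s => G s (y + (x0 - priceOf x0 c s)))
    (F' := fun y s => deriv (G s) (y + (x0 - priceOf x0 c s)))
    (bound := fun _ => M) (s := univ) univ_mem
    (Eventually.of_forall fun y => (h1 y).aestronglyMeasurable)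
    ((h1 y).intervalIntegrable _ _) (measurable_deriv_source hc hGc y).aestronglyMeasurable
    (Eventually.of_forall fun s _ y _ => hGM _ _) intervalIntegrable_const
    (Eventually.of_forall fun s _ y _ => ?_)).2
  exact (((hG s).differentiable (by norm_num)) _).hasDerivAt.comp_add_const _ _

/-- Continuity in `y` holds by dominated convergence, and the integral is Lipschitz in `t` uniformly
in `y` because the integrand is bounded; the two together give joint continuity. -/
theorem continuous_accumulatedDeriv (hc : Continuous c)
    (hGc : Continuous fun z : ℝ × ℝ => G z.1 z.2) (hG : ∀ s, ContDiff ℝ 1 (G s))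
    (hGM : ∀ s y, |deriv (G s) y| ≤ M) :
    Continuous fun z : ℝ × ℝ => accumulatedDeriv x0 c G z.1 z.2 := by
  have hint : ∀ y a b, IntervalIntegrable (fun s => deriv (G s) (y + (x0 - priceOf x0 c s)))
      volume a b := fun y a b => by
    refine (intervalIntegrable_const (c := M)).mono_fun
      (measurable_deriv_source hc hGc y).aestronglyMeasurable (Eventually.of_forall fun s => ?_)
    rw [Real.norm_eq_abs]
    exact (hGM _ _).trans (le_abs_self M)
  refine continuous_prod_of_continuous_lipschitzWith _ M.toNNReal (fun t => ?_) fun y => ?_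
  · refine intervalIntegral.continuous_of_dominated_interval (bound := fun _ => M)
      (fun y => (measurable_deriv_source hc hGc y).aestronglyMeasurable)
      (fun y => Eventually.of_forall fun s _ => hGM _ _) intervalIntegrable_const
      (Eventually.of_forall fun s _ => ?_)
    exact ((hG s).continuous_deriv le_rfl).comp (by fun_prop)
  · refine LipschitzWith.of_dist_le_mul fun t t' => ?_
    simp only [accumulatedDeriv]
    rw [dist_eq_norm, intervalIntegral.integral_interval_sub_left (hint y _ _) (hint y _ _)]
    have h1 := intervalIntegral.norm_integral_le_of_norm_le_const (a := t') (b := t) (C := M)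
      (f := fun s => deriv (G s) (y + (x0 - priceOf x0 c s))) fun s _ => hGM _ _
    refine h1.trans ?_
    rw [Real.dist_eq]
    gcongr
    exact Real.le_coe_toNNReal M

/-- The version of the volume density in a mild solution. -/
noncomputable def density (x0 : ℝ) (g0 : ℝ → ℝ) (c : ℝ → ℝ) (G : ℝ → ℝ → ℝ) (t y : ℝ) : ℝ :=
  g0 (y + (priceOf x0 c t - x0)) + accumulated x0 c G t (y + (priceOf x0 c t - x0))

theorem volumeOf_ae_eq {v0 : L2} {g0 : ℝ → ℝ} (hv0 : v0 =ᵐ[volume] g0) (hc : Continuous c)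
    (hF : Continuous F) (hFG : ∀ s, F s =ᵐ[volume] G s)
    (hGc : Continuous fun z : ℝ × ℝ => G z.1 z.2) {t : ℝ} (ht : 0 ≤ t) :
    volumeOf x0 v0 c F t =ᵐ[volume] density x0 g0 c G t := by
  have h1 := continuous_priceOf x0 hc
  have h2 : Continuous fun s => shift (x0 - priceOf x0 c s) (F s) :=
    continuous_shift (by fun_prop) hF
  have h3 := coeFn_intervalIntegral h2 (continuous_source (x0 := x0) hc hGc)
    (fun s => shift_ae_eq (hFG s) (x0 - priceOf x0 c s)) ht
  have h4 : (v0 + ∫ s in (0 : ℝ)..t, shift (x0 - priceOf x0 c s) (F s) : L2) =ᵐ[volume]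
      fun y => g0 y + accumulated x0 c G t y := by
    filter_upwards [Lp.coeFn_add v0 (∫ s in (0 : ℝ)..t, shift (x0 - priceOf x0 c s) (F s)), hv0,
      h3] with y e1 e2 e3
    rw [e1, Pi.add_apply, e2, e3]
    rfl
  exact shift_ae_eq h4 (priceOf x0 c t - x0)

/-- The density is a `C¹` function of time and of the moving coordinate `y + (priceOf x0 c t - x0)`.
The chain rule through that coordinate produces the transport term, and the direct time derivative
produces the source, whose two displacements cancel. -/
theorem solvesTransport_density {T : ℝ} {g0 : ℝ → ℝ} (hg0 : ContDiff ℝ 1 g0) (hc : Continuous c)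
    (hFG : ∀ s, F s =ᵐ[volume] G s) (hGc : Continuous fun z : ℝ × ℝ => G z.1 z.2)
    (hG : ∀ s, ContDiff ℝ 1 (G s)) (hGM : ∀ s y, |deriv (G s) y| ≤ M) :
    SolvesTransport T c F (density x0 g0 c G) := by
  have d1 := hasDerivAt_accumulated_left (x0 := x0) hc hGc
  have d2 := hasDerivAt_accumulated_right (x0 := x0) hc hGc hG hGM
  have c1 := continuous_source (x0 := x0) hc hGc
  have c2 := continuous_accumulatedDeriv (x0 := x0) hc hGc hG hGM
  have hx := contDiff_priceOf x0 hc
  constructor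
  · refine ContDiff.contDiffOn ?_
    have h1 : ContDiff ℝ 1 fun z : ℝ × ℝ => z.2 + (priceOf x0 c z.1 - x0) := by fun_prop
    have h2 : ContDiff ℝ 1 fun z : ℝ × ℝ => accumulated x0 c G z.1 z.2 :=
      contDiff_one_of_partials d1 d2 c1 c2
    exact (hg0.comp h1).add (h2.comp (contDiff_fst.prodMk h1))
  · intro t _
    refine ⟨G t, (hG t).continuous, hFG t, fun y => HasDerivAt.hasDerivWithinAt ?_⟩
    set z := y + (priceOf x0 c t - x0) with hz
    have hg : HasDerivAt g0 (deriv g0 z) z :=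
      ((hg0.differentiable (by norm_num)) z).hasDerivAt
    have hpt : HasDerivAt (fun r => y + (priceOf x0 c r - x0)) (c t) t :=
      ((hasDerivAt_priceOf x0 hc t).sub_const x0).const_add y
    have e1 : deriv (density x0 g0 c G t) y = deriv g0 z + accumulatedDeriv x0 c G t z :=
      (((hg.add (d2 t z)).comp_add_const y (priceOf x0 c t - x0))).deriv
    have e2 : HasDerivAt (fun r => accumulated x0 c G r (y + (priceOf x0 c r - x0)))
        (G t y + accumulatedDeriv x0 c G t z * c t) t := by
      have h3 := (hasStrictFDerivAt_of_partials d1 d2 c1 c2 (t, z)).hasFDerivAt.comp_hasDerivAt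
        (f := fun r => (r, y + (priceOf x0 c r - x0))) t ((hasDerivAt_id t).prodMk hpt)
      refine h3.congr_deriv ?_
      have hy : z + (x0 - priceOf x0 c t) = y := by rw [hz]; ring
      simp [hy, mul_comm]
    have e3 : HasDerivAt (fun r => density x0 g0 c G r y) _ t := (hg.comp t hpt).add e2
    rw [e1]
    exact e3.congr_deriv (by ring)

end Classical

theorem Mild.eqOn_priceOf {T x0 : ℝ} {v0 : L2} {c : ℝ → ℝ} {F : ℝ → L2} {x : ℝ → ℝ} {v : ℝ → L2}
    (h : Mild T 0 x0 v0 c F x v) : EqOn x (priceOf x0 c) (Icc 0 T) := fun t ht =>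
  sub_eq_zero.1 (abs_nonpos_iff.1 (h t ht).1)

theorem Mild.eqOn_volumeOf {T x0 : ℝ} {v0 : L2} {c : ℝ → ℝ} {F : ℝ → L2} {x : ℝ → ℝ} {v : ℝ → L2}
    (h : Mild T 0 x0 v0 c F x v) : EqOn v (volumeOf x0 v0 c F) (Icc 0 T) := fun t ht =>
  sub_eq_zero.1 (norm_le_zero_iff.1
    ((h.congr (fun _ _ => rfl) (fun _ _ => rfl) h.eqOn_priceOf (fun _ _ => rfl)) t ht).2)

/-! ### Classical solutions are mild solutions -/

theorem integral_eq_sub_of_hasDerivWithinAt_Icc {T t : ℝ} {f f' : ℝ → ℝ} (ht : t ∈ Icc 0 T)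
    (hf' : ContinuousOn f' (Icc 0 T))
    (h : ∀ s ∈ Icc 0 T, HasDerivWithinAt f (f' s) (Icc 0 T) s) :
    ∫ s in (0 : ℝ)..t, f' s = f t - f 0 := by
  have hsub : Icc 0 t ⊆ Icc 0 T := Icc_subset_Icc_right ht.2
  refine intervalIntegral.integral_eq_sub_of_hasDeriv_right_of_le ht.1
    (fun s hs => ((h s (hsub hs)).continuousWithinAt).mono hsub) (fun s hs => ?_) ?_
  · refine (h s (hsub (Ioo_subset_Icc_self hs))).mono_of_mem_nhdsWithin ?_
    refine mem_of_superset (Ioo_mem_nhdsGT hs.2) fun r hr => ⟨?_, ?_⟩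
    · exact hs.1.le.trans hr.1.le
    · exact hr.2.le.trans ht.2
  · refine ContinuousOn.intervalIntegrable ?_
    rw [uIcc_of_le ht.1]
    exact hf'.mono hsub

/-- Along the characteristic `s ↦ y + (x 0 - x s)` the transport term cancels and the time
derivative is the source alone. Integrating for each `y` and identifying the pointwise with the
Bochner integral gives the mild equation. -/
theorem mild_of_solvesTransport {T : ℝ} (hT : 0 < T) {c : ℝ → ℝ} {F : ℝ → L2} {x : ℝ → ℝ}
    {v : ℝ → L2} {u : ℝ → ℝ → ℝ} (hc : ContinuousOn c (Icc 0 T)) (hF : ContinuousOn F (Icc 0 T))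
    (hx : ∀ t ∈ Icc 0 T, HasDerivWithinAt x (c t) (Icc 0 T) t)
    (hv : ∀ t ∈ Icc 0 T, v t =ᵐ[volume] u t) (h : SolvesTransport T c F u) :
    Mild T 0 (x 0) (v 0) c F x v := by
  intro t ht
  have h0 : (0 : ℝ) ∈ Icc 0 T := ⟨le_rfl, hT.le⟩
  have hxc : ContinuousOn x (Icc 0 T) := fun s hs => (hx s hs).continuousWithinAt
  set A : Set (ℝ × ℝ) := Icc 0 T ×ˢ univ with hA
  set D := fderivWithin ℝ (fun z : ℝ × ℝ => u z.1 z.2) A with hD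
  have hud : UniqueDiffOn ℝ A := (uniqueDiffOn_Icc hT).prod uniqueDiffOn_univ
  have hDc : ContinuousOn D A := h.1.continuousOn_fderivWithin hud le_rfl
  have hDd : ∀ z ∈ A, HasFDerivWithinAt (fun z : ℝ × ℝ => u z.1 z.2) (D z) A z := fun z hz =>
    ((h.1.differentiableOn (by norm_num)) z hz).hasFDerivWithinAt
  set k : ℝ → ℝ → ℝ := fun s y => D (s, y + (x 0 - x s)) (1, -c s) with hk
  have hkc : ContinuousOn (fun z : ℝ × ℝ => k z.1 z.2) A := by
    have m1 : MapsTo Prod.fst A (Icc (0 : ℝ) T) := fun z hz => hz.1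
    have hx1 : ContinuousOn (fun z : ℝ × ℝ => x z.1) A := hxc.comp continuousOn_fst m1
    have hc1 : ContinuousOn (fun z : ℝ × ℝ => c z.1) A := hc.comp continuousOn_fst m1
    refine ContinuousOn.clm_apply (hDc.comp (f := fun z : ℝ × ℝ => (z.1, z.2 + (x 0 - x z.1)))
      (by fun_prop) fun z hz => ⟨hz.1, mem_univ _⟩) (by fun_prop)
  have hkd : ∀ y, ∀ s ∈ Icc 0 T,
      HasDerivWithinAt (fun s => u s (y + (x 0 - x s))) (k s y) (Icc 0 T) s := by
    intro y s hs
    have h1 : HasDerivWithinAt (fun s => (s, y + (x 0 - x s))) (1, -c s) (Icc 0 T) s :=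
      (hasDerivWithinAt_id s _).prodMk (((hx s hs).const_sub (x 0)).const_add y)
    exact (hDd (s, y + (x 0 - x s)) ⟨hs, mem_univ _⟩).comp_hasDerivWithinAt
      (f := fun s => (s, y + (x 0 - x s))) s h1 fun r hr => ⟨hr, mem_univ _⟩
  have hks : ∀ s ∈ Icc 0 T, shift (x 0 - x s) (F s) =ᵐ[volume] k s := by
    intro s hs
    obtain ⟨g, -, hFg, hg⟩ := h.2 s hs
    -- The direction `(1, -c s)` is the time direction minus `c s` times the space direction, and
    -- the equation says that this derivative is the source.
    have key : ∀ z, D (s, z) (1, -c s) = g z := by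
      intro z
      have hz : (s, z) ∈ A := ⟨hs, mem_univ _⟩
      have e1 : D (s, z) (1, 0) = c s * deriv (u s) z + g z := by
        have h1 : HasDerivWithinAt (fun r => (r, z)) ((1 : ℝ), (0 : ℝ)) (Icc 0 T) s :=
          (hasDerivWithinAt_id s _).prodMk (hasDerivWithinAt_const s _ z)
        have h2 := (hDd (s, z) hz).comp_hasDerivWithinAt (f := fun r => (r, z)) s h1
          fun r hr => ⟨hr, mem_univ _⟩
        exact ((uniqueDiffOn_Icc hT) s hs).eq_deriv _ h2 (hg z)
      have e2 : D (s, z) (0, 1) = deriv (u s) z := by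
        have h1 : HasDerivWithinAt (fun y => (s, y)) ((0 : ℝ), (1 : ℝ)) univ z :=
          (hasDerivWithinAt_const z _ s).prodMk (hasDerivWithinAt_id z _)
        have h2 := (hDd (s, z) hz).comp_hasDerivWithinAt (f := fun y => (s, y)) z h1
          fun r hr => ⟨hs, mem_univ _⟩
        rw [hasDerivWithinAt_univ] at h2
        exact h2.deriv.symm
      have e3 : ((1 : ℝ), -c s) = (1, 0) - c s • ((0 : ℝ), (1 : ℝ)) := by simp
      rw [e3, map_sub, map_smul, e1, e2, smul_eq_mul]
      ring
    refine (shift_ae_eq hFg _).trans (Eventually.of_forall fun y => ?_)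
    exact (key _).symm
  -- `coeFn_intervalIntegral` needs curves that are continuous on the whole line, so the data are
  -- frozen outside `[0, T]`.
  have hcl := continuous_clamp T
  have hclm := clamp_mem hT.le
  have hF' : Continuous fun s => shift (x 0 - x (clamp T s)) (F (clamp T s)) :=
    (continuousOn_shift (continuousOn_const.sub hxc) hF).comp_continuous hcl hclm
  have hk' : Continuous fun z : ℝ × ℝ => k (clamp T z.1) z.2 :=
    hkc.comp_continuous (f := fun z : ℝ × ℝ => (clamp T z.1, z.2)) (by fun_prop)
      fun z => ⟨hclm _, mem_univ _⟩
  have hclt : ∀ s ∈ uIcc 0 t, clamp T s = s := fun s hs => by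
    rw [uIcc_of_le ht.1] at hs
    exact clamp_of_mem ⟨hs.1, hs.2.trans ht.2⟩
  have hint := coeFn_intervalIntegral hF' hk' (fun s => hks _ (hclm s)) ht.1
  rw [intervalIntegral.integral_congr (g := fun s => shift (x 0 - x s) (F s)) fun s hs => by
    simp only [hclt s hs]] at hint
  refine ⟨?_, ?_⟩
  · rw [integral_eq_sub_of_hasDerivWithinAt_Icc ht hc hx]
    simp
  · have hmain : shift (x 0 - x t) (v t) =
        v 0 + ∫ s in (0 : ℝ)..t, shift (x 0 - x s) (F s) := by
      refine Lp.ext ?_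
      filter_upwards [shift_ae_eq (hv t ht) (x 0 - x t), hint, hv 0 h0,
        Lp.coeFn_add (v 0) (∫ s in (0 : ℝ)..t, shift (x 0 - x s) (F s))] with y e1 e2 e3 e4
      rw [e4, Pi.add_apply, e1, e2, e3]
      have h5 := integral_eq_sub_of_hasDerivWithinAt_Icc (f := fun s => u s (y + (x 0 - x s)))
        (f' := fun s => k s y) ht
        (hkc.comp (f := fun s : ℝ => (s, y)) (by fun_prop) fun s hs => ⟨hs, mem_univ _⟩) (hkd y)
      rw [intervalIntegral.integral_congr (g := fun s => k s y) fun s hs => by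
        simp only [hclt s hs], h5]
      simp
    rw [← hmain, shift_shift]
    simp

/-! ### The limit data -/

theorem TransLip.mono {C C' : ℝ} (h : C ≤ C') {f : L2} (hf : TransLip C f) : TransLip C' f :=
  fun y => (hf y).trans (by gcongr)

/-- A continuously differentiable limit of uniformly compactly supported densities is Lipschitz
continuous. -/
theorem exists_lipVol_of_tendsto {R : ℝ} (hR : 0 ≤ R) {v : L2} {vn : ℕ → L2}
    (hvn : ∀ n, ∀ᵐ x, R < |x| → vn n x = 0) (hlim : Tendsto vn atTop (𝓝 v)) {g : ℝ → ℝ}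
    (hvg : v =ᵐ[volume] g) (hg : ContDiff ℝ 1 g) :
    ∃ (K : ℝ≥0) (κ : ℝ), v ∈ LipVol K ∧ TransLip κ v := by
  have h1 : cutoff R v = v := by
    have h2 : Tendsto (fun n => cutoff R (vn n)) atTop (𝓝 (cutoff R v)) :=
      ((cutoff R).continuous.tendsto v).comp hlim
    simp only [fun n => cutoff_eq_self (hvn n)] at h2
    exact tendsto_nhds_unique h2 hlim
  -- Both sides are continuous, so equality almost everywhere is equality; hence `g` itself has
  -- compact support, and a `C¹` function with compact support is Lipschitz.
  have h3 : (fun x => bump R x * g x) = g := by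
    refine (((lipschitzWith_bump R).continuous.mul hg.continuous).ae_eq_iff_eq volume
      hg.continuous).1 ?_
    have h4 := coeFn_cutoff R v
    rw [h1] at h4
    filter_upwards [h4, hvg] with x e1 e2
    rw [Pi.mul_apply, ← e2, ← e1]
  have h5 : ∀ x, x ∉ Icc (-(R + 1)) (R + 1) → g x = 0 := fun x hx => by
    have hb : bump R x = 0 := bump_eq_zero (not_lt.1 fun h => hx (abs_le.1 h.le))
    rw [← h3]
    simp only [hb, zero_mul]
  obtain ⟨K, hK⟩ := hg.lipschitzWith_of_hasCompactSupport
    (HasCompactSupport.intro isCompact_Icc h5) (by norm_num)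
  exact ⟨K, _, ⟨g, hvg, hK⟩, transLip_of_lipschitz (by positivity) hvg hK h5⟩

theorem IsInitialVolume.ae_eq_zero {dx M : ℝ} {v : L2} (h : IsInitialVolume dx M v) :
    ∀ᵐ x, M < |x| → v x = 0 := by
  obtain ⟨g, hg, -, -, h0⟩ := h
  filter_upwards [hg] with x hx hMx
  rw [hx]
  exact h0 x fun hm => absurd (abs_le.2 hm) (not_le.2 hMx)

namespace Models

variable {Ω : Type*} [MeasurableSpace Ω] {m : Models Ω} {P : Measure Ω} {T M : ℝ} {L : ℝ≥0}
  {I : Event} {fn : ℕ → State → L2} {f : State → L2} {s0 : State}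

theorem InitialAssumption.tendsto_norm_sub (h : m.InitialAssumption M s0)
    (hdx : Tendsto m.dx atTop (𝓝 0)) :
    Tendsto (fun n => ‖s0 - m.init n‖) atTop (𝓝 0) := by
  obtain ⟨-, -, -, -, h1, h2, -, h3, h4⟩ := h
  have e1 := (tendsto_const_nhds (x := s0.ask)).sub h1 |>.abs
  have e2 := (tendsto_const_nhds (x := s0.bid)).sub h2 |>.abs
  have e := (e1.add (h3.trans_tendsto hdx)).add (e2.add (h4.trans_tendsto hdx))
  simp only [sub_self, abs_zero, add_zero] at e
  refine e.congr fun n => ?_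
  rw [State.norm_sub_eq, norm_sub_rev (m.init n).va, norm_sub_rev (m.init n).vb]

theorem PlacementAssumption.tendsto (h : m.PlacementAssumption P T M L I fn f)
    (hdx : Tendsto m.dx atTop (𝓝 0)) (s : State) : Tendsto (fun n => fn n s) atTop (𝓝 (f s)) := by
  obtain ⟨K, hK⟩ := h.2.2.2.1
  refine tendsto_iff_norm_sub_tendsto_zero.2 (squeeze_zero' (Eventually.of_forall fun n =>
    norm_nonneg _) (hK.mono fun n hn => hn s) ?_)
  simpa using hdx.const_mul K

theorem PlacementAssumption.lipschitzWith (h : m.PlacementAssumption P T M L I fn f)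
    (hdx : Tendsto m.dx atTop (𝓝 0)) : LipschitzWith L f :=
  LipschitzWith.of_dist_le_mul fun s s' =>
    le_of_tendsto ((h.tendsto hdx s).dist (h.tendsto hdx s'))
      (Eventually.of_forall fun n => (h.1 n).dist_le_mul s s')

/-- The bounds on `f[s]` and its derivative make the truncated function Lipschitz, and its support
of fixed size turns this into a Lipschitz estimate for translations in `L²`. Both constants depend
on `M` only. -/
theorem PlacementAssumption.transLip_cutoff (h : m.PlacementAssumption P T M L I fn f)
    (hM : 0 ≤ M) {s : State} (ha : IsLipschitzVolume s.va) (hb : IsLipschitzVolume s.vb) :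
    TransLip (↑(M.toNNReal + M.toNNReal) * Real.sqrt (4 * (M + 1 + 1))) (cutoff (M + 1) (f s)) ∧
      cutoff (M + 1) (f s) ∈ LipVol (M.toNNReal + M.toNNReal) := by
  obtain ⟨g, hfg, hg, hgM⟩ := h.2.2.2.2 s ha hb
  obtain ⟨g', h1, h2, h3⟩ := exists_version_cutoff (R := M + 1) hfg
    (lipschitzWith_of_abs_deriv_le hg fun x => (hgM x).2)
    fun x => (hgM x).1.trans (Real.le_coe_toNNReal M)
  exact ⟨transLip_of_lipschitz (by positivity) h1 h2 h3, g', h1, h2⟩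

/-- The limit placement density vanishes outside a fixed interval at states which are approached
by the discrete models. -/
theorem PlacementAssumption.cutoff_limit_eq [IsProbabilityMeasure P]
    (h : m.PlacementAssumption P T M L I fn f) (hmarks : m.BoundedMarks P M) (hM : 0 ≤ M)
    (hdx : Tendsto m.dx atTop (𝓝 0)) {S : ℝ → State}
    (hS : ∀ ε : ℝ, 0 < ε → Tendsto
      (fun n => P {w | ENNReal.ofReal ε < ⨆ t ∈ Icc 0 T, ‖m.path n t w - S t‖ₑ}) atTop (𝓝 0))
    {t : ℝ} (ht : t ∈ Icc 0 T) : cutoff (M + 1) (f (S t)) = f (S t) := by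
  have hL := h.lipschitzWith hdx
  obtain ⟨K, hK⟩ := h.2.2.2.1
  have key : ∀ ε : ℝ, 0 < ε → ‖cutoff (M + 1) (f (S t)) - f (S t)‖ ≤ 2 * ((L + 1) * ε) := by
    intro ε hε
    have hKdx : ∀ᶠ n in atTop, K * m.dx n < ε :=
      Tendsto.eventually_lt_const hε (by simpa using hdx.const_mul K)
    have hdx1 : ∀ᶠ n in atTop, m.dx n ≤ 1 :=
      (hdx.eventually_lt_const one_pos).mono fun _ h => h.le
    obtain ⟨n, h1, h2, h3, h4⟩ := (hKdx.and (hdx1.and (((hS ε hε).eventually_lt_const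
      one_pos).and hK))).exists
    have hk : ⌊t / m.dt n⌋₊ ≤ ⌊T / m.dt n⌋₊ :=
      Nat.floor_le_floor (div_le_div_of_nonneg_right ht.2 (m.dt_pos n).le)
    -- The exceptional event has probability less than `1` and the support property holds almost
    -- surely, so some sample point satisfies both.
    have hex : ∃ w, cutoff (M + 1) (fn n (m.path n t w)) = fn n (m.path n t w) ∧
        ‖m.path n t w - S t‖ ≤ ε := by
      by_contra! hcon
      refine absurd h3 (not_lt.2 ?_)
      refine (measure_univ (μ := P)).symm.trans_le (measure_mono_ae ?_)
      filter_upwards [h.cutoff_eq hmarks hM h2 hk] with w hw _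
      refine lt_of_lt_of_le ?_ (le_iSup₂ (f := fun t _ => ‖m.path n t w - S t‖ₑ) t ht)
      rw [← ofReal_norm]
      exact (ENNReal.ofReal_lt_ofReal_iff_of_nonneg hε.le).2 (hcon w hw)
    obtain ⟨w, hw, hwS⟩ := hex
    set Y := m.path n t w
    have hb : ‖f (S t) - fn n Y‖ ≤ (L + 1) * ε := by
      have e1 : ‖f (S t) - f Y‖ ≤ L * ε := by
        rw [norm_sub_rev] at hwS
        exact (hL.norm_sub_le _ _).trans (by gcongr)
      have e2 := h4 Y
      rw [norm_sub_rev] at e2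
      have e3 := norm_sub_le_norm_sub_add_norm_sub (f (S t)) (f Y) (fn n Y)
      linarith
    -- The cutoff fixes `fn n Y`, so the defect at `f (S t)` is that of the difference and has at
    -- most twice its norm.
    have e : cutoff (M + 1) (f (S t)) - f (S t)
        = cutoff (M + 1) (f (S t) - fn n Y) - (f (S t) - fn n Y) := by
      rw [map_sub, hw]
      abel
    rw [e]
    have e4 := norm_sub_le (cutoff (M + 1) (f (S t) - fn n Y)) (f (S t) - fn n Y)
    have e5 := norm_cutoff_le (M + 1) (f (S t) - fn n Y)
    linarith
  have hlim : Tendsto (fun ε : ℝ => 2 * ((L + 1) * ε)) (𝓝[>] 0) (𝓝 0) := by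
    have : Tendsto (fun ε : ℝ => 2 * ((L + 1) * ε)) (𝓝 0) (𝓝 (2 * ((L + 1) * 0))) := by
      apply Continuous.tendsto
      fun_prop
    simp only [mul_zero] at this
    exact this.mono_left nhdsWithin_le_nhds
  have := ge_of_tendsto hlim (eventually_mem_nhdsWithin.mono key)
  exact sub_eq_zero.1 (norm_le_zero_iff.1 this)

theorem EventAssumption.lipschitzWith_sub {I J : Event} {p q : State → ℝ}
    (hp : m.EventAssumption P T L I p) (hq : m.EventAssumption P T L J q) :
    LipschitzWith (2 * L) fun s => p s - q s := by
  rw [two_mul]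
  exact hp.1.sub hq.1

end Models

/-! ### Mild and classical solutions -/

/-- The price and the volume density of one side of a mild solution satisfy the differential
equations of a classical solution. -/
theorem Mild.exists_solvesTransport {T M x0 : ℝ} {v0 : L2} {c : ℝ → ℝ} {F : ℝ → L2} {x : ℝ → ℝ}
    {v : ℝ → L2} (h : Mild T 0 x0 v0 c F x v) (hc : Continuous c) (hF : Continuous F) {g0 : ℝ → ℝ}
    (hv0 : v0 =ᵐ[volume] g0) (hg0 : ContDiff ℝ 1 g0)
    (hFG : ∀ s, ∃ g : ℝ → ℝ, F s =ᵐ[volume] g ∧ ContDiff ℝ 1 g ∧ ∀ y, |g y| ≤ M ∧ |deriv g y| ≤ M) :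
    (∀ t ∈ Icc 0 T, HasDerivWithinAt x (c t) (Icc 0 T) t) ∧
      ∃ u : ℝ → ℝ → ℝ, (∀ t ∈ Icc 0 T, v t =ᵐ[volume] u t) ∧ SolvesTransport T c F u := by
  choose G hG1 hG2 hG3 using hFG
  have hGc : Continuous fun z : ℝ × ℝ => G z.1 z.2 := continuous_uncurry_of_lipschitz hF hG1
    fun s => lipschitzWith_of_abs_deriv_le (hG2 s) fun y => (hG3 s y).2
  refine ⟨fun t ht => ?_, density x0 g0 c G, fun t ht => ?_,
    solvesTransport_density hg0 hc hG1 hGc hG2 fun s y => (hG3 s y).2⟩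
  · exact (hasDerivAt_priceOf x0 hc t).hasDerivWithinAt.congr h.eqOn_priceOf (h.eqOn_priceOf ht)
  · rw [h.eqOn_volumeOf ht]
    exact volumeOf_ae_eq hv0 hc hF hG1 hGc ht.1

theorem IsClassicalSolution.mildSol {T : ℝ} (hT : 0 < T) {pA pB pD pE : State → ℝ}
    {fC fF : State → L2} {s0 : State} {S : ℝ → State}
    (h : IsClassicalSolution T pA pB pD pE fC fF s0 S) (hp : Continuous fun s => pD s - pE s)
    (hq : Continuous fun s => pB s - pA s) (hf : Continuous fF) (hg : Continuous fC) :
    MildSol T 0 (fun s => pD s - pE s) (fun s => pB s - pA s) fF fC s0 S := by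
  obtain ⟨hS, rfl, hx, hy, ⟨va, hva, ha⟩, vb, hvb, hb⟩ := h
  exact ⟨mild_of_solvesTransport hT (hp.comp_continuousOn hS) (hf.comp_continuousOn hS) hx hva ha,
    mild_of_solvesTransport hT (hq.comp_continuousOn hS) (hg.comp_continuousOn hS) hy hvb hb⟩

end LOB

open LOB

theorem theorem5p2 {Ω : Type*} [MeasurableSpace Ω] (P : Measure Ω) [IsProbabilityMeasure P]
    (m : LOB.Models Ω) (T M : ℝ) (hT : 0 < T) (hM : 0 < M) (L : ℝ≥0)
    (s0 : LOB.State) (pA pB pD pE : LOB.State → ℝ)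
    (fCn fFn : ℕ → LOB.State → LOB.L2) (fC fF : LOB.State → LOB.L2)
    (hscaling : m.Scaling)
    (hinit : m.InitialAssumption M s0)
    (hmarks : m.BoundedMarks P M)
    (hA : m.EventAssumption P T L .A pA) (hB : m.EventAssumption P T L .B pB)
    (hD : m.EventAssumption P T L .D pD) (hE : m.EventAssumption P T L .E pE)
    (hC : m.PlacementAssumption P T M L .C fCn fC)
    (hF : m.PlacementAssumption P T M L .F fFn fF) :
    ∃ S : ℝ → LOB.State,
      (∀ ε : ℝ, 0 < ε →
        Tendsto (fun n => P {w | ENNReal.ofReal ε < ⨆ t ∈ Icc 0 T, ‖m.path n t w - S t‖ₑ})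
          atTop (𝓝 0)) ∧
      LOB.IsClassicalSolution T pA pB pD pE fC fF s0 S ∧
      ∀ S' : ℝ → LOB.State, LOB.IsClassicalSolution T pA pB pD pE fC fF s0 S' →
        EqOn S' S (Icc 0 T) := by
  have hdx := hscaling.tendsto_dx
  have hp := hD.lipschitzWith_sub hE
  have hq := hB.lipschitzWith_sub hA
  have hfL := hF.lipschitzWith hdx
  have hgL := hC.lipschitzWith hdx
  have hcut : ∀ {f : State → L2}, LipschitzWith L f →
      LipschitzWith L fun s => cutoff (M + 1) (f s) := fun hf =>
    LipschitzWith.of_dist_le_mul fun s s' => by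
      rw [dist_eq_norm, ← map_sub]
      refine (norm_cutoff_le _ _).trans ?_
      rw [← dist_eq_norm]
      exact hf.dist_le_mul s s'
  have hnorm := hinit.tendsto_norm_sub hdx
  have hlim : Tendsto m.init atTop (𝓝 s0) := by
    refine tendsto_iff_norm_sub_tendsto_zero.2 (hnorm.congr fun n => norm_sub_rev _ _)
  obtain ⟨g1, hg1, hg1c, -⟩ := hinit.2.2.1
  obtain ⟨g2, hg2, hg2c, -⟩ := hinit.2.2.2.1
  have hvol := hinit.2.2.2.2.2.2.1
  obtain ⟨K1, κ1, hK1, hκ1⟩ := exists_lipVol_of_tendsto hM.le (fun n => (hvol n).1.ae_eq_zero)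
    ((State.continuous_va.tendsto s0).comp hlim) hg1 hg1c
  obtain ⟨K2, κ2, hK2, hκ2⟩ := exists_lipVol_of_tendsto hM.le (fun n => (hvol n).2.ae_eq_zero)
    ((State.continuous_vb.tendsto s0).comp hlim) hg2 hg2c
  set κ3 : ℝ := ↑(M.toNNReal + M.toNNReal) * Real.sqrt (4 * (M + 1 + 1))
  set κ := max κ3 (max κ1 κ2)
  have hκ0 : 0 ≤ κ := le_trans (by positivity) (le_max_left _ _)
  replace hκ1 : TransLip κ s0.va := hκ1.mono ((le_max_left _ _).trans (le_max_right _ _))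
  replace hκ2 : TransLip κ s0.vb := hκ2.mono ((le_max_right _ _).trans (le_max_right _ _))
  have hfK : ∀ s : State, IsLipschitzVolume s.va → IsLipschitzVolume s.vb →
      TransLip κ (cutoff (M + 1) (fF s)) ∧
        cutoff (M + 1) (fF s) ∈ LipVol (M.toNNReal + M.toNNReal) := fun s ha hb =>
    (hF.transLip_cutoff hM.le ha hb).imp_left (TransLip.mono (le_max_left _ _))
  have hgK : ∀ s : State, IsLipschitzVolume s.va → IsLipschitzVolume s.vb →
      TransLip κ (cutoff (M + 1) (fC s)) ∧
        cutoff (M + 1) (fC s) ∈ LipVol (M.toNNReal + M.toNNReal) := fun s ha hb =>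
    (hC.transLip_cutoff hM.le ha hb).imp_left (TransLip.mono (le_max_left _ _))
  -- The candidate limit solves the system with truncated sources, the only one for which the
  -- translation estimates are available so far.
  obtain ⟨S, hSc, hS0, hSv, hS⟩ := exists_mildSol hT.le hκ0 hp hq (hcut hfL) (hcut hgL) hκ1 hκ2
    (LipVol.mono (le_max_left K1 K2) hK1) (LipVol.mono (le_max_right K1 K2) hK2) hfK hgK
  have hSa : Admissible T S := Admissible.of_continuousOn hSc.continuousOn
  have hconv : ∀ ε : ℝ, 0 < ε → Tendsto
      (fun n => P {w | ENNReal.ofReal ε < ⨆ t ∈ Icc 0 T, ‖m.path n t w - S t‖ₑ}) atTop (𝓝 0) :=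
    fun ε hε => Models.tendsto_measure_iSup_path hT.le hM.le hκ0 hscaling hnorm hmarks hA hB hD hE
      hC hF hp hq (hcut hfL) (hcut hgL) hS hSa hκ1 hκ2
      (fun t _ => (hfK _ (hSv t).1 (hSv t).2).1) (fun t _ => (hgK _ (hSv t).1 (hSv t).2).1) hε
  -- Convergence of the models removes the truncation along `S`, which therefore solves the original
  -- system.
  have hfS : EqOn (fun t => cutoff (M + 1) (fF (S t))) (fun t => fF (S t)) (Icc 0 T) :=
    fun t ht => hF.cutoff_limit_eq hmarks hM.le hdx hconv ht
  have hgS : EqOn (fun t => cutoff (M + 1) (fC (S t))) (fun t => fC (S t)) (Icc 0 T) :=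
    fun t ht => hC.cutoff_limit_eq hmarks hM.le hdx hconv ht
  have hmild : MildSol T 0 (fun s => pD s - pE s) (fun s => pB s - pA s) fF fC s0 S :=
    ⟨hS.1.congr (fun _ _ => rfl) hfS (fun _ _ => rfl) fun _ _ => rfl,
      hS.2.congr (fun _ _ => rfl) hgS (fun _ _ => rfl) fun _ _ => rfl⟩
  obtain ⟨hx, ha⟩ := hmild.1.exists_solvesTransport (hp.continuous.comp hSc)
    (hfL.continuous.comp hSc) hg1 hg1c fun s => hF.2.2.2.2 (S s) (hSv s).1 (hSv s).2
  obtain ⟨hy, hb⟩ := hmild.2.exists_solvesTransport (hq.continuous.comp hSc)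
    (hgL.continuous.comp hSc) hg2 hg2c fun s => hC.2.2.2.2 (S s) (hSv s).1 (hSv s).2
  refine ⟨S, hconv, ⟨hSc.continuousOn, hS0, hx, hy, ha, hb⟩, fun S' hS' t ht => ?_⟩
  have h1 := hS'.mildSol hT hp.continuous hq.continuous hfL.continuous hgL.continuous
  -- Uniqueness is stability with `δ = 0` and equal initial states; the translation estimates are
  -- needed along `S` only, so nothing more is asked of the competitor `S'`.
  have h2 := hmild.dist_le hT.le le_rfl hκ0 hp hq hfL hgL h1 hSa
    (Admissible.of_continuousOn hS'.1) hκ1 hκ2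
    (fun r hr => (congrArg (TransLip κ) (hfS hr)).mp (hfK _ (hSv r).1 (hSv r).2).1)
    (fun r hr => (congrArg (TransLip κ) (hgS hr)).mp (hgK _ (hSv r).1 (hSv r).2).1) t ht
  rw [sub_self, norm_zero, add_zero, mul_zero] at h2
  exact (sub_eq_zero.1 (norm_le_zero_iff.1 h2)).symm
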